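/- **Problems.** Graphs are non-empty, finite, simple, directed, and have integer edge weights; $n$ is the number of vertices and $M$ is any upper bound on the absolute values of the weights. The distance $d(i,j)$ is the infimum of the total weights of the directed walks from $i$ to $j$ (the empty walk has weight $0$). Thus $d(i,j)=\infty$ if $j$ is not reachable from $i$, and $d(i,j)=-\infty$ if some walk from $i$ to $j$ meets a negative cycle; $-\infty$ and $\infty$ are smaller and larger, respectively, than every integer. * $\mathsf{APSP}$: given a graph, compute the $n\times n$ matrix of all distances $d(i,j)$. * $\mathsf{CoRadius}$: given a graph with non-negative weights, report a vertex that is not a center, or report that all vertices are centers. A center is a vertex $v$ that minimizes $\max_u d(v,u)$. * $\mathsf{CoMedian}$: given a graph with non-negative weights, report a vertex that is not a median, or report that all vertices are medians. A median is a vertex $v$ that minimizes $\sum_{u\ne v} d(v,u)$. **Model.** Algorithms are random access programs in which every basic operation (memory access, addition, subtraction, multiplication, integer division, test of sign) takes one step and all numbers computed are bounded in absolute value by a fixed polynomial in $n+M$ (words of $O(\log(n+M))$ bits). A problem is solved in *subcubic time* if it is solved in time $\widetilde O(n^{3-\varepsilon})$ for some constant $\varepsilon>0$, where $\widetilde O$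 suppresses factors polylogarithmic in $n$ and $M$; that is, in at most $c\,n^{3-\varepsilon}\log^k(n+M+2)$ steps for some constants $c,k$. There is a *subcubic reduction* from $P$ to $Q$, written $P\le_{n^3}Q$, if there is a program that may call a black box for $Q$ on graphs that it has written to memory, such that for every black box that solves $Q$ in subcubic time, the program using it solves $P$ in subcubic time. Here each call is charged with the running time of the black box on the graph in question. $P$ and $Q$ are *subcubic equivalent* if $P\le_{n^3}Q$ and $Q\le_{n^3}P$. **Theorem.** $\mathsf{APSP}$, $\mathsf{CoMedian}$ and $\mathsf{CoRadius}$ are pairwise subcubic equivalent. -/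

import Mathlib

namespace Subcubic

/-! ## Weighted directed graphs and distances -/

/-- Integers extended by `∞ = ⊤` and `-∞ = ⊥`. -/
abbrev ExtInt : Type := WithBot (WithTop ℤ)

/-- A non-empty finite simple directed graph with integer edge weights, on the vertex set
`{0, …, n - 1}`. A pair `(i, j)` without an edge has weight `⊤ = ∞`. -/
structure WGraph where
  n : ℕ
  n_pos : 0 < n
  w : Fin n → Fin n → WithTop ℤ
  loopless : ∀ i, w i i = ⊤

namespace WGraph

/-- All edge weights lie between `-M` and `M`. -/
def BoundedBy (G : WGraph) (M : ℕ) : Prop :=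
  ∀ (i j : Fin G.n) (z : ℤ), G.w i j = (z : WithTop ℤ) → |z| ≤ (M : ℤ)

/-- All edge weights are non-negative. -/
def NonNeg (G : WGraph) : Prop :=
  ∀ i j : Fin G.n, 0 ≤ G.w i j

/-- `G.HasWalk i j z`: there is a directed walk (possibly empty) from `i` to `j` of total
weight `z`. -/
inductive HasWalk (G : WGraph) : Fin G.n → Fin G.n → ℤ → Prop
  | nil (i : Fin G.n) : HasWalk G i i 0
  | cons {i j k : Fin G.n} {x y : ℤ} (h : G.w i j = (x : WithTop ℤ)) (p : HasWalk G j k y) :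
      HasWalk G i k (x + y)

/-- The distance from `i` to `j`: the infimum of the weights of the walks from `i` to `j`.
It is `⊤ = ∞` if `j` cannot be reached from `i`, and `⊥ = -∞` if a negative cycle lies on some
walk from `i` to `j`. -/
noncomputable def dist (G : WGraph) (i j : Fin G.n) : ExtInt :=
  sInf {d : ExtInt | ∃ z : ℤ, G.HasWalk i j z ∧ d = ((z : WithTop ℤ) : ExtInt)}

/-- The eccentricity of `v`: the largest distance from `v` to a vertex. -/
noncomputable def ecc (G : WGraph) (v : Fin G.n) : ExtInt :=
  ⨆ u : Fin G.n, G.dist v u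

/-- The total sum of the distances from `v` to all other vertices. -/
noncomputable def distSum (G : WGraph) (v : Fin G.n) : ExtInt :=
  ∑ u ∈ Finset.univ.erase v, G.dist v u

/-- `v` is a center: its eccentricity is smallest possible. -/
def IsCenter (G : WGraph) (v : Fin G.n) : Prop :=
  ∀ u : Fin G.n, G.ecc v ≤ G.ecc u

/-- `v` is a median: its total sum of distances is smallest possible. -/
def IsMedian (G : WGraph) (v : Fin G.n) : Prop :=
  ∀ u : Fin G.n, G.distSum v ≤ G.distSum u

/-- The position of the pair `(i, j)` in an array that lists an `n × n` matrix row by row. -/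
def cell (G : WGraph) (i j : Fin G.n) : ℤ :=
  (i.val : ℤ) * (G.n : ℤ) + (j.val : ℤ)

end WGraph

/-! ## Computational problems -/

/-- A computational problem on weighted directed graphs: the admissible inputs, and which
contents of the output array are correct for a given input. -/
structure GraphProblem where
  Valid : WGraph → Prop
  IsAnswer : WGraph → (ℤ → ℤ) → Prop

/-- The integers `tag`, `val` represent the extended integer `d`: tag `0` stands for a finite
number, which is then `val`; tag `1` stands for `∞`; tag `-1` stands for `-∞`. -/
def Represents (tag val : ℤ) (d : ExtInt) : Prop :=
  (tag = 0 ∧ d = ((val : WithTop ℤ) : ExtInt)) ∨ (tag = 1 ∧ d = ⊤) ∨ (tag = -1 ∧ d = ⊥)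

/-- All Pairs Shortest Paths: output the `n × n` matrix of all distances. -/
def APSP : GraphProblem where
  Valid := fun _ => True
  IsAnswer := fun G out =>
    ∀ i j : Fin G.n, Represents (out (2 * G.cell i j)) (out (2 * G.cell i j + 1)) (G.dist i j)

/-- For a graph with non-negative weights, report a vertex that is not a center, or report
(by `-1`) that every vertex is a center. -/
def CoRadius : GraphProblem where
  Valid := WGraph.NonNeg
  IsAnswer := fun G out =>
    (out 0 = -1 ∧ ∀ v : Fin G.n, G.IsCenter v) ∨
      ∃ v : Fin G.n, out 0 = (v.val : ℤ) ∧ ¬ G.IsCenter v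

/-- For a graph with non-negative weights, report a vertex that is not a median, or report
(by `-1`) that every vertex is a median. -/
def CoMedian : GraphProblem where
  Valid := WGraph.NonNeg
  IsAnswer := fun G out =>
    (out 0 = -1 ∧ ∀ v : Fin G.n, G.IsMedian v) ∨
      ∃ v : Fin G.n, out 0 = (v.val : ℤ) ∧ ¬ G.IsMedian v

/-! ## The machine model

Random access programs, written as structured programs over finitely many integer arrays
(a scalar variable is the cell with index `0` of an array). Every basic operation takes one step,
and every number that is computed has to fit into a machine word. -/

/-- A memory state: `σ a z` is the content of cell `z` of array number `a`. -/
abbrev State : Type := ℕ → ℤ → ℤ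

/-- Integer expressions: constants, array access, and arithmetic. -/
inductive Expr : Type
  | lit (z : ℤ) : Expr
  | get (a : ℕ) (e : Expr) : Expr
  | add (e f : Expr) : Expr
  | sub (e f : Expr) : Expr
  | mul (e f : Expr) : Expr
  | div (e f : Expr) : Expr

namespace Expr

/-- The value of an expression. -/
def eval (σ : State) : Expr → ℤ
  | lit z => z
  | get a e => σ a (e.eval σ)
  | add e f => e.eval σ + f.eval σ
  | sub e f => e.eval σ - f.eval σ
  | mul e f => e.eval σ * f.eval σ
  | div e f => e.eval σ / f.eval σ

/-- The number of steps needed to evaluate an expression: one for each operation. -/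
def cost : Expr → ℕ
  | lit _ => 1
  | get _ e => e.cost + 1
  | add e f => e.cost + f.cost + 1
  | sub e f => e.cost + f.cost + 1
  | mul e f => e.cost + f.cost + 1
  | div e f => e.cost + f.cost + 1

/-- Every number that occurs in the evaluation (addresses and intermediate results included)
has absolute value at most `B`. -/
def Fits (B : ℕ) (σ : State) : Expr → Prop
  | lit z => |z| ≤ (B : ℤ)
  | get a e => e.Fits B σ ∧ |σ a (e.eval σ)| ≤ (B : ℤ)
  | add e f => e.Fits B σ ∧ f.Fits B σ ∧ |e.eval σ + f.eval σ| ≤ (B : ℤ)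
  | sub e f => e.Fits B σ ∧ f.Fits B σ ∧ |e.eval σ - f.eval σ| ≤ (B : ℤ)
  | mul e f => e.Fits B σ ∧ f.Fits B σ ∧ |e.eval σ * f.eval σ| ≤ (B : ℤ)
  | div e f => e.Fits B σ ∧ f.Fits B σ ∧ |e.eval σ / f.eval σ| ≤ (B : ℤ)

end Expr

/-- Programs. Conditions are tests of the form `0 < e`; `call` invokes the black box. -/
inductive Program : Type
  | skip : Program
  | set (a : ℕ) (i e : Expr) : Program
  | seq (p q : Program) : Program
  | ite (e : Expr) (p q : Program) : Program
  | while (e : Expr) (p : Program) : Program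
  | call : Program

/-- The input convention: array `0` holds the number of vertices in cell `0`, array `1` holds
the adjacency matrix with entries `0` and `1`, and array `2` holds the weights of the edges.
Nothing is said about any other cell. -/
def Holds (σ : State) (G : WGraph) : Prop :=
  σ 0 0 = (G.n : ℤ) ∧
    ∀ i j : Fin G.n,
      (G.w i j = ⊤ → σ 1 (G.cell i j) = 0) ∧
      ∀ z : ℤ, G.w i j = (z : WithTop ℤ) → σ 1 (G.cell i j) = 1 ∧ σ 2 (G.cell i j) = z

/-- The output convention: the answer is the content of array `3`. -/
def output (σ : State) : ℤ → ℤ := σ 3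

/-- An algorithm, seen as a black box: the output array that it produces on a given input, and
the number of steps that it takes. -/
structure BlackBox where
  answer : WGraph → ℤ → ℤ
  time : WGraph → ℕ

/-- `Exec Q β B p σ σ' t`: the program `p`, with black box `β` for the problem `Q` and with
machine words for the integers of absolute value at most `B`, started in the state `σ`, halts in
the state `σ'` after `t` steps. A call takes the graph stored in the input arrays, which has to be
an admissible input of `Q`, overwrites the output array by the answer of `β`, and is charged with
the running time of `β` on this graph. -/
inductive Exec (Q : GraphProblem) (β : BlackBox) (B : ℕ) :
    Program → State → State → ℕ → Prop
  | skip (σ : State) : Exec Q β B Program.skip σ σ 1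
  | set {a : ℕ} {i e : Expr} {σ : State} (hi : i.Fits B σ) (he : e.Fits B σ) :
      Exec Q β B (Program.set a i e) σ
        (Function.update σ a (Function.update (σ a) (i.eval σ) (e.eval σ)))
        (i.cost + e.cost + 1)
  | seq {p q : Program} {σ₁ σ₂ σ₃ : State} {s t : ℕ}
      (hp : Exec Q β B p σ₁ σ₂ s) (hq : Exec Q β B q σ₂ σ₃ t) :
      Exec Q β B (Program.seq p q) σ₁ σ₃ (s + t)
  | ite_true {e : Expr} {p q : Program} {σ σ' : State} {t : ℕ}
      (he : e.Fits B σ) (h : 0 < e.eval σ) (hp : Exec Q β B p σ σ' t) :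
      Exec Q β B (Program.ite e p q) σ σ' (e.cost + 1 + t)
  | ite_false {e : Expr} {p q : Program} {σ σ' : State} {t : ℕ}
      (he : e.Fits B σ) (h : ¬ 0 < e.eval σ) (hq : Exec Q β B q σ σ' t) :
      Exec Q β B (Program.ite e p q) σ σ' (e.cost + 1 + t)
  | while_true {e : Expr} {p : Program} {σ₁ σ₂ σ₃ : State} {s t : ℕ}
      (he : e.Fits B σ₁) (h : 0 < e.eval σ₁) (hp : Exec Q β B p σ₁ σ₂ s)
      (hw : Exec Q β B (Program.while e p) σ₂ σ₃ t) :
      Exec Q β B (Program.while e p) σ₁ σ₃ (e.cost + 1 + s + t)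
  | while_false {e : Expr} {p : Program} {σ : State}
      (he : e.Fits B σ) (h : ¬ 0 < e.eval σ) :
      Exec Q β B (Program.while e p) σ σ (e.cost + 1)
  | call {σ : State} {G : WGraph} (hG : Holds σ G) (hv : Q.Valid G) :
      Exec Q β B Program.call σ (Function.update σ 3 (β.answer G)) (β.time G + 1)

/-! ## Subcubic time and subcubic reductions -/

/-- The bound `c · n ^ (3 - ε) · (log (n + M + 2)) ^ k`. A running time is `Õ(n ^ (3 - ε))`, where
`Õ` suppresses factors polylogarithmic in `n` and in the bound `M` on the weights, if it is at
most such a bound with constants `c` and `k`. -/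
noncomputable def subcubicBound (ε : ℝ) (c k n M : ℕ) : ℝ :=
  (c : ℝ) * (n : ℝ) ^ (3 - ε) * ((Nat.log 2 (n + M + 2) : ℕ) : ℝ) ^ k

/-- The black box `β` solves the problem `Q` in (truly) subcubic time. -/
def BlackBox.SolvesSubcubic (β : BlackBox) (Q : GraphProblem) : Prop :=
  (∀ G : WGraph, Q.Valid G → Q.IsAnswer G (β.answer G)) ∧
    ∃ ε : ℝ, 0 < ε ∧ ∃ c k : ℕ, ∀ (G : WGraph) (M : ℕ), Q.Valid G → G.BoundedBy M →
      (β.time G : ℝ) ≤ subcubicBound ε c k G.n M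

/-- The program `p`, with black box `β` for the problem `Q`, solves the problem `P` in (truly)
subcubic time, on machine words of `O(log (n + M))` bits. -/
def Program.SolvesSubcubic (p : Program) (P Q : GraphProblem) (β : BlackBox) : Prop :=
  ∃ δ : ℝ, 0 < δ ∧ ∃ c k r : ℕ, ∀ (G : WGraph) (M : ℕ), P.Valid G → G.BoundedBy M →
    ∀ σ : State, Holds σ G →
      ∃ (σ' : State) (t : ℕ), Exec Q β ((G.n + M + 2) ^ r) p σ σ' t ∧
        P.IsAnswer G (output σ') ∧ (t : ℝ) ≤ subcubicBound δ c k G.n M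

/-- `P` is subcubically not harder than `Q`: there is a program that turns every black box that
solves `Q` in subcubic time into a subcubic solution of `P`. -/
def SubcubicReducible (P Q : GraphProblem) : Prop :=
  ∃ p : Program, ∀ β : BlackBox, β.SolvesSubcubic Q → p.SolvesSubcubic P Q β

/-- Subcubic equivalence: subcubic reductions in both directions. -/
def SubcubicEquivalent (P Q : GraphProblem) : Prop :=
  SubcubicReducible P Q ∧ SubcubicReducible Q P

end Subcubic

namespace Subcubic

/-! ## Program logic -/

namespace Expr

/-! `APSP` is the hub of all six reductions. Towards it there is little to do. Once all distances
are known, quadratic time suffices to compute the sum or the maximum of every row and to compare it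
with that of vertex `0`: a larger value exposes that vertex, a smaller one exposes vertex `0`, and
if all values agree every vertex is optimal (`Run.findLarger`, `Aggregate.isAnswer`). The depth lies
in solving `APSP` with a black box for `CoMedian` or `CoRadius`.

Detection. Given three `q × q` matrices, the question is whether `A i k + B k j < C i j` for some
`i`, `k`, `j`. It is encoded in a complete graph with five classes of `q` vertices and weights close
to multiples of a large number `h`. In the median graph all rows of weights have the same sum, and
the only triangle inequality that can fail is the one along the classes 0, 1, 2. Without a negative
triangle the weights are distances and all vertices tie; with one, a vertex of class 0 beats the
vertices of class 4, whose sums never change (`all_isMedian_iff`). In the center graph all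
eccentricities are `6 * h`, except that a vertex of class 0 drops below this if a path through the
classes 0, 1, 2, 3 to its own copy in class 3 is shorter than `6 * h`, which is again a negative
triangle (`all_isCenter_iff`).

From detection to products. The min-plus product of matrices of dimension `q ^ 4` is found by a
binary search for all entries at once: each round asks which entries lie below given thresholds. The
matrices are cut into blocks of size `q`, and the detector is called on each of the `q ^ 9` triples
of blocks. If it reports a negative triangle, the triple is searched exhaustively in time `q ^ 3`,
and every entry found is marked by a threshold that no sum can undercut. As each such search marks a
new one of the `q ^ 8` entries, a round costs about `q ^ 11 + q ^ 9 * t`, where `t` is the time of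
one call on `5 * q` vertices (`Run.compareAll`). For `t` about `q ^ (3 - ε)` this is `(q ^ 4) ^ (3 -
ε / 4)`, which is subcubic in the dimension (`blocks_time_le`).

From products to distances. Repeated squaring yields the minimal weights of walks with at most `s ≥
n` edges. The distance from `i` to `j` is `-∞` precisely if some vertex `v` with a negative diagonal
entry is reachable from `i` and reaches `j`; one further product finds these pairs
(`WalkMat.dist_eq`, `Run.negativeProduct`).

Word size. All stored numbers are bounded by a polynomial `Y` in `n + M`, and every expression has
at most 256 leaves, so that all intermediate results are at most `Y ^ 256` (`fits_of_small`). -/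

instance : Add Expr := ⟨Expr.add⟩
instance : Sub Expr := ⟨Expr.sub⟩
instance : Mul Expr := ⟨Expr.mul⟩
instance : Div Expr := ⟨Expr.div⟩

/-- The scalar variable stored in cell `0` of array `a`. -/
def var (a : ℕ) : Expr := get a (lit 0)

/-- The number of leaves of an expression, addresses included. -/
def leaves : Expr → ℕ
  | lit _ => 1
  | get _ e => e.leaves
  | add e f => e.leaves + f.leaves
  | sub e f => e.leaves + f.leaves
  | mul e f => e.leaves + f.leaves
  | div e f => e.leaves + f.leaves

/-- All literals and all numbers read from memory are at most `Y` in absolute value. -/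
def Small (Y : ℕ) (σ : State) : Expr → Prop
  | lit z => |z| ≤ (Y : ℤ)
  | get a e => e.Small Y σ ∧ |σ a (e.eval σ)| ≤ (Y : ℤ)
  | add e f => e.Small Y σ ∧ f.Small Y σ
  | sub e f => e.Small Y σ ∧ f.Small Y σ
  | mul e f => e.Small Y σ ∧ f.Small Y σ
  | div e f => e.Small Y σ ∧ f.Small Y σ

section
variable (σ : State) (Y : ℕ) (e f : Expr) (a : ℕ) (z : ℤ)
@[simp] theorem eval_lit : (lit z).eval σ = z := rfl
@[simp] theorem eval_get : (get a e).eval σ = σ a (e.eval σ) := rfl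
@[simp] theorem eval_var : (var a).eval σ = σ a 0 := rfl
@[simp] theorem eval_add : (e + f).eval σ = e.eval σ + f.eval σ := rfl
@[simp] theorem eval_sub : (e - f).eval σ = e.eval σ - f.eval σ := rfl
@[simp] theorem eval_mul : (e * f).eval σ = e.eval σ * f.eval σ := rfl
@[simp] theorem eval_div : (e / f).eval σ = e.eval σ / f.eval σ := rfl
@[simp] theorem small_lit : (lit z).Small Y σ ↔ |z| ≤ (Y : ℤ) := Iff.rfl
@[simp] theorem small_get :
    (get a e).Small Y σ ↔ e.Small Y σ ∧ |σ a (e.eval σ)| ≤ (Y : ℤ) := Iff.rfl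
@[simp] theorem small_var : (var a).Small Y σ ↔ |σ a 0| ≤ (Y : ℤ) := by
  simp [var]
@[simp] theorem small_add : (e + f).Small Y σ ↔ e.Small Y σ ∧ f.Small Y σ := Iff.rfl
@[simp] theorem small_sub : (e - f).Small Y σ ↔ e.Small Y σ ∧ f.Small Y σ := Iff.rfl
@[simp] theorem small_mul : (e * f).Small Y σ ↔ e.Small Y σ ∧ f.Small Y σ := Iff.rfl
@[simp] theorem small_div : (e / f).Small Y σ ↔ e.Small Y σ ∧ f.Small Y σ := Iff.rfl
end

theorem one_le_leaves (e : Expr) : 1 ≤ e.leaves := by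
  induction e <;> simp only [leaves] <;> omega

theorem pow_add_pow_le {Y a b : ℕ} (hY : 2 ≤ Y) (ha : 1 ≤ a) (hb : 1 ≤ b) :
    Y ^ a + Y ^ b ≤ Y ^ (a + b) := by
  have h1 : Y ≤ Y ^ a := Nat.le_self_pow (by omega) Y
  have h2 : Y ≤ Y ^ b := Nat.le_self_pow (by omega) Y
  rw [pow_add]
  nlinarith [Nat.mul_le_mul (hY.trans h1) (hY.trans h2)]

/-- Each operation at most multiplies the bounds of its operands: sums because `Y ^ a + Y ^ b ≤ Y ^
(a + b)` for `2 ≤ Y`, quotients because integer division does not increase the absolute value. Thus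
only literals and memory contents need to be bounded by hand. -/
theorem fits_of_small {Y B : ℕ} {σ : State} (hY : 2 ≤ Y) (e : Expr) (he : e.Small Y σ)
    (hB : Y ^ e.leaves ≤ B) : e.Fits B σ ∧ |e.eval σ| ≤ ((Y ^ e.leaves : ℕ) : ℤ) := by
  have mono : ∀ {a b : ℕ}, a ≤ b → Y ^ a ≤ Y ^ b := fun h => Nat.pow_le_pow_right (by omega) h
  have hYl : ∀ e : Expr, (Y : ℤ) ≤ ((Y ^ e.leaves : ℕ) : ℤ) := fun e => by
    exact_mod_cast Nat.le_self_pow (by have := one_le_leaves e; omega) Y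
  have hBz : ((Y ^ e.leaves : ℕ) : ℤ) ≤ (B : ℤ) := by exact_mod_cast hB
  induction e with
  | lit z =>
    have h : |z| ≤ (Y : ℤ) := he
    have := hYl (lit z)
    exact ⟨h.trans (this.trans hBz), h.trans this⟩
  | get a e ih =>
    have := hYl (get a e)
    exact ⟨⟨(ih he.1 hB hBz).1, he.2.trans (this.trans hBz)⟩, he.2.trans this⟩
  | add e f ihe ihf =>
    have he1 : Y ^ e.leaves ≤ Y ^ (add e f).leaves := mono (by simp [leaves])
    have hf1 : Y ^ f.leaves ≤ Y ^ (add e f).leaves := mono (by simp [leaves])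
    obtain ⟨h1, h2⟩ := ihe he.1 (he1.trans hB) (by exact_mod_cast he1.trans hB)
    obtain ⟨h3, h4⟩ := ihf he.2 (hf1.trans hB) (by exact_mod_cast hf1.trans hB)
    have h5 : ((Y ^ e.leaves : ℕ) : ℤ) + ((Y ^ f.leaves : ℕ) : ℤ)
        ≤ ((Y ^ (add e f).leaves : ℕ) : ℤ) := by
      exact_mod_cast pow_add_pow_le hY (one_le_leaves e) (one_le_leaves f)
    have h6 : |e.eval σ + f.eval σ| ≤ ((Y ^ (add e f).leaves : ℕ) : ℤ) :=
      (abs_add_le _ _).trans (by omega)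
    exact ⟨⟨h1, h3, h6.trans hBz⟩, h6⟩
  | sub e f ihe ihf =>
    have he1 : Y ^ e.leaves ≤ Y ^ (sub e f).leaves := mono (by simp [leaves])
    have hf1 : Y ^ f.leaves ≤ Y ^ (sub e f).leaves := mono (by simp [leaves])
    obtain ⟨h1, h2⟩ := ihe he.1 (he1.trans hB) (by exact_mod_cast he1.trans hB)
    obtain ⟨h3, h4⟩ := ihf he.2 (hf1.trans hB) (by exact_mod_cast hf1.trans hB)
    have h5 : ((Y ^ e.leaves : ℕ) : ℤ) + ((Y ^ f.leaves : ℕ) : ℤ)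
        ≤ ((Y ^ (sub e f).leaves : ℕ) : ℤ) := by
      exact_mod_cast pow_add_pow_le hY (one_le_leaves e) (one_le_leaves f)
    have h6 : |e.eval σ - f.eval σ| ≤ ((Y ^ (sub e f).leaves : ℕ) : ℤ) :=
      (abs_sub _ _).trans (by omega)
    exact ⟨⟨h1, h3, h6.trans hBz⟩, h6⟩
  | mul e f ihe ihf =>
    have he1 : Y ^ e.leaves ≤ Y ^ (mul e f).leaves := mono (by simp [leaves])
    have hf1 : Y ^ f.leaves ≤ Y ^ (mul e f).leaves := mono (by simp [leaves])
    obtain ⟨h1, h2⟩ := ihe he.1 (he1.trans hB) (by exact_mod_cast he1.trans hB)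
    obtain ⟨h3, h4⟩ := ihf he.2 (hf1.trans hB) (by exact_mod_cast hf1.trans hB)
    have h6 : |e.eval σ * f.eval σ| ≤ ((Y ^ (mul e f).leaves : ℕ) : ℤ) := by
      rw [abs_mul, leaves, pow_add, Nat.cast_mul]
      exact mul_le_mul h2 h4 (abs_nonneg _) (by positivity)
    exact ⟨⟨h1, h3, h6.trans hBz⟩, h6⟩
  | div e f ihe ihf =>
    have he1 : Y ^ e.leaves ≤ Y ^ (div e f).leaves := mono (by simp [leaves])
    have hf1 : Y ^ f.leaves ≤ Y ^ (div e f).leaves := mono (by simp [leaves])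
    obtain ⟨h1, h2⟩ := ihe he.1 (he1.trans hB) (by exact_mod_cast he1.trans hB)
    obtain ⟨h3, h4⟩ := ihf he.2 (hf1.trans hB) (by exact_mod_cast hf1.trans hB)
    have h6 : |e.eval σ / f.eval σ| ≤ ((Y ^ (div e f).leaves : ℕ) : ℤ) :=
      (Int.abs_ediv_le_abs _ _).trans (h2.trans (by exact_mod_cast he1))
    exact ⟨⟨h1, h3, h6.trans hBz⟩, h6⟩

theorem Fits.mono {B B' : ℕ} (h : B ≤ B') {σ : State} {e : Expr} (he : e.Fits B σ) :
    e.Fits B' σ := by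
  have hz : (B : ℤ) ≤ B' := by exact_mod_cast h
  induction e with
  | lit z => exact le_trans (show |z| ≤ (B : ℤ) from he) hz
  | get a e ih => exact ⟨ih he.1, he.2.trans hz⟩
  | add e f ihe ihf => exact ⟨ihe he.1, ihf he.2.1, he.2.2.trans hz⟩
  | sub e f ihe ihf => exact ⟨ihe he.1, ihf he.2.1, he.2.2.trans hz⟩
  | mul e f ihe ihf => exact ⟨ihe he.1, ihf he.2.1, he.2.2.trans hz⟩
  | div e f ihe ihf => exact ⟨ihe he.1, ihf he.2.1, he.2.2.trans hz⟩

/-- `1` if `e` and `f` have the same value, and `0` otherwise. -/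
def eqE (e f : Expr) : Expr := lit 1 / (lit 1 + (e - f) * (e - f))

-- The denominator is `1` if the values agree and at least `2` otherwise. Such indicators replace
-- branching inside expressions.
@[simp] theorem eval_eqE (σ : State) (e f : Expr) :
    (eqE e f).eval σ = if e.eval σ = f.eval σ then 1 else 0 := by
  simp only [eqE, eval_div, eval_lit, eval_add, eval_mul, eval_sub]
  split_ifs with h
  · simp [h]
  · have : 0 < (e.eval σ - f.eval σ) * (e.eval σ - f.eval σ) :=
      mul_self_pos.2 (sub_ne_zero.2 h)
    exact Int.ediv_eq_zero_of_lt (by norm_num) (by omega)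

@[simp] theorem small_eqE (σ : State) (Y : ℕ) (e f : Expr) :
    (eqE e f).Small Y σ ↔ 1 ≤ Y ∧ e.Small Y σ ∧ f.Small Y σ := by
  simp only [eqE, small_div, small_lit, small_add, small_mul, small_sub, abs_one]
  constructor
  · rintro ⟨h, -, h2, -⟩
    exact ⟨by exact_mod_cast h, h2⟩
  · rintro ⟨h, h2⟩
    have : (1 : ℤ) ≤ Y := by exact_mod_cast h
    exact ⟨this, this, h2, h2⟩

/-- The remainder of `e` modulo `f`. -/
def modE (e f : Expr) : Expr := e - (e / f) * f

@[simp] theorem eval_modE (σ : State) (e f : Expr) :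
    (modE e f).eval σ = e.eval σ % f.eval σ := by
  simp only [modE, eval_sub, eval_mul, eval_div, Int.emod_def]
  ring

@[simp] theorem small_modE (σ : State) (Y : ℕ) (e f : Expr) :
    (modE e f).Small Y σ ↔ e.Small Y σ ∧ f.Small Y σ := by
  simp only [modE, small_div, small_mul, small_sub]
  tauto

/-- `1` if `e` is positive and `0` otherwise, for `|e| < z`. -/
def posE (e z : Expr) : Expr := (e - lit 1 + z) / z

/-- The dividend lies between `0` and `2 * z - 2`, and it reaches `z` exactly when `e` is positive.
-/
theorem eval_posE {σ : State} {e z : Expr} (h : |e.eval σ| < z.eval σ) :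
    (posE e z).eval σ = if 0 < e.eval σ then 1 else 0 := by
  simp only [posE, eval_div, eval_add, eval_sub, eval_lit]
  rw [abs_lt] at h
  split_ifs with h0
  · rw [Int.ediv_eq_iff_of_pos (by omega)]
    omega
  · exact Int.ediv_eq_zero_of_lt (by omega) (by omega)

@[simp] theorem small_posE (σ : State) (Y : ℕ) (e z : Expr) :
    (posE e z).Small Y σ ↔ 1 ≤ Y ∧ e.Small Y σ ∧ z.Small Y σ := by
  simp only [posE, small_div, small_lit, small_add, small_sub, abs_one]
  have : (1 : ℤ) ≤ Y ↔ 1 ≤ Y := by exact_mod_cast Iff.rfl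
  tauto

section
variable (e f : Expr) (a : ℕ) (z : ℤ)
@[simp] theorem leaves_lit : (lit z).leaves = 1 := rfl
@[simp] theorem leaves_get : (get a e).leaves = e.leaves := rfl
@[simp] theorem leaves_var : (var a).leaves = 1 := rfl
@[simp] theorem leaves_add : (e + f).leaves = e.leaves + f.leaves := rfl
@[simp] theorem leaves_sub : (e - f).leaves = e.leaves + f.leaves := rfl
@[simp] theorem leaves_mul : (e * f).leaves = e.leaves + f.leaves := rfl
@[simp] theorem leaves_div : (e / f).leaves = e.leaves + f.leaves := rfl
@[simp] theorem leaves_eqE : (eqE e f).leaves = 2 + 2 * (e.leaves + f.leaves) := by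
  simp only [eqE, leaves_div, leaves_lit, leaves_add, leaves_mul, leaves_sub]
  ring
@[simp] theorem leaves_modE : (modE e f).leaves = 2 * (e.leaves + f.leaves) := by
  simp only [modE, leaves_div, leaves_mul, leaves_sub]
  ring
@[simp] theorem leaves_posE : (posE e f).leaves = e.leaves + 1 + 2 * f.leaves := by
  simp only [posE, leaves_div, leaves_lit, leaves_add, leaves_sub]
  ring
@[simp] theorem cost_lit : (lit z).cost = 1 := rfl
@[simp] theorem cost_get : (get a e).cost = e.cost + 1 := rfl
@[simp] theorem cost_var : (var a).cost = 2 := rfl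
@[simp] theorem cost_add : (e + f).cost = e.cost + f.cost + 1 := rfl
@[simp] theorem cost_sub : (e - f).cost = e.cost + f.cost + 1 := rfl
@[simp] theorem cost_mul : (e * f).cost = e.cost + f.cost + 1 := rfl
@[simp] theorem cost_div : (e / f).cost = e.cost + f.cost + 1 := rfl
@[simp] theorem cost_eqE : (eqE e f).cost = 2 * (e.cost + f.cost) + 7 := by
  simp only [eqE, cost_div, cost_lit, cost_add, cost_mul, cost_sub]
  ring
@[simp] theorem cost_modE : (modE e f).cost = 2 * (e.cost + f.cost) + 3 := by
  simp only [modE, cost_div, cost_mul, cost_sub]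
  ring
@[simp] theorem cost_posE : (posE e f).cost = e.cost + 2 * f.cost + 4 := by
  simp only [posE, cost_div, cost_lit, cost_add, cost_sub]
  ring
end

end Expr

open Subcubic.Expr (lit get var eqE modE posE)

/-- The state `σ` with `x` written to cell `i` of array `a`. -/
def State.upd (σ : State) (a : ℕ) (i x : ℤ) : State :=
  Function.update σ a (Function.update (σ a) i x)

namespace State

theorem upd_of_ne {σ : State} {a b : ℕ} {i x : ℤ} (h : b ≠ a) : σ.upd a i x b = σ b :=
  Function.update_of_ne h _ _

theorem upd_same {σ : State} {a : ℕ} {i x j : ℤ} :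
    σ.upd a i x a j = if j = i then x else σ a j := by
  simp [upd, Function.update_apply]

@[simp] theorem upd_cell {σ : State} {a : ℕ} {i x : ℤ} : σ.upd a i x a i = x := by
  simp [upd_same]

end State

open State

namespace Program

/-- Whether the program may write to array `a`. -/
def mod : Program → ℕ → Bool
  | skip, _ => false
  | set b _ _, a => a == b
  | seq p q, a => p.mod a || q.mod a
  | ite _ p q, a => p.mod a || q.mod a
  | .while _ p, a => p.mod a
  | call, a => a == 3

end Program

/-! ### Frame property and monotonicity of executions -/

section
variable {Q : GraphProblem} {β : BlackBox}

/-- This lets a specification mention only what a program changes; for concrete programs `mod` is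
decided by `rfl`. -/
theorem Exec.frame {B : ℕ} {p : Program} {σ σ' : State} {t : ℕ}
    (h : Exec Q β B p σ σ' t) {a : ℕ} (ha : p.mod a = false) : σ' a = σ a := by
  induction h with
  | skip => rfl
  | set hi he =>
    simp only [Program.mod] at ha
    exact Function.update_of_ne (fun h => by simp [h] at ha) _ _
  | seq _ _ ihp ihq =>
    simp only [Program.mod, Bool.or_eq_false_iff] at ha
    rw [ihq ha.2, ihp ha.1]
  | ite_true _ _ _ ih =>
    simp only [Program.mod, Bool.or_eq_false_iff] at ha
    exact ih ha.1
  | ite_false _ _ _ ih =>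
    simp only [Program.mod, Bool.or_eq_false_iff] at ha
    exact ih ha.2
  | while_true _ _ _ _ ihp ihw => rw [ihw ha, ihp ha]
  | while_false => rfl
  | call => exact Function.update_of_ne (fun h => by simp [h, Program.mod] at ha) _ _

theorem Exec.mono {B B' : ℕ} (hB : B ≤ B') {p : Program} {σ σ' : State} {t : ℕ}
    (h : Exec Q β B p σ σ' t) : Exec Q β B' p σ σ' t := by
  induction h with
  | skip => exact .skip _
  | set hi he => exact .set (hi.mono hB) (he.mono hB)
  | seq _ _ ihp ihq => exact .seq ihp ihq
  | ite_true he h _ ih => exact .ite_true (he.mono hB) h ih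
  | ite_false he h _ ih => exact .ite_false (he.mono hB) h ih
  | while_true he h _ _ ihp ihw => exact .while_true (he.mono hB) h ihp ihw
  | while_false he h => exact .while_false (he.mono hB) h
  | call hG hv => exact .call hG hv
end

/-- `Run Q β Y p σ T Φ`: on machine words bounded by `Y ^ 256`, the program `p` started in `σ` halts
within `T` steps in a state that satisfies `Φ`. -/
def Run (Q : GraphProblem) (β : BlackBox) (Y : ℕ) (p : Program) (σ : State) (T : ℕ)
    (Φ : State → Prop) : Prop :=
  ∃ σ' t, Exec Q β (Y ^ 256) p σ σ' t ∧ t ≤ T ∧ Φ σ'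

/-! ### Rules for total correctness with running times -/

section
variable {Q : GraphProblem} {β : BlackBox} {Y : ℕ} {p q : Program} {σ : State} {T T' : ℕ}
  {Φ Ψ : State → Prop}

theorem Run.frame (h : Run Q β Y p σ T Φ) :
    Run Q β Y p σ T (fun τ => Φ τ ∧ ∀ a, p.mod a = false → τ a = σ a) := by
  obtain ⟨σ', t, h, ht, hΦ⟩ := h
  exact ⟨σ', t, h, ht, hΦ, fun a ha => h.frame ha⟩

theorem Run.imp (h : Run Q β Y p σ T Φ) (hT : T ≤ T') (hΦ : ∀ τ, Φ τ → Ψ τ) :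
    Run Q β Y p σ T' Ψ := by
  obtain ⟨σ', t, h, ht, hp⟩ := h
  exact ⟨σ', t, h, ht.trans hT, hΦ _ hp⟩

theorem Run.seq (h : Run Q β Y p σ T (fun τ => Run Q β Y q τ T' Φ)) :
    Run Q β Y (p.seq q) σ (T + T') Φ := by
  obtain ⟨σ', t, h, ht, σ'', t', h', ht', hΦ⟩ := h
  exact ⟨σ'', _, .seq h h', by omega, hΦ⟩

/-- Sequential composition, with the frame of the first program made available. -/
theorem Run.seq_frame (h : Run Q β Y p σ T Ψ)
    (h' : ∀ τ, Ψ τ → (∀ a, p.mod a = false → τ a = σ a) → Run Q β Y q τ T' Φ) :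
    Run Q β Y (p.seq q) σ (T + T') Φ :=
  (h.frame.imp le_rfl fun τ hτ => h' τ hτ.1 hτ.2).seq

theorem fits_of_leaves (hY : 2 ≤ Y) {e : Expr} (he : e.Small Y σ) (hl : e.leaves ≤ 256) :
    e.Fits (Y ^ 256) σ :=
  (Expr.fits_of_small hY e he (Nat.pow_le_pow_right (by omega) hl)).1

theorem Run.ite {e : Expr} (hY : 2 ≤ Y) (hl : e.leaves ≤ 256) (he : e.Small Y σ)
    (hp : 0 < e.eval σ → Run Q β Y p σ T Φ) (hq : ¬ 0 < e.eval σ → Run Q β Y q σ T Φ) :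
    Run Q β Y (.ite e p q) σ (e.cost + 1 + T) Φ := by
  by_cases h : 0 < e.eval σ
  · obtain ⟨σ', t, h1, ht, hΦ⟩ := hp h
    exact ⟨σ', _, .ite_true (fits_of_leaves hY he hl) h h1, by omega, hΦ⟩
  · obtain ⟨σ', t, h1, ht, hΦ⟩ := hq h
    exact ⟨σ', _, .ite_false (fits_of_leaves hY he hl) h h1, by omega, hΦ⟩

theorem Run.call {G : WGraph} (hG : Holds σ G) (hv : Q.Valid G)
    (hΦ : Φ (Function.update σ 3 (β.answer G))) : Run Q β Y .call σ (β.time G + 1) Φ :=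
  ⟨_, _, .call hG hv, le_rfl, hΦ⟩

/-- Weakest precondition of a program without loops and calls. -/
def WP (Y : ℕ) : Program → (State → Prop) → State → Prop
  | .skip, Φ, σ => Φ σ
  | .set a i e, Φ, σ => i.Small Y σ ∧ e.Small Y σ ∧ Φ (σ.upd a (i.eval σ) (e.eval σ))
  | .seq p q, Φ, σ => WP Y p (WP Y q Φ) σ
  | .ite e p q, Φ, σ => e.Small Y σ ∧ (0 < e.eval σ → WP Y p Φ σ) ∧ (¬ 0 < e.eval σ → WP Y q Φ σ)
  | .while _ _, _, _ => False
  | .call, _, _ => False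

/-- A bound on the running time of a program without loops and calls. -/
def Program.cost : Program → ℕ
  | .skip => 1
  | .set _ i e => i.cost + e.cost + 1
  | .seq p q => p.cost + q.cost
  | .ite e p q => e.cost + 1 + (p.cost + q.cost)
  | .while _ _ => 0
  | .call => 0

/-- All expressions of the program have at most `256` leaves. -/
def Program.Short : Program → Prop
  | .skip => True
  | .set _ i e => i.leaves ≤ 256 ∧ e.leaves ≤ 256
  | .seq p q => p.Short ∧ q.Short
  | .ite e p q => e.leaves ≤ 256 ∧ p.Short ∧ q.Short
  | .while e p => e.leaves ≤ 256 ∧ p.Short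
  | .call => True

/-- Programs without loops and calls are verified by symbolic evaluation; `WP` is false for loops
and calls, so they need no case here. -/
theorem Run.of_wp (hY : 2 ≤ Y) (hs : p.Short) (h : WP Y p Φ σ) : Run Q β Y p σ p.cost Φ := by
  induction p generalizing σ Φ with
  | skip => exact ⟨σ, 1, .skip _, le_rfl, h⟩
  | set a i e =>
    exact ⟨_, _, .set (fits_of_leaves hY h.1 hs.1) (fits_of_leaves hY h.2.1 hs.2), le_rfl, h.2.2⟩
  | seq p q ihp ihq =>
    exact ((ihp hs.1 h).imp le_rfl fun τ hτ => ihq hs.2 hτ).seq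
  | ite e p q ihp ihq =>
    exact Run.ite hY hs.1 h.1 (fun h0 => (ihp hs.2.1 (h.2.1 h0)).imp (by omega) fun _ => id)
      (fun h0 => (ihq hs.2.2 (h.2.2 h0)).imp (by omega) fun _ => id)
  | _ => exact h.elim

theorem Run.set {a : ℕ} {i e : Expr} (hY : 2 ≤ Y) (hil : i.leaves ≤ 256) (hel : e.leaves ≤ 256)
    (hi : i.Small Y σ) (he : e.Small Y σ) (h : Φ (σ.upd a (i.eval σ) (e.eval σ))) :
    Run Q β Y (.set a i e) σ (i.cost + e.cost + 1) Φ :=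
  Run.of_wp (p := .set a i e) hY ⟨hil, hel⟩ ⟨hi, he, h⟩

/-- A loop with `n` iterations, invariant `I` and potential `V` that pays for expensive
iterations. -/
theorem Run.while_potential {e : Expr} (hY : 2 ≤ Y) (hl : e.leaves ≤ 256) (n : ℕ)
    (I : ℕ → State → Prop) (V : State → ℕ) (h0 : I 0 σ)
    (hb : ∀ k < n, ∀ τ, (∀ a, p.mod a = false → τ a = σ a) → I k τ →
      e.Small Y τ ∧ 0 < e.eval τ ∧
        ∃ E, Run Q β Y p τ (T + E) (fun τ' => I (k + 1) τ' ∧ E + V τ' ≤ V τ))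
    (hend : ∀ τ, (∀ a, p.mod a = false → τ a = σ a) → I n τ → e.Small Y τ ∧ ¬ 0 < e.eval τ) :
    Run Q β Y (.while e p) σ (n * (T + e.cost + 1) + (e.cost + 1) + V σ) (I n) := by
  -- The induction runs over the number `m` of remaining iterations.
  suffices h : ∀ m ≤ n, ∀ τ, (∀ a, p.mod a = false → τ a = σ a) → I (n - m) τ →
      Run Q β Y (.while e p) τ (m * (T + e.cost + 1) + (e.cost + 1) + V τ) (I n) from
    h n le_rfl σ (fun _ _ => rfl) (by simpa using h0)
  intro m
  induction m with
  | zero =>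
    intro _ τ hf hI
    obtain ⟨h1, h2⟩ := hend τ hf (by simpa using hI)
    exact ⟨τ, _, .while_false (fits_of_leaves hY h1 hl) h2, by omega, by simpa using hI⟩
  | succ m ih =>
    intro hm τ hf hI
    obtain ⟨h1, h2, E, h3⟩ := hb (n - (m + 1)) (by omega) τ hf hI
    obtain ⟨τ₁, s, hs, hsT, ⟨hI1, hV⟩, hf1⟩ := h3.frame
    obtain ⟨τ₂, t, ht, htT, hI2⟩ := ih (by omega) τ₁ (fun a ha => (hf1 a ha).trans (hf a ha))
      (by rwa [show n - (m + 1) + 1 = n - m by omega] at hI1)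
    refine ⟨τ₂, _, .while_true (fits_of_leaves hY h1 hl) h2 hs ht, ?_, hI2⟩
    have : (m + 1) * (T + e.cost + 1) = m * (T + e.cost + 1) + (T + e.cost + 1) := by ring
    omega

theorem Run.while {e : Expr} (hY : 2 ≤ Y) (hl : e.leaves ≤ 256) (n : ℕ)
    (I : ℕ → State → Prop) (h0 : I 0 σ)
    (hb : ∀ k < n, ∀ τ, (∀ a, p.mod a = false → τ a = σ a) → I k τ →
      e.Small Y τ ∧ 0 < e.eval τ ∧ Run Q β Y p τ T (I (k + 1)))
    (hend : ∀ τ, (∀ a, p.mod a = false → τ a = σ a) → I n τ → e.Small Y τ ∧ ¬ 0 < e.eval τ) :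
    Run Q β Y (.while e p) σ (n * (T + e.cost + 1) + (e.cost + 1)) (I n) :=
  Run.while_potential hY hl n I (fun _ => 0) h0
    (fun k hk τ hf hI => ⟨(hb k hk τ hf hI).1, (hb k hk τ hf hI).2.1, 0,
      (hb k hk τ hf hI).2.2.imp le_rfl fun _ h => ⟨h, le_rfl⟩⟩) hend

/-- The loop `for x = 0, …, N - 1 do p`. -/
def Program.for (x : ℕ) (N : Expr) (p : Program) : Program :=
  .seq (.set x (lit 0) (lit 0))
    (.while (N - var x) (.seq p (.set x (lit 0) (var x + lit 1))))

/-- The counter is incremented after the body has established `I (k + 1)`, so `hI` and `hV` demand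
that invariant and potential do not depend on it. The bound `255` leaves one leaf for the counter in
the loop condition. -/
theorem Run.for_potential {x : ℕ} {N : Expr} (hY : 2 ≤ Y) (hl : N.leaves ≤ 255) {n : ℕ}
    (hn : n ≤ Y) (I : ℕ → State → Prop) (V : State → ℕ) (hx : p.mod x = false)
    (hI : ∀ k τ z, I k τ → I k (τ.upd x 0 z)) (hV : ∀ τ z, V (τ.upd x 0 z) = V τ) (h0 : I 0 σ)
    (hN : ∀ τ, (∀ a, p.mod a = false → a ≠ x → τ a = σ a) → N.Small Y τ ∧ N.eval τ = n)
    (hb : ∀ k < n, ∀ τ, (∀ a, p.mod a = false → a ≠ x → τ a = σ a) → τ x 0 = (k : ℤ) → I k τ →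
        ∃ E, Run Q β Y p τ (T + E) (fun τ' => I (k + 1) τ' ∧ E + V τ' ≤ V τ)) :
    Run Q β Y (.for x N p) σ (n * (T + N.cost + 20) + (N.cost + 20) + V σ) (I n) := by
  have hY' : (2 : ℤ) ≤ Y := by exact_mod_cast hY
  have hn' : (n : ℤ) ≤ Y := by exact_mod_cast hn
  have hle : (N - var x).leaves ≤ 256 := by
    show N.leaves + 1 ≤ 256
    omega
  have key := Run.while_potential (Q := Q) (β := β) (T := T + 7) (e := N - var x)
    (p := .seq p (.set x (lit 0) (var x + lit 1))) (σ := σ.upd x 0 0) hY hle n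
    (fun k τ => τ x 0 = k ∧ I k τ) V ⟨by simp, hI _ _ _ h0⟩ ?_ ?_
  · refine ((Run.set hY (by simp [Expr.leaves]) (by simp [Expr.leaves])
      (by simp) (by simp) key).imp le_rfl fun _ => id).seq.imp ?_ fun _ h => h.2
    have h1 : (N - var x).cost = N.cost + 3 := rfl
    simp only [h1, hV, Expr.cost]
    have : n * (T + 7 + (N.cost + 3) + 1) ≤ n * (T + N.cost + 20) :=
      Nat.mul_le_mul_left _ (by omega)
    omega
  · rintro k hk τ hf ⟨hxk, hIk⟩
    have hf' : ∀ a, p.mod a = false → a ≠ x → τ a = σ a := fun a ha hax => by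
      rw [hf a (by simp [Program.mod, ha, hax]), upd_of_ne hax]
    obtain ⟨hs, hev⟩ := hN τ hf'
    refine ⟨?_, ?_, ?_⟩
    · simp only [Expr.small_sub, Expr.small_var, hxk]
      exact ⟨hs, by rw [Nat.abs_cast]; omega⟩
    · simp only [Expr.eval_sub, Expr.eval_var, hxk, hev]
      omega
    · obtain ⟨E, hr⟩ := hb k hk τ hf' hxk hIk
      refine ⟨E, (hr.frame.imp le_rfl ?_).seq.imp (T := T + E + 7) (by omega) (fun _ => id)⟩
      rintro τ' ⟨⟨h1, h2⟩, h3⟩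
      have hxk' : τ' x 0 = k := by rw [h3 x hx, hxk]
      refine (Run.set (a := x) (i := lit 0) (e := var x + lit 1) hY (by simp [Expr.leaves])
        (by change 1 + 1 ≤ 256; omega) ?_ ?_ ?_).imp
        (T' := 7) (by change 1 + (2 + 1 + 1) + 1 ≤ 7; omega) (fun _ => id)
      · simp
      · simp only [Expr.small_add, Expr.small_var, Expr.small_lit, hxk', abs_one, Nat.abs_cast]
        omega
      · simp only [Expr.eval_lit, Expr.eval_add, Expr.eval_var, hxk', upd_cell, hV]
        exact ⟨⟨by push_cast; ring, hI _ _ _ h1⟩, h2⟩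
  · rintro τ hf ⟨hxk, hIk⟩
    have hf' : ∀ a, p.mod a = false → a ≠ x → τ a = σ a := fun a ha hax => by
      rw [hf a (by simp [Program.mod, ha, hax]), upd_of_ne hax]
    obtain ⟨hs, hev⟩ := hN τ hf'
    refine ⟨?_, ?_⟩
    · simp only [Expr.small_sub, Expr.small_var, hxk]
      exact ⟨hs, by rw [Nat.abs_cast]; omega⟩
    · simp [hxk, hev]

theorem Run.for {x : ℕ} {N : Expr} (hY : 2 ≤ Y) (hl : N.leaves ≤ 255) {n : ℕ}
    (hn : n ≤ Y) (I : ℕ → State → Prop) (hx : p.mod x = false)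
    (hI : ∀ k τ z, I k τ → I k (τ.upd x 0 z)) (h0 : I 0 σ)
    (hN : ∀ τ, (∀ a, p.mod a = false → a ≠ x → τ a = σ a) → N.Small Y τ ∧ N.eval τ = n)
    (hb : ∀ k < n, ∀ τ, (∀ a, p.mod a = false → a ≠ x → τ a = σ a) → τ x 0 = (k : ℤ) → I k τ →
        Run Q β Y p τ T (I (k + 1))) :
    Run Q β Y (.for x N p) σ (n * (T + N.cost + 20) + (N.cost + 20)) (I n) := by
  refine (Run.for_potential (T := T) hY hl hn I (fun _ => 0) hx hI (fun _ _ => rfl) h0 hN ?_).imp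
    (by simp) (fun _ h => h)
  exact fun k hk τ hf hxk hIk => ⟨0, (hb k hk τ hf hxk hIk).imp (by simp) fun _ h => ⟨h, by simp⟩⟩

end

/-- A loop over the cells of a square matrix, whose size is the content of the scalar variable `r`.
Variable `17` is the index of the current cell, `18` is its row and `19` is its column. -/
def Program.cells (r : ℕ) (p : Program) : Program :=
  .for 17 (var r * var r) (.seq (.set 18 (lit 0) (var 17 / var r))
    (.seq (.set 19 (lit 0) (modE (var 17) (var r))) p))

/-- Array `a` holds the `k × k` matrix `f`, row by row. -/
def Mat (σ : State) (a k : ℕ) (f : ℕ → ℕ → ℤ) : Prop :=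
  ∀ i < k, ∀ j < k, σ a ((i : ℤ) * k + j) = f i j

theorem cell_lt {i j k : ℕ} (hi : i < k) (hj : j < k) : i * k + j < k * k := by
  nlinarith

theorem cell_div {i j k : ℕ} (hj : j < k) : (i * k + j) / k = i := by
  rw [mul_comm, Nat.mul_add_div (by omega), Nat.div_eq_of_lt hj, add_zero]

theorem cell_mod {i j k : ℕ} (hj : j < k) : (i * k + j) % k = j := by
  rw [mul_comm, Nat.mul_add_mod, Nat.mod_eq_of_lt hj]

theorem cell_inj {i j i' j' k : ℕ} (hj : j < k) (hj' : j' < k) :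
    i * k + j = i' * k + j' ↔ i = i' ∧ j = j' := by
  refine ⟨fun h => ?_, fun h => by rw [h.1, h.2]⟩
  have h1 := cell_div (i := i) hj
  have h2 := cell_mod (i := i) hj
  rw [h, cell_div hj'] at h1
  rw [h, cell_mod hj'] at h2
  exact ⟨h1.symm, h2.symm⟩

theorem cell_inj_int {i j i' j' k : ℕ} (hj : j < k) (hj' : j' < k) :
    (i : ℤ) * k + j = i' * k + j' ↔ i = i' ∧ j = j' := by
  rw [← cell_inj hj hj']
  exact_mod_cast Iff.rfl

section
variable {Q : GraphProblem} {β : BlackBox} {Y : ℕ} {p : Program} {σ : State} {T : ℕ}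

/-- The invariant is indexed by the number of cells that are done; quotient and remainder of this
number modulo `k` are the current row and column. Registers `17` to `19` are scratch, which is why
`I` must be insensitive to them. -/
theorem Run.cells {r k : ℕ} (hY : 2 ≤ Y) (hk0 : 0 < k) (hk : k * k ≤ Y) (I : ℕ → State → Prop)
    (hp : p.mod 17 = false) (hr : r < 17 ∨ 19 < r) (hpr : p.mod r = false) (hrk : σ r 0 = k)
    (hI : ∀ c τ τ', (∀ a, a < 17 ∨ 19 < a → τ' a = τ a) → I c τ → I c τ') (h0 : I 0 σ)
    (hb : ∀ i < k, ∀ j < k, ∀ τ, (∀ a, p.mod a = false → a < 17 ∨ 19 < a → τ a = σ a) →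
      τ 17 0 = (i : ℤ) * k + j → τ 18 0 = (i : ℤ) → τ 19 0 = (j : ℤ) → I (i * k + j) τ →
      Run Q β Y p τ T (I (i * k + j + 1))) :
    Run Q β Y (.cells r p) σ (k * k * (T + 75)) (I (k * k)) := by
  have hkY : k ≤ Y := le_trans (Nat.le_mul_self k) hk
  refine (Run.for (n := k * k) (T := T + 25) hY (by simp) hk I
    (by simp [Program.mod, hp]) (fun c τ z h => hI c τ _ (fun a ha => upd_of_ne (by omega)) h) h0
    ?_ ?_).imp (T' := k * k * (T + 75)) ?_ (fun _ h => h)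
  · intro τ hf
    simp only [Expr.small_mul, Expr.small_var, Expr.eval_mul, Expr.eval_var, hf r
      (by simp [Program.mod, hpr]; omega) (by omega), hrk, Nat.abs_cast]
    push_cast
    exact ⟨⟨by exact_mod_cast hkY, by exact_mod_cast hkY⟩, rfl⟩
  · intro c hc τ hf hτ hIc
    have hi : c / k < k := Nat.div_lt_of_lt_mul hc
    have hj : c % k < k := Nat.mod_lt _ hk0
    have hck : c / k * k + c % k = c := Nat.div_add_mod' c k
    have hτr : τ r 0 = k := by
      rw [hf r (by simp [Program.mod, hpr]; omega) (by omega), hrk]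
    have hcY : c ≤ Y := by omega
    refine ((Run.set hY (by simp) (by simp) (by simp)
      (by simp only [Expr.small_div, Expr.small_var, hτ, hτr, Nat.abs_cast]
          exact ⟨by exact_mod_cast hcY, by exact_mod_cast hkY⟩) ?_).seq (T' := T + 18)).imp
      (by change 1 + (2 + 2 + 1) + 1 + (T + 18) ≤ _; omega) (fun _ h => h)
    refine ((Run.set hY (by simp) (by simp) (by simp) ?_ ?_).seq (T' := T)).imp
      (by change 1 + (2 + (2 + 2 + 1 + 2 + 1) + 1) + 1 + T ≤ _; omega) (fun _ h => h)
    · simp only [Expr.small_modE, Expr.small_var, upd_of_ne (show 17 ≠ 18 by omega),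
        upd_of_ne (show r ≠ 18 by omega), hτ, hτr, Nat.abs_cast]
      exact ⟨by exact_mod_cast hcY, by exact_mod_cast hkY⟩
    · have hbody := hb (c / k) hi (c % k) hj ((τ.upd 18 0 (c / k : ℕ)).upd 19 0 (c % k : ℕ)) ?_ ?_ ?_
        ?_ ?_
      · rw [hck] at hbody
        simpa [upd_of_ne (show 17 ≠ 18 by omega), upd_of_ne (show r ≠ 18 by omega), hτ, hτr]
          using hbody
      · intro a ha ha'
        rw [upd_of_ne (by omega), upd_of_ne (by omega),
          hf a (by simp [Program.mod, ha]; omega) (by omega)]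
      · rw [upd_of_ne (by omega), upd_of_ne (by omega), hτ]
        exact_mod_cast hck.symm
      · rw [upd_of_ne (by omega), upd_cell]
      · rw [upd_cell]
      · rw [hck]
        exact hI c τ _ (fun a ha => by rw [upd_of_ne (by omega), upd_of_ne (by omega)]) hIc
  · change k * k * (T + 25 + 5 + 20) + (5 + 20) ≤ _
    nlinarith [Nat.mul_pos hk0 hk0]

/-- Filling array `a` with a matrix by a loop over its cells. -/
theorem Run.fill {r k a : ℕ} (f : ℕ → ℕ → ℤ) (hY : 2 ≤ Y) (hs : p.Short) (hk0 : 0 < k)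
    (hk : k * k ≤ Y) (ha : a < 17 ∨ 19 < a) (hp : ∀ b, b ≠ a → p.mod b = false)
    (hr : r < 17 ∨ 19 < r) (hra : r ≠ a) (hrk : σ r 0 = k)
    (hb : ∀ i < k, ∀ j < k, ∀ τ, (∀ b, b ≠ a → b < 17 ∨ 19 < b → τ b = σ b) →
      τ 17 0 = (i : ℤ) * k + j → τ 18 0 = (i : ℤ) → τ 19 0 = (j : ℤ) →
      τ a ((i : ℤ) * k + j) = σ a ((i : ℤ) * k + j) →
      WP Y p (fun τ' => τ' a = τ.upd a ((i : ℤ) * k + j) (f i j) a) τ) :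
    Run Q β Y (.cells r p) σ (k * k * (p.cost + 75))
      (fun τ => Mat τ a k f ∧ ∀ b, b ≠ a → b < 17 ∨ 19 < b → τ b = σ b) := by
  refine ((Run.cells (T := p.cost) hY hk0 hk (fun c τ => ∀ i < k, ∀ j < k,
    τ a ((i : ℤ) * k + j) = if i * k + j < c then f i j else σ a ((i : ℤ) * k + j))
    (hp _ (by omega)) hr (hp _ hra) hrk ?_ ?_ ?_).frame).imp le_rfl ?_
  · intro c τ τ' h hτ
    rwa [h a ha]
  · intro i _ j _
    simp
  · intro i hi j hj τ hf h17 h18 h19 hI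
    refine (Run.of_wp hY hs (hb i hi j hj τ (fun b hb => hf b (hp b hb)) h17 h18 h19
      (by simpa using hI i hi j hj))).imp le_rfl ?_
    intro τ' hτ' i' hi' j' hj'
    rw [hτ', upd_same, hI i' hi' j' hj']
    by_cases h : i' = i ∧ j' = j
    · simp [h.1, h.2]
    · have h1 : i' * k + j' ≠ i * k + j := fun h' => h ((cell_inj hj' hj).1 h')
      rw [if_neg (fun h' => h ((cell_inj_int hj' hj).1 h'))]
      exact if_congr (by omega) rfl rfl
  · rintro τ ⟨h1, h2⟩
    refine ⟨fun i hi j hj => ?_, fun b hb hb' => h2 b ?_⟩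
    · rw [h1 i hi j hj, if_pos (cell_lt hi hj)]
    · simp only [Program.cells, Program.for, Program.mod, hp b hb]
      simp
      omega

/-- Filling array `a` with the values of an expression. -/
theorem Run.fill_expr {r k a : ℕ} {e : Expr} (f : ℕ → ℕ → ℤ) (hY : 2 ≤ Y) (hs : e.leaves ≤ 256)
    (hk0 : 0 < k) (hk : k * k ≤ Y) (ha : a < 17 ∨ 19 < a)
    (hr : r < 17 ∨ 19 < r) (hra : r ≠ a) (hrk : σ r 0 = k)
    (hb : ∀ i < k, ∀ j < k, ∀ τ, (∀ b, b ≠ a → b < 17 ∨ 19 < b → τ b = σ b) →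
      τ 17 0 = (i : ℤ) * k + j → τ 18 0 = (i : ℤ) → τ 19 0 = (j : ℤ) →
      τ a ((i : ℤ) * k + j) = σ a ((i : ℤ) * k + j) → e.Small Y τ ∧ e.eval τ = f i j) :
    Run Q β Y (.cells r (.set a (var 17) e)) σ (k * k * (e.cost + 80))
      (fun τ => Mat τ a k f ∧ ∀ b, b ≠ a → b < 17 ∨ 19 < b → τ b = σ b) := by
  refine (Run.fill (p := .set a (var 17) e) f hY ⟨by simp, hs⟩ hk0 hk ha
    (fun b hb => by simp [Program.mod, hb]) hr hra hrk ?_).imp ?_ (fun _ h => h)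
  · intro i hi j hj τ hf h17 h18 h19 h
    obtain ⟨h1, h2⟩ := hb i hi j hj τ hf h17 h18 h19 h
    refine ⟨?_, h1, ?_⟩
    · have := cell_lt hi hj
      rw [Expr.small_var, h17, abs_of_nonneg (by positivity)]
      exact_mod_cast (by omega : i * k + j ≤ Y)
    · rw [h2, Expr.eval_var, h17]
  · simp only [Program.cost, var, Expr.cost]
    exact Nat.mul_le_mul_left _ (by omega)
end

/-! ## Distances -/

namespace WGraph
variable {G : WGraph}

/-- The inequalities for the edges telescope along the walk. The lower bounds for distances in the
gadgets come from such potentials. -/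
theorem HasWalk.potential_le {φ : Fin G.n → ℤ}
    (h : ∀ i j (x : ℤ), G.w i j = (x : WithTop ℤ) → φ j ≤ φ i + x) {i j : Fin G.n} {z : ℤ}
    (p : G.HasWalk i j z) : φ j ≤ φ i + z := by
  induction p with
  | nil => simp
  | cons hw _ ih => linarith [h _ _ _ hw]

theorem HasWalk.single {i j : Fin G.n} {x : ℤ} (h : G.w i j = (x : WithTop ℤ)) :
    G.HasWalk i j x := by
  simpa using HasWalk.cons h (.nil j)

theorem HasWalk.append {i j k : Fin G.n} {x y : ℤ} (p : G.HasWalk i j x) (q : G.HasWalk j k y) :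
    G.HasWalk i k (x + y) := by
  induction p with
  | nil => simpa using q
  | cons h _ ih => rw [add_assoc]; exact .cons h (ih q)

theorem dist_le {i j : Fin G.n} {z : ℤ} (p : G.HasWalk i j z) :
    G.dist i j ≤ ((z : WithTop ℤ) : ExtInt) :=
  sInf_le ⟨z, p, rfl⟩

theorem le_dist {i j : Fin G.n} {D : ExtInt}
    (h : ∀ z, G.HasWalk i j z → D ≤ ((z : WithTop ℤ) : ExtInt)) : D ≤ G.dist i j := by
  refine le_sInf ?_
  rintro _ ⟨z, hz, rfl⟩
  exact h z hz

theorem coe_le_coe_int {x y : ℤ} :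
    ((x : WithTop ℤ) : ExtInt) ≤ ((y : WithTop ℤ) : ExtInt) ↔ x ≤ y := by
  rw [WithBot.coe_le_coe, WithTop.coe_le_coe]

theorem exists_int_of_le {d : ExtInt} {x y : ℤ} (h1 : ((x : WithTop ℤ) : ExtInt) ≤ d)
    (h2 : d ≤ ((y : WithTop ℤ) : ExtInt)) : ∃ e : ℤ, d = ((e : WithTop ℤ) : ExtInt) := by
  induction d using WithBot.recBotCoe with
  | bot => simp at h1
  | coe d =>
    induction d using WithTop.recTopCoe with
    | top => simp at h2
    | coe d => exact ⟨d, rfl⟩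

theorem NonNeg.walk_nonneg (h : G.NonNeg) {i j : Fin G.n} {z : ℤ} (p : G.HasWalk i j z) :
    0 ≤ z := by
  have := p.potential_le (φ := fun _ => 0) (fun i j x hx => by
    have := h i j
    rw [hx] at this
    simpa using (WithTop.coe_le_coe.1 this))
  simpa using this

theorem NonNeg.dist_nonneg (h : G.NonNeg) (i j : Fin G.n) :
    (((0 : ℤ) : WithTop ℤ) : ExtInt) ≤ G.dist i j :=
  le_dist fun _ p => coe_le_coe_int.2 (h.walk_nonneg p)

theorem NonNeg.dist_self (h : G.NonNeg) (i : Fin G.n) :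
    G.dist i i = (((0 : ℤ) : WithTop ℤ) : ExtInt) :=
  le_antisymm (dist_le (.nil i)) (h.dist_nonneg i i)

theorem coe_sum_int {ι : Type*} (s : Finset ι) (f : ι → ℤ) :
    (((∑ i ∈ s, f i : ℤ) : WithTop ℤ) : ExtInt) = ∑ i ∈ s, ((f i : WithTop ℤ) : ExtInt) := by
  classical
  induction s using Finset.induction_on with
  | empty => rfl
  | insert a s ha ih => rw [Finset.sum_insert ha, Finset.sum_insert ha, ← ih]; rfl

theorem distSum_eq {u : Fin G.n} {e : Fin G.n → ℤ}
    (h : ∀ v, v ≠ u → G.dist u v = ((e v : WithTop ℤ) : ExtInt)) :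
    G.distSum u = ((∑ v ∈ Finset.univ.erase u, e v : ℤ) : WithTop ℤ) := by
  rw [distSum, coe_sum_int]
  exact Finset.sum_congr rfl fun v hv => h v (Finset.ne_of_mem_erase hv)

end WGraph

open WGraph

/-- The complete graph on `n` vertices with weights `W`. -/
abbrev completeGraph (n : ℕ) (hn : 0 < n) (W : ℕ → ℕ → ℤ) : WGraph where
  n := n
  n_pos := hn
  w i j := if i = j then ⊤ else (W i j : ℤ)
  loopless _ := if_pos rfl

/-! ### Distances in complete graphs -/

section complete
variable {n : ℕ} {hn : 0 < n} {W : ℕ → ℕ → ℤ}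

theorem completeGraph_w {i j : Fin n} (h : i ≠ j) :
    (completeGraph n hn W).w i j = ((W i j : ℤ) : WithTop ℤ) :=
  if_neg h

theorem completeGraph_w_eq {i j : Fin n} {x : ℤ}
    (h : (completeGraph n hn W).w i j = (x : WithTop ℤ)) : i ≠ j ∧ x = W i j := by
  by_cases hij : i = j
  · subst hij
    rw [(completeGraph n hn W).loopless] at h
    exact absurd h (by simp)
  · rw [completeGraph_w hij] at h
    exact ⟨hij, (WithTop.coe_injective h).symm⟩

theorem completeGraph_nonneg (h : ∀ i < n, ∀ j < n, 0 ≤ W i j) :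
    (completeGraph n hn W).NonNeg := by
  intro i j
  by_cases hij : i = j
  · subst hij
    rw [(completeGraph n hn W).loopless]
    exact le_top
  · rw [completeGraph_w hij]
    exact WithTop.coe_le_coe.2 (h i i.2 j j.2)

theorem completeGraph_dist_le {i j : Fin n} (h : i ≠ j) :
    (completeGraph n hn W).dist i j ≤ ((W i j : WithTop ℤ) : ExtInt) :=
  dist_le (G := completeGraph n hn W) (.single (completeGraph_w h))

/-- Linear programming duality in its easy direction. Only pairs `u ≠ v` are tested, since diagonal
entries of `W` are not edges. -/
theorem completeGraph_le_dist {φ : ℕ → ℤ} {i j : Fin n} {D : ℤ}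
    (h : ∀ u < n, ∀ v < n, u ≠ v → φ v ≤ φ u + W u v) (hD : D ≤ φ j - φ i) :
    ((D : WithTop ℤ) : ExtInt) ≤ (completeGraph n hn W).dist i j := by
  refine le_dist (G := completeGraph n hn W) fun z p => coe_le_coe_int.2 ?_
  have := p.potential_le (φ := fun v => φ v.val) (fun u v x hx => by
    obtain ⟨huv, rfl⟩ := completeGraph_w_eq hx
    exact h u u.2 v v.2 (fun h => huv (Fin.ext h)))
  simp only at this
  omega

/-- In a complete graph with the triangle inequality, edges are shortest paths. -/
theorem completeGraph_dist (hW : ∀ i < n, ∀ j < n, 0 ≤ W i j) {i j : Fin n} (hij : i ≠ j)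
    (h : ∀ u < n, ∀ v < n, W i v ≤ W i u + W u v) :
    (completeGraph n hn W).dist i j = ((W i j : WithTop ℤ) : ExtInt) := by
  refine le_antisymm (completeGraph_dist_le hij)
    (completeGraph_le_dist (φ := fun v => if v = i.val then 0 else W i v) ?_ ?_)
  · intro u hu v hv _
    have h1 := h u hu v hv
    have h2 := hW i i.2 u hu
    have h3 := hW u hu v hv
    split_ifs with hv hu hu
    · simpa using h3
    · omega
    · subst hu
      omega
    · exact h1
  · simp [Fin.val_ne_iff.2 hij.symm]

theorem completeGraph_dist_eq_int (hW : ∀ i < n, ∀ j < n, 0 ≤ W i j) (i j : Fin n) :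
    ∃ e : ℤ, (completeGraph n hn W).dist i j = ((e : WithTop ℤ) : ExtInt) := by
  have h0 := (completeGraph_nonneg (hn := hn) hW)
  by_cases hij : i = j
  · exact ⟨0, hij ▸ h0.dist_self i⟩
  · exact exists_int_of_le (h0.dist_nonneg i j) (completeGraph_dist_le hij)
end complete

/-! ## Detecting negative triangles by medians and centers -/

/-- All entries of the `q × q` matrix `A` are at most `N` in absolute value. -/
def Bdd (q : ℕ) (N : ℤ) (A : ℕ → ℕ → ℤ) : Prop :=
  ∀ p < q, ∀ r < q, |A p r| ≤ N

/-- There are no `i, k, j` with `A i k + B k j < C i j`. -/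
def TriangleFree (q : ℕ) (A B C : ℕ → ℕ → ℤ) : Prop :=
  ∀ i < q, ∀ k < q, ∀ j < q, C i j ≤ A i k + B k j

/-- The weights of a graph on `5 * q` vertices, given by weights that depend on the class (the
quotient by `q`) and the position (the remainder) of the two vertices. -/
def blockWeight (q : ℕ) (w : ℕ → ℕ → ℕ → ℕ → ℤ) (u v : ℕ) : ℤ :=
  w (u / q) (u % q) (v / q) (v % q)

/-- The complete graph with the given block weights. -/
abbrev blockGraph (q : ℕ) (hq : 0 < 5 * q) (w : ℕ → ℕ → ℕ → ℕ → ℤ) : WGraph :=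
  completeGraph (5 * q) hq (blockWeight q w)

theorem block_vertex_lt {q d r : ℕ} (hd : d < 5) (hr : r < q) : d * q + r < 5 * q := by
  nlinarith

theorem blockWeight_mk {q : ℕ} {w : ℕ → ℕ → ℕ → ℕ → ℤ} {c p d r : ℕ} (hp : p < q) (hr : r < q) :
    blockWeight q w (c * q + p) (d * q + r) = w c p d r := by
  rw [blockWeight, cell_div hp, cell_div hr, cell_mod hp, cell_mod hr]

theorem sum_range_mul (f : ℕ → ℤ) (q n : ℕ) :
    ∑ v ∈ Finset.range (n * q), f v = ∑ d ∈ Finset.range n, ∑ r ∈ Finset.range q, f (d * q + r) := by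
  induction n with
  | zero => simp
  | succ n ih => rw [Finset.sum_range_succ, ← ih, Nat.succ_mul, Finset.sum_range_add]

/-- The weights of a graph in which all vertices are medians if and only if there is no
negative triangle. -/
def medianWeight (h : ℤ) (A B C : ℕ → ℕ → ℤ) : ℕ → ℕ → ℕ → ℕ → ℤ
  | 0, p, 1, r => 2 * h + A p r
  | 1, p, 2, r => 2 * h + B p r
  | 0, p, 2, r => 4 * h + C p r
  | 1, _, 0, _ => 4 * h
  | 0, p, 3, r => 3 * h - A p r
  | 0, p, 4, r => 3 * h - C p r
  | 1, p, 4, r => 3 * h - B p r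
  | _, _, _, _ => 3 * h

/-- The weights of a graph in which all vertices are centers if and only if there is no
negative triangle. -/
def radiusWeight (h : ℤ) (A B C : ℕ → ℕ → ℤ) : ℕ → ℕ → ℕ → ℕ → ℤ
  | 0, p, 1, r => 2 * h + A p r
  | 1, p, 2, r => 2 * h + B p r
  | 2, p, 3, r => 2 * h - C r p
  | 0, p, 3, r => if p = r then 6 * h else 5 * h
  | 0, _, _, _ => 5 * h
  | _, _, _, _ => 6 * h

/-! ### The graph for medians -/

section
variable {q : ℕ} {h N : ℤ} {A B C : ℕ → ℕ → ℤ}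

/-- The 25 pairs of classes collapse to five types, after which the triangle inequality becomes
linear arithmetic. -/
theorem medianWeight_cases (hA : Bdd q N A) (hB : Bdd q N B) (hC : Bdd q N C)
    {c p d r : ℕ} (hc : c < 5) (hp : p < q) (hd : d < 5) (hr : r < q) :
    (c = 0 ∧ d = 1 ∧ medianWeight h A B C c p d r = 2 * h + A p r) ∨
    (c = 1 ∧ d = 2 ∧ medianWeight h A B C c p d r = 2 * h + B p r) ∨
    (c = 0 ∧ d = 2 ∧ medianWeight h A B C c p d r = 4 * h + C p r) ∨
    (c = 1 ∧ d = 0 ∧ medianWeight h A B C c p d r = 4 * h) ∨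
    (¬ (c = 0 ∧ d = 1) ∧ ¬ (c = 1 ∧ d = 2) ∧ ¬ (c = 0 ∧ d = 2) ∧ ¬ (c = 1 ∧ d = 0) ∧
      |medianWeight h A B C c p d r - 3 * h| ≤ N) := by
  have h1 := hA p hp r hr
  have h2 := hB p hp r hr
  have h3 := hC p hp r hr
  have h4 := (abs_nonneg _).trans h1
  interval_cases c <;> interval_cases d <;> simp [medianWeight, *]

/-- Every matrix entry in a row occurs once more with the opposite sign, with classes 3 and 4 as
counterweights, and each `2 * h` is balanced by a `4 * h`; the weight `4 * h` from class 1 to class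
0 exists only for this purpose. -/
theorem medianWeight_sum (c p : ℕ) :
    ∑ d ∈ Finset.range 5, ∑ r ∈ Finset.range q, medianWeight h A B C c p d r
      = 5 * q * (3 * h) := by
  have key : ∀ f : ℕ → ℤ, ∑ d ∈ Finset.range 5, f d = f 0 + f 1 + f 2 + f 3 + f 4 := fun f => by
    simp [Finset.sum_range_succ]
  rw [key]
  match c with
  | 0 => simp [medianWeight, Finset.sum_add_distrib, Finset.sum_sub_distrib]; ring
  | 1 => simp [medianWeight, Finset.sum_add_distrib, Finset.sum_sub_distrib]; ring
  | c + 2 => simp [medianWeight]; ring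

/-- Two light edges, of weight near `2 * h`, are consecutive only along the classes 0, 1, 2, where
the inequality is the hypothesis `ht`. Any other pair of edges weighs at least `5 * h - 2 * N`, and
no edge weighs more than `4 * h + N`. -/
theorem medianWeight_triangle (hA : Bdd q N A) (hB : Bdd q N B) (hC : Bdd q N C) (hN : 12 * N ≤ h)
    (ht : TriangleFree q A B C) {a i b k c j : ℕ} (ha : a < 5) (hi : i < q) (hb : b < 5)
    (hk : k < q) (hc : c < 5) (hj : j < q) :
    medianWeight h A B C a i c j ≤ medianWeight h A B C a i b k + medianWeight h A B C b k c j := by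
  have hA1 := abs_le.1 (hA i hi k hk)
  have hB1 := abs_le.1 (hB k hk j hj)
  have hB2 := abs_le.1 (hB i hi k hk)
  have hB3 := abs_le.1 (hB i hi j hj)
  have hA2 := abs_le.1 (hA k hk j hj)
  have hA3 := abs_le.1 (hA i hi j hj)
  have hC1 := abs_le.1 (hC i hi j hj)
  have hC2 := abs_le.1 (hC k hk j hj)
  have hC3 := abs_le.1 (hC i hi k hk)
  have htr := ht i hi k hk j hj
  have e1 := medianWeight_cases (h := h) hA hB hC ha hi hc hj
  have e2 := medianWeight_cases (h := h) hA hB hC ha hi hb hk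
  have e3 := medianWeight_cases (h := h) hA hB hC hb hk hc hj
  simp only [abs_le] at e1 e2 e3
  generalize medianWeight h A B C a i c j = x at *
  generalize medianWeight h A B C a i b k = y at *
  generalize medianWeight h A B C b k c j = z at *
  rcases e1 with e1 | e1 | e1 | e1 | e1 <;> rcases e2 with e2 | e2 | e2 | e2 | e2 <;>
    rcases e3 with e3 | e3 | e3 | e3 | e3 <;> omega

theorem medianWeight_mem (hA : Bdd q N A) (hB : Bdd q N B) (hC : Bdd q N C) (hN : 12 * N ≤ h)
    {c p d r : ℕ} (hc : c < 5) (hp : p < q) (hd : d < 5) (hr : r < q) :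
    0 ≤ medianWeight h A B C c p d r ∧ medianWeight h A B C c p d r ≤ 8 * h := by
  have h1 := abs_le.1 (hA p hp r hr)
  have h2 := abs_le.1 (hB p hp r hr)
  have h3 := abs_le.1 (hC p hp r hr)
  have e1 := medianWeight_cases (h := h) hA hB hC hc hp hd hr
  simp only [abs_le] at e1
  omega

theorem radiusWeight_mem (hA : Bdd q N A) (hB : Bdd q N B) (hC : Bdd q N C) (hN : 12 * N ≤ h)
    {c p d r : ℕ} (hc : c < 5) (hp : p < q) (hd : d < 5) (hr : r < q) :
    h ≤ radiusWeight h A B C c p d r ∧ radiusWeight h A B C c p d r ≤ 6 * h := by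
  have h1 := abs_le.1 (hA p hp r hr)
  have h2 := abs_le.1 (hB p hp r hr)
  have h3 := abs_le.1 (hC r hr p hp)
  interval_cases c <;> interval_cases d <;> simp only [radiusWeight] <;> (try split_ifs) <;>
    constructor <;> omega

theorem blockWeight_mem {w : ℕ → ℕ → ℕ → ℕ → ℤ} {x y : ℤ} (hq : 0 < q)
    (hw : ∀ c < 5, ∀ p < q, ∀ d < 5, ∀ r < q, x ≤ w c p d r ∧ w c p d r ≤ y)
    {u v : ℕ} (hu : u < 5 * q) (hv : v < 5 * q) :
    x ≤ blockWeight q w u v ∧ blockWeight q w u v ≤ y :=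
  hw _ (Nat.div_lt_of_lt_mul (by omega)) _ (Nat.mod_lt _ hq) _
    (Nat.div_lt_of_lt_mul (by omega)) _ (Nat.mod_lt _ hq)

theorem blockWeight_median_sum (u : Fin (5 * q)) :
    ∑ v ∈ Finset.univ.erase u, blockWeight q (medianWeight h A B C) u v
      = 5 * q * (3 * h) - 3 * h := by
  have hq : 0 < q := by have := u.2; omega
  have h1 : ∑ v : Fin (5 * q), blockWeight q (medianWeight h A B C) u v = 5 * q * (3 * h) := by
    rw [Finset.sum_fin_eq_sum_range, ← medianWeight_sum (u.val / q) (u.val % q),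
      ← Finset.sum_congr rfl (fun d hd => Finset.sum_congr rfl fun r hr => ?_),
      ← sum_range_mul (fun v => blockWeight q (medianWeight h A B C) u v)]
    · refine Finset.sum_congr rfl fun v hv => ?_
      rw [dif_pos (Finset.mem_range.1 hv)]
    · rw [blockWeight, cell_div (Finset.mem_range.1 hr), cell_mod (Finset.mem_range.1 hr)]
  have h2 : blockWeight q (medianWeight h A B C) u u = 3 * h := by
    rw [blockWeight]
    have : u.val / q < 5 := Nat.div_lt_of_lt_mul (by omega)
    generalize u.val / q = c at *
    interval_cases c <;> rfl
  rw [Finset.sum_erase_eq_sub (Finset.mem_univ u), h1, h2]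

/-- All edges that leave a vertex of class 4 have the same weight, so no detour is shorter, whether
or not there are negative triangles. These vertices serve as the yardstick. -/
theorem median_distSum_last (hq : 0 < 5 * q) (hA : Bdd q N A) (hB : Bdd q N B) (hC : Bdd q N C)
    (hN : 12 * N ≤ h) (u : Fin (5 * q)) (hu : u.val / q = 4) :
    (blockGraph q hq (medianWeight h A B C)).distSum u
      = ((5 * q * (3 * h) - 3 * h : ℤ) : WithTop ℤ) := by
  have hw : ∀ u < 5 * q, ∀ v < 5 * q, 0 ≤ blockWeight q (medianWeight h A B C) u v :=
    fun u hu v hv => (blockWeight_mem (by omega) (fun c hc p hp d hd r hr =>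
      medianWeight_mem hA hB hC hN hc hp hd hr) hu hv).1
  rw [← blockWeight_median_sum u]
  have hrow : ∀ v, blockWeight q (medianWeight h A B C) u v = 3 * h := fun v => by
    rw [blockWeight, hu]
    rfl
  refine distSum_eq (G := blockGraph q hq (medianWeight h A B C)) fun v hv => ?_
  refine completeGraph_dist hw (Ne.symm hv) fun k hk v hv => ?_
  rw [hrow, hrow]
  linarith [hw k hk v hv]

theorem median_distSum (hq : 0 < 5 * q) (hA : Bdd q N A) (hB : Bdd q N B) (hC : Bdd q N C)
    (hN : 12 * N ≤ h) (ht : TriangleFree q A B C) (u : Fin (5 * q)) :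
    (blockGraph q hq (medianWeight h A B C)).distSum u
      = ((5 * q * (3 * h) - 3 * h : ℤ) : WithTop ℤ) := by
  have hw : ∀ u < 5 * q, ∀ v < 5 * q, 0 ≤ blockWeight q (medianWeight h A B C) u v :=
    fun u hu v hv => (blockWeight_mem (by omega) (fun c hc p hp d hd r hr =>
      medianWeight_mem hA hB hC hN hc hp hd hr) hu hv).1
  rw [← blockWeight_median_sum u]
  refine distSum_eq (G := blockGraph q hq (medianWeight h A B C)) fun v hv => ?_
  refine completeGraph_dist hw (Ne.symm hv) fun k hk v hv => ?_
  exact medianWeight_triangle hA hB hC hN ht (Nat.div_lt_of_lt_mul (by omega))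
    (Nat.mod_lt _ (by omega)) (Nat.div_lt_of_lt_mul (by omega)) (Nat.mod_lt _ (by omega))
    (Nat.div_lt_of_lt_mul (by omega)) (Nat.mod_lt _ (by omega))

/-- Distances never exceed edge weights, and all rows of weights have the same sum. A negative
triangle makes one distance from class 0 strictly smaller, so that a vertex of class 4 is no median;
otherwise all sums agree. -/
theorem all_isMedian_iff (hq : 0 < 5 * q) (hA : Bdd q N A) (hB : Bdd q N B) (hC : Bdd q N C)
    (hN : 12 * N ≤ h) :
    (∀ v, (blockGraph q hq (medianWeight h A B C)).IsMedian v) ↔ TriangleFree q A B C := by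
  refine ⟨fun hm => ?_, fun ht v u => ?_⟩
  · by_contra ht
    simp only [TriangleFree, not_forall, not_le] at ht
    obtain ⟨i, hi, k, hk, j, hj, hlt⟩ := ht
    have hw : ∀ u < 5 * q, ∀ v < 5 * q, 0 ≤ blockWeight q (medianWeight h A B C) u v :=
      fun u hu v hv => (blockWeight_mem (by omega) (fun c hc p hp d hd r hr =>
        medianWeight_mem hA hB hC hN hc hp hd hr) hu hv).1
    let u : Fin (5 * q) := ⟨0 * q + i, block_vertex_lt (by omega) hi⟩
    let m : Fin (5 * q) := ⟨1 * q + k, block_vertex_lt (by omega) hk⟩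
    let v : Fin (5 * q) := ⟨2 * q + j, block_vertex_lt (by omega) hj⟩
    let z : Fin (5 * q) := ⟨4 * q + i, block_vertex_lt (by omega) hi⟩
    have hum : u ≠ m := fun h => by have := congrArg Fin.val h; simp [u, m] at this; omega
    have hmv : m ≠ v := fun h => by have := congrArg Fin.val h; simp [m, v] at this; omega
    have huv : u ≠ v := fun h => by have := congrArg Fin.val h; simp [u, v] at this; omega
    choose e he using fun v : Fin (5 * q) => completeGraph_dist_eq_int (hn := hq) hw u v
    have h1 := distSum_eq (G := blockGraph q hq (medianWeight h A B C)) (u := u) (e := e)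
      fun v _ => he v
    have h2 := hm z u
    rw [median_distSum_last hq hA hB hC hN z (cell_div hi), h1, coe_le_coe_int,
      ← blockWeight_median_sum u] at h2
    refine absurd h2 (not_le.2 (Finset.sum_lt_sum (fun x hx => ?_) ⟨v, ?_, ?_⟩))
    · have := completeGraph_dist_le (hn := hq) (W := blockWeight q (medianWeight h A B C))
        (Finset.ne_of_mem_erase hx).symm
      rwa [he, coe_le_coe_int] at this
    · simp [huv.symm]
    · have h3 := dist_le (G := blockGraph q hq (medianWeight h A B C))
        (.cons (completeGraph_w hum) (.single (completeGraph_w hmv)))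
      rw [he, coe_le_coe_int] at h3
      refine h3.trans_lt ?_
      simp only [u, m, v, blockWeight_mk hi hk, blockWeight_mk hi hj, blockWeight_mk hk hj,
        medianWeight]
      linarith
  · rw [median_distSum hq hA hB hC hN ht, median_distSum hq hA hB hC hN ht]

end

/-! ### The graph for centers -/

section
variable {q : ℕ} {h N : ℤ} {A B C : ℕ → ℕ → ℤ}

/-- A lower bound for distances in a block graph from a potential. -/
theorem blockGraph_le_dist {w : ℕ → ℕ → ℕ → ℕ → ℤ} (hq : 0 < 5 * q) {φ : ℕ → ℕ → ℤ}
    (hφ : ∀ c < 5, ∀ p < q, ∀ d < 5, ∀ r < q, φ d r ≤ φ c p + w c p d r ∨ (c = d ∧ p = r))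
    {u v : Fin (5 * q)} {D : ℤ}
    (hD : D ≤ φ (v / q) (v % q) - φ (u / q) (u % q)) :
    ((D : WithTop ℤ) : ExtInt) ≤ (blockGraph q hq w).dist u v := by
  refine completeGraph_le_dist (φ := fun v => φ (v / q) (v % q)) (fun x hx y hy hxy => ?_) hD
  rcases hφ (x / q) (Nat.div_lt_of_lt_mul (by omega)) (x % q) (Nat.mod_lt _ (by omega))
    (y / q) (Nat.div_lt_of_lt_mul (by omega)) (y % q) (Nat.mod_lt _ (by omega)) with h | ⟨h1, h2⟩
  · exact h
  · exact absurd (by rw [← Nat.div_add_mod x q, ← Nat.div_add_mod y q, h1, h2]) hxy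

theorem radius_ecc_le (hq : 0 < 5 * q) (hA : Bdd q N A) (hB : Bdd q N B) (hC : Bdd q N C)
    (hh : 0 ≤ h) (hN : 12 * N ≤ h) (u : Fin (5 * q)) :
    (blockGraph q hq (radiusWeight h A B C)).ecc u ≤ ((6 * h : ℤ) : WithTop ℤ) := by
  refine iSup_le fun v => ?_
  by_cases huv : u = v
  · subst huv
    exact (dist_le (.nil _)).trans (coe_le_coe_int.2 (by omega))
  · exact (completeGraph_dist_le huv).trans (coe_le_coe_int.2 (blockWeight_mem (by omega)
      (fun c hc p hp d hd r hr => radiusWeight_mem hA hB hC hN hc hp hd hr) u.2 v.2).2)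

/-- From class 4 every first step costs `6 * h`. From the classes 1, 2, 3 the far vertices are those
of class 4: entering them costs `6 * h` except from class 0, and reaching class 0 is itself
expensive. -/
theorem radius_le_ecc (hq : 0 < 5 * q) (hA : Bdd q N A) (hB : Bdd q N B) (hC : Bdd q N C)
    (hh : 0 ≤ h) (hN : 12 * N ≤ h) (u : Fin (5 * q)) (hu : u.val / q ≠ 0) :
    ((6 * h : ℤ) : WithTop ℤ) ≤ (blockGraph q hq (radiusWeight h A B C)).ecc u := by
  have hu5 : u.val / q < 5 := Nat.div_lt_of_lt_mul (by omega)
  have hup : u.val % q < q := Nat.mod_lt _ (by omega)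
  by_cases hu4 : u.val / q = 4
  · let v : Fin (5 * q) := ⟨0 * q + 0, block_vertex_lt (by omega) (by omega)⟩
    refine le_trans ?_ (le_iSup _ v)
    refine blockGraph_le_dist hq (φ := fun c p => if c = 4 ∧ p = u % q then 0 else 6 * h) ?_ ?_
    · intro c hc p hp d hd r hr
      have := radiusWeight_mem (h := h) hA hB hC hN hc hp hd hr
      by_cases h1 : c = 4 ∧ p = u % q
      · by_cases h2 : d = 4 ∧ r = u % q
        · exact Or.inr ⟨h1.1.trans h2.1.symm, h1.2.trans h2.2.symm⟩
        · left
          rw [if_pos h1, if_neg h2]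
          have : radiusWeight h A B C c p d r = 6 * h := by rw [h1.1]; rfl
          omega
      · left
        rw [if_neg h1]
        split_ifs <;> omega
    · simp [v, hu4]
  · let v : Fin (5 * q) := ⟨4 * q + 0, block_vertex_lt (by omega) (by omega)⟩
    refine le_trans ?_ (le_iSup _ v)
    -- Class 0 gets the potential `h` to make up for its cheaper edges, of weight `5 * h`, to class
    -- 4.
    refine blockGraph_le_dist hq
      (φ := fun c _ => if c = 0 then h else if c = 4 then 6 * h else 0) ?_ ?_
    · intro c hc p hp d hd r hr
      left
      have := radiusWeight_mem (h := h) hA hB hC hN hc hp hd hr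
      by_cases hd4 : d = 4
      · subst hd4
        interval_cases c <;> simp [radiusWeight] <;> omega
      · simp only [hd4, if_false]
        split_ifs <;> omega
    · have : v.val / q = 4 := cell_div (by omega)
      simp [this, hu, hu4]

/-- The far vertex is the copy of `u` in class 3. The only route that could undercut the direct edge
of weight `6 * h` runs through classes 1 and 2 and weighs `6 * h + A i k + B k j - C i j`. -/
theorem radius_le_ecc_of_triangleFree (hq : 0 < 5 * q) (hA : Bdd q N A) (hB : Bdd q N B)
    (hC : Bdd q N C) (hh : 0 ≤ h) (hN : 12 * N ≤ h) (ht : TriangleFree q A B C) (u : Fin (5 * q))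
    (hu : u.val / q = 0) :
    ((6 * h : ℤ) : WithTop ℤ) ≤ (blockGraph q hq (radiusWeight h A B C)).ecc u := by
  have hup : u.val % q < q := Nat.mod_lt _ (by omega)
  set i := u.val % q with hi
  let v : Fin (5 * q) := ⟨3 * q + i, block_vertex_lt (by omega) hup⟩
  refine le_trans ?_ (le_iSup _ v)
  -- With `C i p` in class 2, the inequality for the edges from class 1 to class 2 is the absence of
  -- negative triangles, and the edges from class 2 to the target are tight.
  let φ : ℕ → ℕ → ℤ := fun c p => match c with
    | 0 => if p = i then 0 else 5 * h
    | 1 => 2 * h + A i p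
    | 2 => 4 * h + C i p
    | 3 => if p = i then 6 * h else 5 * h
    | _ => 5 * h
  refine blockGraph_le_dist hq (φ := φ) ?_ ?_
  · intro c hc p hp d hd r hr
    have hA1 := abs_le.1 (hA i hup p hp)
    have hA2 := abs_le.1 (hA p hp r hr)
    have hA3 := abs_le.1 (hA i hup r hr)
    have hB1 := abs_le.1 (hB p hp r hr)
    have hC1 := abs_le.1 (hC r hr p hp)
    have hC2 := abs_le.1 (hC i hup p hp)
    have hC3 := abs_le.1 (hC i hup r hr)
    have htr := ht i hup p hp r hr
    interval_cases c <;> interval_cases d <;> simp only [radiusWeight, φ]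
    all_goals first
      | (left; omega)
      | (clear_value i
         clear φ v hi hu
         rcases eq_or_ne p i with h1 | h1 <;> rcases eq_or_ne r i with h2 | h2 <;>
           (try subst h1) <;> (try subst h2) <;> (try simp only [if_true, if_false, *]) <;>
           omega)
  · have h1 : v.val / q = 3 := cell_div hup
    have h2 : v.val % q = i := cell_mod hup
    rw [h1, h2, hu, ← hi]
    simp [φ]

/-- The negative triangle gives a path shorter than `6 * h` to the copy in class 3; every other
vertex is reached by an edge of weight at most `5 * h`. -/
theorem radius_ecc_lt (hq : 0 < 5 * q) (hA : Bdd q N A)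
    (hh : 0 < h) (hN : 12 * N ≤ h) {i k j : ℕ} (hi : i < q) (hk : k < q) (hj : j < q)
    (hlt : A i k + B k j < C i j) :
    (blockGraph q hq (radiusWeight h A B C)).ecc ⟨0 * q + i, block_vertex_lt (by omega) hi⟩
      ≤ ((6 * h - 1 : ℤ) : WithTop ℤ) := by
  refine iSup_le fun v => ?_
  set u : Fin (5 * q) := ⟨0 * q + i, block_vertex_lt (by omega) hi⟩ with hu
  have huq : u.val / q = 0 := cell_div hi
  have hui : u.val % q = i := cell_mod hi
  by_cases huv : u = v
  · subst huv
    exact (dist_le (.nil _)).trans (coe_le_coe_int.2 (by omega))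
  by_cases hv : v.val / q = 3 ∧ v.val % q = i
  · let a : Fin (5 * q) := ⟨1 * q + k, block_vertex_lt (by omega) hk⟩
    let b : Fin (5 * q) := ⟨2 * q + j, block_vertex_lt (by omega) hj⟩
    have ha : a.val / q = 1 := cell_div hk
    have ha' : a.val % q = k := cell_mod hk
    have hb : b.val / q = 2 := cell_div hj
    have hb' : b.val % q = j := cell_mod hj
    have hua : u ≠ a := fun h => by rw [h] at huq; omega
    have hab : a ≠ b := fun h => by rw [h] at ha; omega
    have hbv : b ≠ v := fun h => by rw [h] at hb; omega
    have h3 := dist_le (G := blockGraph q hq (radiusWeight h A B C))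
      (.cons (completeGraph_w hua) (.cons (completeGraph_w hab) (.single (completeGraph_w hbv))))
    refine h3.trans (coe_le_coe_int.2 ?_)
    simp only [blockWeight, huq, hui, ha, ha', hb, hb', hv.1, hv.2, radiusWeight]
    omega
  · refine (completeGraph_dist_le huv).trans (coe_le_coe_int.2 ?_)
    rw [blockWeight, huq, hui]
    have hv5 : v.val / q < 5 := Nat.div_lt_of_lt_mul (by rw [mul_comm]; exact v.2)
    have hvq : v.val % q < q := Nat.mod_lt _ (by omega)
    have hA1 := abs_le.1 (hA i hi _ hvq)
    generalize v.val % q = r at *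
    generalize v.val / q = d at *
    interval_cases d <;> simp only [radiusWeight]
    all_goals omega

theorem all_isCenter_iff (hq : 0 < 5 * q) (hA : Bdd q N A) (hB : Bdd q N B) (hC : Bdd q N C)
    (hh : 0 < h) (hN : 12 * N ≤ h) :
    (∀ v, (blockGraph q hq (radiusWeight h A B C)).IsCenter v) ↔ TriangleFree q A B C := by
  refine ⟨fun hm => ?_, fun ht v u => ?_⟩
  · by_contra ht
    simp only [TriangleFree, not_forall, not_le] at ht
    obtain ⟨i, hi, k, hk, j, hj, hlt⟩ := ht
    let z : Fin (5 * q) := ⟨4 * q + i, block_vertex_lt (by omega) hi⟩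
    have h1 := radius_le_ecc hq hA hB hC hh.le hN z (by rw [cell_div hi]; omega)
    have h2 := (h1.trans (hm z _)).trans (radius_ecc_lt hq hA hh hN hi hk hj hlt)
    rw [coe_le_coe_int] at h2
    omega
  · refine (radius_ecc_le hq hA hB hC hh.le hN v).trans ?_
    by_cases hu : u.val / q = 0
    · exact radius_le_ecc_of_triangleFree hq hA hB hC hh.le hN ht u hu
    · exact radius_le_ecc hq hA hB hC hh.le hN u hu

end

/-- The expression `wt` computes the block weights `w`, on which an answer to the problem `Q` tells
whether there is a negative triangle. -/
structure Detector (Q : GraphProblem) (wt : Expr)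
    (w : ℤ → (ℕ → ℕ → ℤ) → (ℕ → ℕ → ℤ) → (ℕ → ℕ → ℤ) → ℕ → ℕ → ℕ → ℕ → ℤ) : Prop where
  leaves_le : wt.leaves ≤ 256
  eval : ∀ {Y q h u v : ℕ} {N : ℤ} {σ : State} {A B C : ℕ → ℕ → ℤ}, 20 ≤ Y → q ≤ Y → h ≤ Y →
    N ≤ Y → u < 5 * q → v < 5 * q → u ≤ Y → v ≤ Y → Bdd q N A → Bdd q N B → Bdd q N C →
    Mat σ 35 q A → Mat σ 36 q B → Mat σ 37 q C → σ 5 0 = q → σ 8 0 = h → σ 18 0 = u → σ 19 0 = v →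
    wt.Small Y σ ∧ wt.eval σ = blockWeight q (w h A B C) u v
  weight_mem : ∀ {q : ℕ} {h N : ℤ} {A B C : ℕ → ℕ → ℤ}, Bdd q N A → Bdd q N B → Bdd q N C → 0 < h →
    12 * N ≤ h → ∀ c < 5, ∀ p < q, ∀ d < 5, ∀ r < q, 0 ≤ w h A B C c p d r ∧ w h A B C c p d r ≤ 8 * h
  valid : ∀ G : WGraph, G.NonNeg → Q.Valid G
  answer : ∀ {q : ℕ} {h N : ℤ} {A B C : ℕ → ℕ → ℤ} (hq : 0 < 5 * q), Bdd q N A → Bdd q N B →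
    Bdd q N C → 0 < h → 12 * N ≤ h → ∀ out, Q.IsAnswer (blockGraph q hq (w h A B C)) out →
    -1 ≤ out 0 ∧ out 0 < 5 * q ∧ (out 0 = -1 ↔ TriangleFree q A B C)

/-- The number of the pair of classes of the current row and column. -/
def classCode : Expr := var 18 / var 5 * lit 5 + var 19 / var 5

/-- The expression `e` for the pair of classes with number `k`, and `0` otherwise. -/
def onClass (k : ℤ) (e : Expr) : Expr := eqE classCode (lit k) * e

/-- The entry of the matrix in array `a` at the positions of the current row and column. -/
def posEntry (a : ℕ) : Expr := get a (modE (var 18) (var 5) * var 5 + modE (var 19) (var 5))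

/-- The entry of the transposed matrix in array `a` at the positions of the current row and
column. -/
def posEntryT (a : ℕ) : Expr := get a (modE (var 19) (var 5) * var 5 + modE (var 18) (var 5))

/-- The pair of classes `c`, `d` has the number `5 * c + d`. The base value is `3 * h`, and each
further term corrects the weight for one pair of classes. -/
def medianExpr : Expr :=
  lit 3 * var 8 + onClass 1 (posEntry 35 - var 8) + onClass 7 (posEntry 36 - var 8)
    + onClass 2 (posEntry 37 + var 8) + onClass 5 (var 8) - onClass 3 (posEntry 35)
    - onClass 4 (posEntry 37) - onClass 9 (posEntry 36)

/-- The base value is `6 * h`. The last term lowers the weight from class 0 to class 3 by `h` unless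
the positions agree. -/
def radiusExpr : Expr :=
  lit 6 * var 8 + onClass 1 (posEntry 35 - lit 4 * var 8) + onClass 7 (posEntry 36 - lit 4 * var 8)
    - onClass 13 (posEntryT 37 + lit 4 * var 8) - onClass 0 (var 8) - onClass 2 (var 8)
    - onClass 4 (var 8)
    - onClass 3 (var 8 * (lit 1 - eqE (modE (var 18) (var 5)) (modE (var 19) (var 5))))

/-! ### Evaluating the weights of the gadgets -/

section
variable {Y q h u v : ℕ} {N : ℤ} {σ : State} {A : ℕ → ℕ → ℤ} {a : ℕ}

theorem eval_onClass (h5 : σ 5 0 = q) (h18 : σ 18 0 = u) (h19 : σ 19 0 = v) (k : ℤ) (e : Expr) :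
    (onClass k e).eval σ
      = (if ((u / q : ℕ) : ℤ) * 5 + ((v / q : ℕ) : ℤ) = k then 1 else 0) * e.eval σ := by
  simp [onClass, classCode, h5, h18, h19]

theorem small_onClass (hY : 20 ≤ Y) (hq : q ≤ Y) (hu : u ≤ Y) (hv : v ≤ Y) (h5 : σ 5 0 = q)
    (h18 : σ 18 0 = u) (h19 : σ 19 0 = v) {k : ℤ} (hk : |k| ≤ 20) {e : Expr} :
    (onClass k e).Small Y σ ↔ e.Small Y σ := by
  simp only [onClass, classCode, Expr.small_mul, Expr.small_eqE, Expr.small_add, Expr.small_div,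
    Expr.small_var, Expr.small_lit, h5, h18, h19, Nat.abs_cast]
  refine and_iff_right ⟨by omega, ⟨⟨⟨?_, ?_⟩, ?_⟩, ?_, ?_⟩, ?_⟩ <;> norm_num <;> omega

theorem eval_posEntry (hq : 0 < q) (h5 : σ 5 0 = q) (h18 : σ 18 0 = u) (h19 : σ 19 0 = v)
    (hA : Mat σ a q A) : (posEntry a).eval σ = A (u % q) (v % q) := by
  simp only [posEntry, Expr.eval_get, Expr.eval_add, Expr.eval_mul, Expr.eval_modE, Expr.eval_var,
    h5, h18, h19]
  exact_mod_cast hA (u % q) (Nat.mod_lt _ hq) (v % q) (Nat.mod_lt _ hq)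

theorem eval_posEntryT (hq : 0 < q) (h5 : σ 5 0 = q) (h18 : σ 18 0 = u) (h19 : σ 19 0 = v)
    (hA : Mat σ a q A) : (posEntryT a).eval σ = A (v % q) (u % q) := by
  simp only [posEntryT, Expr.eval_get, Expr.eval_add, Expr.eval_mul, Expr.eval_modE, Expr.eval_var,
    h5, h18, h19]
  exact_mod_cast hA (v % q) (Nat.mod_lt _ hq) (u % q) (Nat.mod_lt _ hq)

theorem small_posEntry (hq0 : 0 < q) (hq : q ≤ Y) (hu : u ≤ Y) (hv : v ≤ Y) (hN : N ≤ Y)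
    (h5 : σ 5 0 = q) (h18 : σ 18 0 = u) (h19 : σ 19 0 = v) (hA : Mat σ a q A) (hb : Bdd q N A) :
    (posEntry a).Small Y σ := by
  have h := eval_posEntry hq0 h5 h18 h19 hA
  have hb := (hb (u % q) (Nat.mod_lt _ hq0) (v % q) (Nat.mod_lt _ hq0)).trans hN
  rw [posEntry] at h ⊢
  rw [Expr.eval_get] at h
  rw [Expr.small_get, h]
  refine ⟨?_, hb⟩
  simp only [Expr.small_add, Expr.small_mul, Expr.small_modE, Expr.small_var, h5, h18, h19,
    Nat.abs_cast]
  omega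

theorem small_posEntryT (hq0 : 0 < q) (hq : q ≤ Y) (hu : u ≤ Y) (hv : v ≤ Y) (hN : N ≤ Y)
    (h5 : σ 5 0 = q) (h18 : σ 18 0 = u) (h19 : σ 19 0 = v) (hA : Mat σ a q A) (hb : Bdd q N A) :
    (posEntryT a).Small Y σ := by
  have h := eval_posEntryT hq0 h5 h18 h19 hA
  have hb := (hb (v % q) (Nat.mod_lt _ hq0) (u % q) (Nat.mod_lt _ hq0)).trans hN
  rw [posEntryT] at h ⊢
  rw [Expr.eval_get] at h
  rw [Expr.small_get, h]
  refine ⟨?_, hb⟩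
  simp only [Expr.small_add, Expr.small_mul, Expr.small_modE, Expr.small_var, h5, h18, h19,
    Nat.abs_cast]
  omega
end

theorem detector_coMedian : Detector CoMedian medianExpr medianWeight where
  leaves_le := by simp [medianExpr, onClass, classCode, posEntry]
  eval {Y q h u v N σ A B C} hY hq hh hN hu hv huY hvY bA bB bC mA mB mC h5 h8 h18 h19 := by
    have hq0 : 0 < q := by omega
    constructor
    · simp only [medianExpr, Expr.small_add, Expr.small_sub, Expr.small_mul, Expr.small_var,
        small_onClass hY hq huY hvY h5 h18 h19 (show |(1 : ℤ)| ≤ 20 by norm_num),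
        small_onClass hY hq huY hvY h5 h18 h19 (show |(7 : ℤ)| ≤ 20 by norm_num),
        small_onClass hY hq huY hvY h5 h18 h19 (show |(2 : ℤ)| ≤ 20 by norm_num),
        small_onClass hY hq huY hvY h5 h18 h19 (show |(5 : ℤ)| ≤ 20 by norm_num),
        small_onClass hY hq huY hvY h5 h18 h19 (show |(3 : ℤ)| ≤ 20 by norm_num),
        small_onClass hY hq huY hvY h5 h18 h19 (show |(4 : ℤ)| ≤ 20 by norm_num),
        small_onClass hY hq huY hvY h5 h18 h19 (show |(9 : ℤ)| ≤ 20 by norm_num),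
        small_posEntry hq0 hq huY hvY hN h5 h18 h19 mA bA,
        small_posEntry hq0 hq huY hvY hN h5 h18 h19 mB bB,
        small_posEntry hq0 hq huY hvY hN h5 h18 h19 mC bC, h8, Nat.abs_cast, Expr.small_lit,
        true_and, and_true]
      norm_num
      omega
    · simp only [medianExpr, Expr.eval_add, Expr.eval_sub, Expr.eval_mul, Expr.eval_var,
        eval_onClass h5 h18 h19, eval_posEntry hq0 h5 h18 h19 mA, eval_posEntry hq0 h5 h18 h19 mB,
        eval_posEntry hq0 h5 h18 h19 mC, h8, Expr.eval_lit, blockWeight]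
      have hc : u / q < 5 := Nat.div_lt_of_lt_mul (by omega)
      have hd : v / q < 5 := Nat.div_lt_of_lt_mul (by omega)
      generalize u / q = c at *
      generalize v / q = d at *
      interval_cases c <;> interval_cases d <;> norm_num [medianWeight] <;> ring
  weight_mem bA bB bC _ hN _ hc _ hp _ hd _ hr := medianWeight_mem bA bB bC hN hc hp hd hr
  valid _ h := h
  answer {q h N A B C} hq bA bB bC _ hN out ho := by
    have key := all_isMedian_iff hq bA bB bC hN
    rcases ho with ⟨h1, h2⟩ | ⟨v, h1, h2⟩
    · exact ⟨by omega, by omega, iff_of_true h1 (key.1 h2)⟩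
    · have hv : (v.val : ℤ) < 5 * q := by exact_mod_cast v.2
      exact ⟨by omega, by omega, iff_of_false (by omega) (fun h => h2 (key.2 h v))⟩

theorem detector_coRadius : Detector CoRadius radiusExpr radiusWeight where
  leaves_le := by simp [radiusExpr, onClass, classCode, posEntry, posEntryT]
  eval {Y q h u v N σ A B C} hY hq hh hN hu hv huY hvY bA bB bC mA mB mC h5 h8 h18 h19 := by
    have hq0 : 0 < q := by omega
    constructor
    · simp only [radiusExpr, Expr.small_add, Expr.small_sub, Expr.small_mul, Expr.small_var,
        small_onClass hY hq huY hvY h5 h18 h19 (show |(1 : ℤ)| ≤ 20 by norm_num),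
        small_onClass hY hq huY hvY h5 h18 h19 (show |(7 : ℤ)| ≤ 20 by norm_num),
        small_onClass hY hq huY hvY h5 h18 h19 (show |(13 : ℤ)| ≤ 20 by norm_num),
        small_onClass hY hq huY hvY h5 h18 h19 (show |(0 : ℤ)| ≤ 20 by norm_num),
        small_onClass hY hq huY hvY h5 h18 h19 (show |(2 : ℤ)| ≤ 20 by norm_num),
        small_onClass hY hq huY hvY h5 h18 h19 (show |(4 : ℤ)| ≤ 20 by norm_num),
        small_onClass hY hq huY hvY h5 h18 h19 (show |(3 : ℤ)| ≤ 20 by norm_num),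
        small_posEntry hq0 hq huY hvY hN h5 h18 h19 mA bA,
        small_posEntry hq0 hq huY hvY hN h5 h18 h19 mB bB, Expr.small_eqE, Expr.small_modE,
        small_posEntryT hq0 hq huY hvY hN h5 h18 h19 mC bC, h5, h8, h18, h19, Nat.abs_cast,
        Expr.small_lit, true_and]
      norm_num
      omega
    · simp only [radiusExpr, Expr.eval_add, Expr.eval_sub, Expr.eval_mul, Expr.eval_var,
        eval_onClass h5 h18 h19, eval_posEntry hq0 h5 h18 h19 mA, eval_posEntry hq0 h5 h18 h19 mB,
        eval_posEntryT hq0 h5 h18 h19 mC, h8, Expr.eval_lit, blockWeight, Expr.eval_eqE,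
        Expr.eval_modE, h5, h18, h19]
      have hpr : ((u : ℤ) % q = (v : ℤ) % q) ↔ u % q = v % q := by exact_mod_cast Iff.rfl
      have hc : u / q < 5 := Nat.div_lt_of_lt_mul (by omega)
      have hd : v / q < 5 := Nat.div_lt_of_lt_mul (by omega)
      rw [if_congr hpr rfl rfl]
      generalize u / q = c at *
      generalize v / q = d at *
      interval_cases c <;> interval_cases d <;> norm_num [radiusWeight] <;> (try split_ifs) <;> ring
  weight_mem bA bB bC hh hN _ hc _ hp _ hd _ hr := by
    have := radiusWeight_mem bA bB bC hN hc hp hd hr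
    omega
  valid _ h := h
  answer {q h N A B C} hq bA bB bC hh hN out ho := by
    have key := all_isCenter_iff hq bA bB bC hh hN
    rcases ho with ⟨h1, h2⟩ | ⟨v, h1, h2⟩
    · exact ⟨by omega, by omega, iff_of_true h1 (key.1 h2)⟩
    · have hv : (v.val : ℤ) < 5 * q := by exact_mod_cast v.2
      exact ⟨by omega, by omega, iff_of_false (by omega) (fun h => h2 (key.2 h v))⟩

/-- Writing the detection graph to the input arrays and calling the black box. -/
def detect (wt : Expr) : Program :=
  .seq (.set 15 (lit 0) (lit 5 * var 5)) <|
  .seq (.cells 15 (.set 1 (var 17) (lit 1 - eqE (var 18) (var 19)))) <|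
  .seq (.cells 15 (.set 2 (var 17) wt)) <|
  .seq (.set 0 (lit 0) (var 15)) .call

/-! ### Calling the black box on a gadget -/

section
variable {Q : GraphProblem} {β : BlackBox} {wt : Expr}
  {w : ℤ → (ℕ → ℕ → ℤ) → (ℕ → ℕ → ℤ) → (ℕ → ℕ → ℤ) → ℕ → ℕ → ℕ → ℕ → ℤ}

/-- Apart from the call, the cost is that of writing `(5 * q) ^ 2` cells twice. The bounds on the
answer are kept because the answer is read by a later test and has to fit a word. -/
theorem Run.detect (D : Detector Q wt w) (hβ : ∀ G, Q.Valid G → Q.IsAnswer G (β.answer G))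
    {Y q h t : ℕ} {N : ℤ} {σ : State} {A B C : ℕ → ℕ → ℤ} (hY : 20 ≤ Y) (hq : 0 < q)
    (hqY : (5 * q) * (5 * q) ≤ Y) (hh : 0 < h) (hhY : h ≤ Y) (hNY : N ≤ Y) (hN : 12 * N ≤ h)
    (bA : Bdd q N A) (bB : Bdd q N B) (bC : Bdd q N C) (mA : Mat σ 35 q A) (mB : Mat σ 36 q B)
    (mC : Mat σ 37 q C) (h5 : σ 5 0 = q) (h8 : σ 8 0 = h)
    (ht : ∀ G : WGraph, G.n = 5 * q → G.BoundedBy (8 * h) → Q.Valid G → β.time G ≤ t) :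
    Run Q β Y (detect wt) σ (q * q * (50 * wt.cost + 5000) + t) (fun τ =>
      -1 ≤ τ 3 0 ∧ τ 3 0 < 5 * q ∧ (τ 3 0 = -1 ↔ TriangleFree q A B C)) := by
  have hY2 : 2 ≤ Y := by omega
  have hq5 : 0 < 5 * q := by omega
  have hqY' : 5 * q ≤ Y := le_trans (Nat.le_mul_self _) hqY
  have hqYz : (5 * q : ℤ) ≤ Y := by exact_mod_cast hqY'
  set G := blockGraph q hq5 (w h A B C) with hG
  have hmem : ∀ {u v}, u < 5 * q → v < 5 * q → 0 ≤ blockWeight q (w h A B C) u v ∧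
      blockWeight q (w h A B C) u v ≤ 8 * h := fun hu hv =>
    blockWeight_mem hq (D.weight_mem bA bB bC (by exact_mod_cast hh) hN) hu hv
  have hval : Q.Valid G := D.valid _ (completeGraph_nonneg fun u hu v hv => (hmem hu hv).1)
  have hbd : G.BoundedBy (8 * h) := by
    intro u v z hz
    obtain ⟨-, rfl⟩ := completeGraph_w_eq hz
    have := hmem u.2 v.2
    rw [abs_of_nonneg this.1]
    exact_mod_cast this.2
  have hans := D.answer hq5 bA bB bC (by exact_mod_cast hh) hN _ (hβ G hval)
  refine (Run.seq_frame (T := 6) (T' := 25 * (q * q) * (100 + 19) + (25 * (q * q) * (wt.cost + 80)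
    + (4 + (t + 1)))) (Run.set (Φ := fun τ => τ 15 0 = 5 * q) hY2 (by simp) (by simp) (by simp) ?_
    ?_) ?_).imp ?_ (fun _ h => h)
  · simp only [Expr.small_mul, Expr.small_lit, Expr.small_var, h5, Nat.abs_cast]
    norm_num
    omega
  · simp [h5]
  · intro τ h15 hf
    refine Run.seq_frame (T := 25 * (q * q) * (100 + 19)) ((Run.fill_expr (k := 5 * q) (a := 1)
      (e := lit 1 - eqE (var 18) (var 19)) (fun i j => if i = j then 0 else 1) hY2 (by simp) hq5 hqY
      (by omega) (by omega) (by omega) (by simpa using h15) ?_).imp ?_ (fun _ h => h.1)) ?_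
    · intro i hi j hj τ hf h17 h18 h19 _
      constructor
      · simp only [Expr.small_sub, Expr.small_lit, Expr.small_eqE, Expr.small_var, h18, h19,
          Nat.abs_cast]
        norm_num
        omega
      · simp only [Expr.eval_sub, Expr.eval_lit, Expr.eval_eqE, Expr.eval_var, h18, h19]
        norm_cast
        split_ifs <;> rfl
    · simp
      nlinarith
    intro τ₁ m1 hf1
    refine Run.seq_frame (T := 25 * (q * q) * (wt.cost + 80)) ((Run.fill_expr (k := 5 * q) (a := 2)
      (e := wt) (blockWeight q (w h A B C)) hY2 D.leaves_le hq5 hqY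
      (by omega) (by omega) (by omega) ?_ ?_).imp ?_ (fun _ h => h.1)) ?_
    · rw [hf1 15 rfl, h15]
      simp
    · intro i hi j hj τ' hf' h17 h18 h19 _
      have e5 : τ' 5 = σ 5 := by rw [hf' 5 (by omega) (by omega), hf1 5 rfl, hf 5 rfl]
      have e8 : τ' 8 = σ 8 := by rw [hf' 8 (by omega) (by omega), hf1 8 rfl, hf 8 rfl]
      have e35 : τ' 35 = σ 35 := by rw [hf' 35 (by omega) (by omega), hf1 35 rfl, hf 35 rfl]
      have e36 : τ' 36 = σ 36 := by rw [hf' 36 (by omega) (by omega), hf1 36 rfl, hf 36 rfl]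
      have e37 : τ' 37 = σ 37 := by rw [hf' 37 (by omega) (by omega), hf1 37 rfl, hf 37 rfl]
      exact D.eval (N := N) hY (by omega) hhY hNY hi hj (by omega) (by omega) bA bB bC
        (by rwa [Mat, e35]) (by rwa [Mat, e36]) (by rwa [Mat, e37]) (by rw [e5, h5])
        (by rw [e8, h8]) h18 h19
    · nlinarith
    intro τ₂ m2 hf2
    have e15 : τ₂ 15 0 = 5 * q := by rw [hf2 15 rfl, hf1 15 rfl, h15]
    refine Run.seq_frame (T := 4) (Run.set (Φ := fun τ => τ 0 0 = 5 * q) hY2 (by simp) (by simp)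
      (by simp) (by simp [e15]; omega) (by simp [e15])) ?_
    intro τ₃ h0 hf3
    have hH : Holds τ₃ G := by
      have hGn : (G.n : ℤ) = 5 * q := by push_cast [hG]; rfl
      refine ⟨by rw [h0, hGn], fun i j => ?_⟩
      have c1 := m1 i i.2 j j.2
      have c2 := m2 i i.2 j j.2
      rw [← hf2 1 rfl, ← hf3 1 rfl] at c1
      rw [← hf3 2 rfl] at c2
      push_cast at c1 c2
      rw [← hGn] at c1 c2
      refine ⟨fun hw => ?_, fun z hz => ?_⟩
      · have hij : i = j := by
          by_contra hij
          rw [completeGraph_w hij] at hw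
          exact WithTop.coe_ne_top hw
        rw [WGraph.cell]
        simpa [hij] using c1
      · obtain ⟨hij, rfl⟩ := completeGraph_w_eq hz
        rw [WGraph.cell, c1, c2, if_neg (Fin.val_ne_iff.2 hij)]
        exact ⟨rfl, rfl⟩
    refine (Run.call hH hval ?_).imp (Nat.add_le_add_right (ht G rfl hbd hval) 1) (fun _ h => h)
    simpa using hans
  · nlinarith [Nat.mul_pos hq hq]
end

/-! ## Simultaneous comparison of a min-plus product with thresholds -/

/-- The parameters of the computation: matrices have dimension `q ^ 4` and are cut into blocks of
size `q`, `X` bounds finite entries, the number `-P` marks finished entries, and `t` bounds the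
running time of the black box on the graphs that are used. -/
structure Params (Q : GraphProblem) (β : BlackBox) (Y q X P t : ℕ) : Prop where
  word : 20 ≤ Y
  q_pos : 0 < q
  X_pos : 0 < X
  q_le : 25 * q ^ 9 ≤ Y
  X_le : 800 * X ≤ Y
  P_ge : 2 * X + 2 ≤ P
  P_le : P ≤ 8 * X
  correct : ∀ G, Q.Valid G → Q.IsAnswer G (β.answer G)
  time_le : ∀ G : WGraph, G.n = 5 * q → G.BoundedBy (800 * X) → Q.Valid G → β.time G ≤ t

/-- The contents of the registers that hold the parameters. -/
structure Regs (σ : State) (q X P : ℕ) : Prop where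
  r5 : σ 5 0 = q
  r6 : σ 6 0 = (q ^ 4 : ℕ)
  r7 : σ 7 0 = X
  r8 : σ 8 0 = (100 * X : ℕ)
  r9 : σ 9 0 = P

theorem Regs.congr {σ τ : State} {q X P : ℕ} (h : Regs σ q X P) (h5 : τ 5 = σ 5) (h6 : τ 6 = σ 6)
    (h7 : τ 7 = σ 7) (h8 : τ 8 = σ 8) (h9 : τ 9 = σ 9) : Regs τ q X P :=
  ⟨by rw [h5, h.r5], by rw [h6, h.r6], by rw [h7, h.r7], by rw [h8, h.r8], by rw [h9, h.r9]⟩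

theorem Mat.congr {σ τ : State} {a k : ℕ} {f : ℕ → ℕ → ℤ} (h : Mat σ a k f) (e : τ a = σ a) :
    Mat τ a k f := by
  rwa [Mat, e]

/-- Entry of array `m` in row `e` and column `f`. -/
def entry (m : ℕ) (e f : Expr) : Expr := get m (e * var 6 + f)

/-- The global index of the position in variable `b` of the block in variable `a`. -/
def blockIx (a b : ℕ) : Expr := var a * var 5 + var b

namespace Params
variable {Q : GraphProblem} {β : BlackBox} {Y q X P t : ℕ}

theorem pow_le (H : Params Q β Y q X P t) {k : ℕ} (hk : k ≤ 9) : 25 * q ^ k ≤ Y :=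
  (Nat.mul_le_mul_left _ (Nat.pow_le_pow_right H.q_pos hk)).trans H.q_le

theorem ix_lt {x i : ℕ} (hx : x < q ^ 3) (hi : i < q) : x * q + i < q ^ 4 := by
  have : (x + 1) * q ≤ q ^ 3 * q := Nat.mul_le_mul_right _ hx
  rw [← pow_succ] at this
  nlinarith

theorem div_lt {x : ℕ} (hx : x < q ^ 4) : x / q < q ^ 3 :=
  Nat.div_lt_of_lt_mul (by rwa [mul_comm, ← pow_succ])

theorem eval_blockIx {σ : State} {a b x i : ℕ} (h5 : σ 5 0 = q) (ha : σ a 0 = x) (hb : σ b 0 = i) :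
    (blockIx a b).eval σ = ((x * q + i : ℕ) : ℤ) := by
  simp [blockIx, h5, ha, hb]

theorem small_blockIx (H : Params Q β Y q X P t) {σ : State} {a b x i : ℕ} (h5 : σ 5 0 = q)
    (ha : σ a 0 = x) (hb : σ b 0 = i) (hx : x < q ^ 3) (hi : i < q) : (blockIx a b).Small Y σ := by
  have h1 := H.pow_le (k := 1) (by omega)
  have h3 := H.pow_le (k := 3) (by omega)
  rw [pow_one] at h1
  simp only [blockIx, Expr.small_add, Expr.small_mul, Expr.small_var, h5, ha, hb, Nat.abs_cast]
  omega

theorem eval_entry {σ : State} {m i j : ℕ} {e f : Expr} {F : ℕ → ℕ → ℤ}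
    (h6 : σ 6 0 = (q ^ 4 : ℕ)) (he : e.eval σ = i) (hf : f.eval σ = j) (hi : i < q ^ 4)
    (hj : j < q ^ 4) (hF : Mat σ m (q ^ 4) F) : (entry m e f).eval σ = F i j := by
  simp only [entry, Expr.eval_get, Expr.eval_add, Expr.eval_mul, Expr.eval_var, h6, he, hf]
  exact hF i hi j hj

theorem small_entry (H : Params Q β Y q X P t) {σ : State} {m i j : ℕ} {e f : Expr}
    {F : ℕ → ℕ → ℤ} {N : ℤ} (h6 : σ 6 0 = (q ^ 4 : ℕ)) (he : e.eval σ = i) (hf : f.eval σ = j)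
    (hi : i < q ^ 4) (hj : j < q ^ 4) (hF : Mat σ m (q ^ 4) F) (hse : e.Small Y σ)
    (hsf : f.Small Y σ) (hN : N ≤ Y) (hb : Bdd (q ^ 4) N F) : (entry m e f).Small Y σ := by
  have h1 := eval_entry h6 he hf hi hj hF
  have h4 := H.pow_le (k := 4) (by omega)
  rw [entry, Expr.eval_get] at h1
  rw [entry, Expr.small_get, h1]
  refine ⟨?_, (hb i hi j hj).trans hN⟩
  simp only [Expr.small_add, Expr.small_mul, Expr.small_var, h6, Nat.abs_cast]
  exact ⟨⟨hse, by omega⟩, hsf⟩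

end Params

/-- Copying a block of the matrix in array `m` to array `m'`. -/
def copyBlock (m' m a b : ℕ) : Program :=
  .cells 5 (.set m' (var 17) (entry m (blockIx a 18) (blockIx b 19)))

section
variable {Q : GraphProblem} {β : BlackBox} {Y q X P t : ℕ} {σ : State} {A B T : ℕ → ℕ → ℤ}

theorem Run.copyBlock (H : Params Q β Y q X P t) {m' m a b x y : ℕ} {N : ℤ} {F : ℕ → ℕ → ℤ}
    (hR : Regs σ q X P) (hm' : 19 < m') (hm : 19 < m) (hmm' : m ≠ m') (ha : a < 17) (hb : b < 17)
    (hF : Mat σ m (q ^ 4) F) (hN : N ≤ Y) (hFb : Bdd (q ^ 4) N F) (hx : σ a 0 = x) (hy : σ b 0 = y)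
    (hxq : x < q ^ 3) (hyq : y < q ^ 3) :
    Run Q β Y (copyBlock m' m a b) σ (q * q * 110)
      (fun τ => Mat τ m' q (fun i j => F (x * q + i) (y * q + j))) := by
  have h1 := H.pow_le (k := 2) (by omega)
  have h0 := H.q_pos
  have hY := H.word
  refine (Run.fill_expr (e := entry m (blockIx a 18) (blockIx b 19)) _ (by omega)
    (by simp [entry, blockIx]) h0 (by rw [← sq]; omega) (by omega) (by omega) (by omega) hR.r5
    ?_).imp ?_ (fun _ h => h.1)
  · intro i hi j hj τ hf h17 h18 h19 _
    have h5 : τ 5 0 = q := by rw [hf 5 (by omega) (by omega), hR.r5]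
    have h6 : τ 6 0 = (q ^ 4 : ℕ) := by rw [hf 6 (by omega) (by omega), hR.r6]
    have hxa : τ a 0 = x := by rw [hf a (by omega) (by omega), hx]
    have hyb : τ b 0 = y := by rw [hf b (by omega) (by omega), hy]
    have hF' := hF.congr (hf m hmm' (by omega))
    have e1 := Params.eval_blockIx h5 hxa h18
    have e2 := Params.eval_blockIx h5 hyb h19
    exact ⟨H.small_entry h6 e1 e2 (Params.ix_lt hxq hi) (Params.ix_lt hyq hj) hF'
      (H.small_blockIx h5 hxa h18 hxq hi) (H.small_blockIx h5 hyb h19 hyq hj) hN hFb,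
      Params.eval_entry h6 e1 e2 (Params.ix_lt hxq hi) (Params.ix_lt hyq hj) hF'⟩
  · exact Nat.mul_le_mul_left _ (by simp [entry, blockIx])

/-- Some position of the block `c` shows that entry `i, j`, which lies in the blocks `a` and `b`, of
the min-plus product of `A` and `B` is below the threshold. -/
def Found (q : ℕ) (A B T : ℕ → ℕ → ℤ) (a b c i j : ℕ) : Prop :=
  i / q = a ∧ j / q = b ∧ ∃ k < q, A i (c * q + k) + B (c * q + k) j < T i j

/-- Comparing all sums for the entry of the current cell with its threshold. -/
def searchCell : Program :=
  .for 20 (var 5) (.ite (entry 32 (blockIx 12 18) (blockIx 13 19)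
      - entry 30 (blockIx 12 18) (blockIx 14 20) - entry 31 (blockIx 14 20) (blockIx 13 19))
    (.set 32 (blockIx 12 18 * var 6 + blockIx 13 19) (lit 0 - var 9)) .skip)

/-- The threshold may be overwritten during the search: after it has become `-P`, no comparison
succeeds any more by `hAB`, so the result depends only on the original value `z`. -/
theorem Run.searchCell (H : Params Q β Y q X P t) {a b c i j : ℕ} {z : ℤ}
    (hR : Regs σ q X P)
    (hA : Mat σ 30 (q ^ 4) A) (hB : Mat σ 31 (q ^ 4) B)
    (bA : Bdd (q ^ 4) (8 * X) A) (bB : Bdd (q ^ 4) (8 * X) B) (hz : |z| ≤ 8 * X)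
    (hAB : ∀ i < q ^ 4, ∀ k < q ^ 4, ∀ j < q ^ 4, -(P : ℤ) ≤ A i k + B k j)
    (ha : σ 12 0 = a) (hb : σ 13 0 = b) (hc : σ 14 0 = c) (h18 : σ 18 0 = i) (h19 : σ 19 0 = j)
    (ha3 : a < q ^ 3) (hb3 : b < q ^ 3) (hc3 : c < q ^ 3) (hi : i < q) (hj : j < q)
    (hT : σ 32 (((a * q + i : ℕ) : ℤ) * (q ^ 4 : ℕ) + (b * q + j : ℕ)) = z) :
    Run Q β Y searchCell σ (q * 200) (fun τ => τ 32 = σ.upd 32 (((a * q + i : ℕ) : ℤ) * (q ^ 4 : ℕ)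
          + (b * q + j : ℕ)) (if ∃ k < q, A (a * q + i) (c * q + k) + B (c * q + k) (b * q + j) < z
            then -(P : ℤ) else z) 32) := by
  have hY := H.word
  have h1 := H.pow_le (k := 1) (by omega)
  have h4 := H.pow_le (k := 4) (by omega)
  have hq0 := H.q_pos
  have hX := H.X_le
  have hP := H.P_le
  rw [pow_one] at h1
  set cell : ℤ := ((a * q + i : ℕ) : ℤ) * (q ^ 4 : ℕ) + (b * q + j : ℕ) with hcell
  refine (Run.for (n := q) (T := 150) (by omega) (by simp) (by omega)
    (fun m τ => τ 32 = σ.upd 32 cell (if ∃ k < m, A (a * q + i) (c * q + k)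
      + B (c * q + k) (b * q + j) < z then -(P : ℤ) else z) 32) rfl
    (fun m τ v h => by rw [upd_of_ne (by omega), h]) ?_ ?_ ?_).imp ?_ ?_
  · funext x
    rw [upd_same]
    split_ifs with h1 h2
    · simp at h2
    · rw [h1, hT]
    · rfl
  · intro τ hf
    rw [Expr.small_var, Expr.eval_var, hf 5 rfl (by omega), hR.r5, Nat.abs_cast]
    exact ⟨by omega, rfl⟩
  · intro k hk τ hf h20 hI
    have hR' := hR.congr (hf 5 rfl (by omega)) (hf 6 rfl (by omega)) (hf 7 rfl (by omega))
      (hf 8 rfl (by omega)) (hf 9 rfl (by omega))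
    have ha' : τ 12 0 = a := by rw [hf 12 rfl (by omega), ha]
    have hb' : τ 13 0 = b := by rw [hf 13 rfl (by omega), hb]
    have hc' : τ 14 0 = c := by rw [hf 14 rfl (by omega), hc]
    have h18' : τ 18 0 = i := by rw [hf 18 rfl (by omega), h18]
    have h19' : τ 19 0 = j := by rw [hf 19 rfl (by omega), h19]
    have hA' := hA.congr (hf 30 rfl (by omega))
    have hB' := hB.congr (hf 31 rfl (by omega))
    have ei := Params.eval_blockIx hR'.r5 ha' h18'
    have ej := Params.eval_blockIx hR'.r5 hb' h19'
    have ek := Params.eval_blockIx hR'.r5 hc' h20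
    have si := H.small_blockIx hR'.r5 ha' h18' ha3 hi
    have sj := H.small_blockIx hR'.r5 hb' h19' hb3 hj
    have sk := H.small_blockIx hR'.r5 hc' h20 hc3 hk
    have li := Params.ix_lt ha3 hi
    have lj := Params.ix_lt hb3 hj
    have lk := Params.ix_lt hc3 hk
    have eA := Params.eval_entry hR'.r6 ei ek li lk hA'
    have eB := Params.eval_entry hR'.r6 ek ej lk lj hB'
    have sA := H.small_entry hR'.r6 ei ek li lk hA' si sk (by omega) bA
    have sB := H.small_entry hR'.r6 ek ej lk lj hB' sk sj (by omega) bB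
    have eix : (blockIx 12 18 * var 6 + blockIx 13 19).eval τ = cell := by
      simp only [Expr.eval_add, Expr.eval_mul, ei, ej, Expr.eval_var, hR'.r6, hcell]
    have six : (blockIx 12 18 * var 6 + blockIx 13 19).Small Y τ := by
      simp only [Expr.small_add, Expr.small_mul, Expr.small_var, hR'.r6, Nat.abs_cast]
      exact ⟨⟨si, by omega⟩, sj⟩
    have hcur : τ 32 cell = if ∃ k' < k, A (a * q + i) (c * q + k')
        + B (c * q + k') (b * q + j) < z then -(P : ℤ) else z := by rw [hI, upd_cell]
    have eT : (entry 32 (blockIx 12 18) (blockIx 13 19)).eval τ = τ 32 cell := by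
      rw [entry, Expr.eval_get, eix]
    have sT : (entry 32 (blockIx 12 18) (blockIx 13 19)).Small Y τ := by
      rw [entry, Expr.small_get, eix, hcur]
      refine ⟨six, ?_⟩
      split_ifs
      · rw [abs_neg, Nat.abs_cast]
        omega
      · omega
    refine (Run.of_wp (by omega) (by simp [Program.Short, entry, blockIx]) ?_).imp
      (by simp [Program.cost, entry, blockIx]) (fun _ h => h)
    have hlow := hAB _ li _ lk _ lj
    simp only [WP, Expr.eval_sub, Expr.small_sub, eA, eB, eT, sA, sB, sT, true_and, six, eix,
      Expr.small_lit, Expr.small_var, hR'.r9, Expr.eval_lit, Expr.eval_var, Nat.abs_cast]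
    have hcell' : ∀ v, τ.upd 32 cell v 32 = σ.upd 32 cell v 32 := fun v => by
      funext x
      rw [upd_same, upd_same, hI]
      by_cases hx : x = cell
      · rw [if_pos hx, if_pos hx]
      · rw [if_neg hx, if_neg hx, upd_same, if_neg hx]
    refine ⟨fun h => ⟨⟨by simp, by omega⟩, ?_⟩, fun h => ?_⟩
    · rw [hcell', hcur] at *
      rw [if_pos, zero_sub]
      split_ifs at h with h'
      · omega
      · exact ⟨k, by omega, by omega⟩
    · rw [hI]
      rw [hcur] at h
      congr 1
      split_ifs with h1 h2 h2
      · rfl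
      · obtain ⟨k', hk', hlt⟩ := h1
        exact absurd ⟨k', by omega, hlt⟩ h2
      · obtain ⟨k', hk', hlt⟩ := h2
        rw [if_neg h1] at h
        rcases Nat.lt_succ_iff_lt_or_eq.1 hk' with h3 | rfl
        · exact absurd ⟨k', h3, hlt⟩ h1
        · omega
      · rfl
  · change q * (150 + 2 + 20) + (2 + 20) ≤ q * 200
    omega
  · exact fun τ hτ => hτ

end

/-- Comparing all sums for the current triple of blocks with the thresholds. -/
def searchBlock : Program := .cells 5 searchCell

open Classical in
/-- The thresholds after all entries that are found in the given triple of blocks are marked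
by `-P`. -/
noncomputable def lower (q P : ℕ) (A B T : ℕ → ℕ → ℤ) (a b c i j : ℕ) : ℤ :=
  if Found q A B T a b c i j then -(P : ℤ) else T i j

/-- The number of entries that are not marked by `-P`. -/
def pending (q P : ℕ) (σ : State) : ℕ :=
  ((Finset.range (q ^ 4) ×ˢ Finset.range (q ^ 4)).filter
    (fun x => σ 32 ((x.1 : ℤ) * (q ^ 4 : ℕ) + x.2) ≠ -(P : ℤ))).card

theorem pending_le (q P : ℕ) (σ : State) : pending q P σ ≤ q ^ 8 := by
  refine (Finset.card_filter_le _ _).trans ?_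
  rw [Finset.card_product, Finset.card_range, ← pow_add]

/-- Marks are never removed, and the entry `i, j` is marked for the first time. -/
theorem pending_lt {q P : ℕ} {A B T : ℕ → ℕ → ℤ} {σ τ : State} {a b c i j : ℕ}
    (hσ : Mat σ 32 (q ^ 4) T) (hτ : Mat τ 32 (q ^ 4) (lower q P A B T a b c))
    (hi : i < q ^ 4) (hj : j < q ^ 4) (hf : Found q A B T a b c i j) (hT : T i j ≠ -(P : ℤ)) :
    pending q P τ < pending q P σ := by
  refine Finset.card_lt_card (Finset.ssubset_iff_of_subset ?_ |>.2 ⟨(i, j), ?_, ?_⟩)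
  · intro x hx
    simp only [Finset.mem_filter, Finset.mem_product, Finset.mem_range] at hx ⊢
    refine ⟨hx.1, fun h => hx.2 ?_⟩
    rw [hτ _ hx.1.1 _ hx.1.2, lower]
    rw [hσ _ hx.1.1 _ hx.1.2] at h
    split_ifs
    · rfl
    · exact h
  · simp only [Finset.mem_filter, Finset.mem_product, Finset.mem_range]
    exact ⟨⟨hi, hj⟩, by rwa [hσ _ hi _ hj]⟩
  · simp only [Finset.mem_filter, Finset.mem_product, Finset.mem_range]
    rintro ⟨-, h⟩
    rw [hτ _ hi _ hj, lower, if_pos hf] at h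
    exact h rfl

/-! ### Amortized search in the triples of blocks -/

section
variable {Q : GraphProblem} {β : BlackBox} {Y q X P t : ℕ} {σ : State} {A B T : ℕ → ℕ → ℤ}
  {a b c : ℕ}

theorem Run.searchBlock (H : Params Q β Y q X P t) (hR : Regs σ q X P)
    (hA : Mat σ 30 (q ^ 4) A) (hB : Mat σ 31 (q ^ 4) B) (hT : Mat σ 32 (q ^ 4) T)
    (bA : Bdd (q ^ 4) (8 * X) A) (bB : Bdd (q ^ 4) (8 * X) B) (bT : Bdd (q ^ 4) (8 * X) T)
    (hAB : ∀ i < q ^ 4, ∀ k < q ^ 4, ∀ j < q ^ 4, -(P : ℤ) ≤ A i k + B k j)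
    (ha : σ 12 0 = a) (hb : σ 13 0 = b) (hc : σ 14 0 = c)
    (ha3 : a < q ^ 3) (hb3 : b < q ^ 3) (hc3 : c < q ^ 3) :
    Run Q β Y searchBlock σ (q ^ 3 * 275) (fun τ => Mat τ 32 (q ^ 4) (lower q P A B T a b c)) := by
  have hq0 := H.q_pos
  have hY := H.word
  have h2 := H.pow_le (k := 2) (by omega)
  refine (Run.cells (k := q) (T := q * 200) (by omega) hq0 (by rw [← sq]; omega)
    (fun m τ => Mat τ 32 (q ^ 4) (fun i j => if i % q * q + j % q < m then
      lower q P A B T a b c i j else T i j)) rfl (by omega) rfl hR.r5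
    (fun m τ τ' h hI => hI.congr (h 32 (by omega))) ?_ ?_).imp ?_ ?_
  · intro i hi j hj
    simp only [hT i hi j hj, Nat.not_lt_zero, if_false]
  · intro i hi j hj τ hf h17 h18 h19 hI
    have li := Params.ix_lt ha3 hi
    have lj := Params.ix_lt hb3 hj
    refine (Run.searchCell (z := T (a * q + i) (b * q + j)) H (hR.congr (hf 5 rfl (by omega))
      (hf 6 rfl (by omega)) (hf 7 rfl (by omega)) (hf 8 rfl (by omega)) (hf 9 rfl (by omega)))
      (hA.congr (hf 30 rfl (by omega))) (hB.congr (hf 31 rfl (by omega))) bA bB (bT _ li _ lj) hAB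
      (by rw [hf 12 rfl (by omega), ha]) (by rw [hf 13 rfl (by omega), hb])
      (by rw [hf 14 rfl (by omega), hc]) h18 h19 ha3 hb3 hc3 hi hj ?_).imp le_rfl ?_
    · rw [hI _ li _ lj]
      beta_reduce
      rw [cell_mod hi, cell_mod hj, if_neg (by omega)]
    · intro τ' hτ' i' hi' j' hj'
      rw [hτ', upd_same]
      beta_reduce
      by_cases hij : i' = a * q + i ∧ j' = b * q + j
      · obtain ⟨rfl, rfl⟩ := hij
        rw [if_pos rfl, cell_mod hi, cell_mod hj, if_pos (show i * q + j < i * q + j + 1 by omega), lower]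
        have hF : Found q A B T a b c (a * q + i) (b * q + j) ↔ ∃ k < q, A (a * q + i) (c * q + k)
            + B (c * q + k) (b * q + j) < T (a * q + i) (b * q + j) := by
          simp only [Found, cell_div hi, cell_div hj, true_and]
        split_ifs with h1 h2 h2
        · rfl
        · exact absurd (hF.2 h1) h2
        · exact absurd (hF.1 h2) h1
        · rfl
      · rw [if_neg (fun h => hij ((cell_inj_int hj' lj).1 h)), hI _ hi' _ hj']
        beta_reduce
        by_cases hm : i' % q * q + j' % q = i * q + j
        · rw [if_neg (by omega), if_pos (by omega), lower, if_neg]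
          rintro ⟨h1, h2, -⟩
          obtain ⟨h3, h4⟩ := (cell_inj (Nat.mod_lt _ hq0) hj).1 hm
          refine hij ⟨?_, ?_⟩
          · rw [← h1, ← h3, Nat.div_add_mod']
          · rw [← h2, ← h4, Nat.div_add_mod']
        · exact if_congr (by omega) rfl rfl
  · calc q * q * (q * 200 + 75) ≤ q * q * (q * 275) := Nat.mul_le_mul_left _ (by omega)
      _ = q ^ 3 * 275 := by ring
  · intro τ hI i hi j hj
    rw [hI i hi j hj]
    refine if_pos ?_
    exact cell_lt (Nat.mod_lt _ hq0) (Nat.mod_lt _ hq0)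

/-- Comparing all sums for the current triple of blocks with the thresholds, if the black box tells
that this marks an entry. -/
def compareBlock (wt : Expr) : Program :=
  .seq (copyBlock 35 30 12 14) <| .seq (copyBlock 36 31 14 13) <| .seq (copyBlock 37 32 12 13) <|
  .seq (detect wt) (.ite (var 3 + lit 1) searchBlock .skip)

variable {wt : Expr} {w : ℤ → (ℕ → ℕ → ℤ) → (ℕ → ℕ → ℤ) → (ℕ → ℕ → ℤ) → ℕ → ℕ → ℕ → ℕ → ℤ}

/-- The number `E` is the cost of the exhaustive search, which takes place only if the black box
reports a negative triangle. It is then paid for by an entry that ceases to be pending. -/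
theorem Run.compareBlock (D : Detector Q wt w) (H : Params Q β Y q X P t) (hR : Regs σ q X P)
    (hA : Mat σ 30 (q ^ 4) A) (hB : Mat σ 31 (q ^ 4) B) (hT : Mat σ 32 (q ^ 4) T)
    (bA : Bdd (q ^ 4) (8 * X) A) (bB : Bdd (q ^ 4) (8 * X) B) (bT : Bdd (q ^ 4) (8 * X) T)
    (hAB : ∀ i < q ^ 4, ∀ k < q ^ 4, ∀ j < q ^ 4, -(P : ℤ) ≤ A i k + B k j)
    (ha : σ 12 0 = a) (hb : σ 13 0 = b) (hc : σ 14 0 = c)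
    (ha3 : a < q ^ 3) (hb3 : b < q ^ 3) (hc3 : c < q ^ 3) :
    ∃ E, Run Q β Y (compareBlock wt) σ (q ^ 2 * (50 * wt.cost + 6000) + t + E) (fun τ =>
      Mat τ 32 (q ^ 4) (lower q P A B T a b c) ∧
        E + pending q P τ * (q ^ 3 * 275) ≤ pending q P σ * (q ^ 3 * 275)) := by
  have hq0 := H.q_pos
  have hY := H.word
  have hX := H.X_le
  have hX0 := H.X_pos
  have h1 := H.pow_le (k := 1) (by omega)
  have h2 := H.pow_le (k := 2) (by omega)
  rw [pow_one] at h1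
  have hloc : ∀ {F : ℕ → ℕ → ℤ} {x y : ℕ}, Bdd (q ^ 4) (8 * X) F → x < q ^ 3 → y < q ^ 3 →
      Bdd q (8 * X) (fun i j => F (x * q + i) (y * q + j)) := fun hF hx hy i hi j hj =>
    hF _ (Params.ix_lt hx hi) _ (Params.ix_lt hy hj)
  have hNY : (8 * X : ℤ) ≤ Y := by omega
  set TF := TriangleFree q (fun i j => A (a * q + i) (c * q + j))
    (fun i j => B (c * q + i) (b * q + j)) (fun i j => T (a * q + i) (b * q + j)) with hTF
  have hlt : ∀ {k k' : ℕ}, q ^ 2 * (50 * wt.cost + 6000) + t + k =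
    q * q * 110 + (q * q * 110 + (q * q * 110 + ((q * q * (50 * wt.cost + 5000) + t) +
      (q ^ 2 * 670 + k)))) := by
    intro k _
    ring
  -- everything before the decision
  have pre : ∀ {E : ℕ} {Φ : State → Prop}, (∀ τ : State, (∀ m, 3 < m → m < 15 → τ m = σ m) →
      τ 30 = σ 30 → τ 31 = σ 31 → τ 32 = σ 32 → -1 ≤ τ 3 0 ∧ τ 3 0 < 5 * q ∧ (τ 3 0 = -1 ↔ TF) →
      Run Q β Y (.ite (var 3 + lit 1) Subcubic.searchBlock .skip) τ (q ^ 2 * 670 + E) Φ) →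
      Run Q β Y (Subcubic.compareBlock wt) σ (q ^ 2 * (50 * wt.cost + 6000) + t + E) Φ := by
    intro E Φ hΦ
    rw [hlt (k' := 0)]
    refine Run.seq_frame (Run.copyBlock H hR (by omega) (by omega) (by omega) (by omega) (by omega)
      hA hNY bA ha hc ha3 hc3) fun τ₁ m1 f1 => ?_
    refine Run.seq_frame (Run.copyBlock H (hR.congr (f1 5 rfl) (f1 6 rfl) (f1 7 rfl) (f1 8 rfl)
      (f1 9 rfl)) (by omega) (by omega) (by omega) (by omega) (by omega)
      (hB.congr (f1 31 rfl)) hNY bB (by rw [f1 14 rfl, hc]) (by rw [f1 13 rfl, hb]) hc3 hb3)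
      fun τ₂ m2 f2 => ?_
    have e2 : ∀ m, (Subcubic.copyBlock 35 30 12 14).mod m = false →
      (Subcubic.copyBlock 36 31 14 13).mod m = false → τ₂ m = σ m :=
      fun m hm hm' => (f2 m hm').trans (f1 m hm)
    refine Run.seq_frame (Run.copyBlock H (hR.congr (e2 5 rfl rfl) (e2 6 rfl rfl) (e2 7 rfl rfl)
      (e2 8 rfl rfl) (e2 9 rfl rfl)) (by omega) (by omega) (by omega) (by omega) (by omega)
      (hT.congr (e2 32 rfl rfl)) hNY bT (by rw [e2 12 rfl rfl, ha]) (by rw [e2 13 rfl rfl, hb])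
      ha3 hb3) fun τ₃ m3 f3 => ?_
    have e3 : ∀ m, (Subcubic.copyBlock 35 30 12 14).mod m = false →
      (Subcubic.copyBlock 36 31 14 13).mod m = false →
      (Subcubic.copyBlock 37 32 12 13).mod m = false → τ₃ m = σ m :=
      fun m hm hm' hm'' => (f3 m hm'').trans (e2 m hm hm')
    -- Entries and thresholds are at most `8 * X`, and `12 * (8 * X) ≤ 100 * X` is the separation
    -- that the gadgets need.
    refine Run.seq_frame (Run.detect D H.correct (N := 8 * X) (h := 100 * X) hY hq0
      (by nlinarith) (by omega) (by omega) hNY (by push_cast; omega) (hloc bA ha3 hc3)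
      (hloc bB hc3 hb3) (hloc bT ha3 hb3) (m1.congr ((f3 35 rfl).trans (f2 35 rfl)))
      (m2.congr (f3 36 rfl)) m3 (by rw [e3 5 rfl rfl rfl, hR.r5])
      (by rw [e3 8 rfl rfl rfl, hR.r8]) (fun G h1 h2 h3 => H.time_le G h1 (by
        convert h2 using 1; ring) h3)) fun τ₄ h4 f4 => ?_
    refine hΦ τ₄ (fun m hm hm' => ?_) ((f4 30 rfl).trans (e3 30 rfl rfl rfl))
      ((f4 31 rfl).trans (e3 31 rfl rfl rfl)) ((f4 32 rfl).trans (e3 32 rfl rfl rfl)) h4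
    interval_cases m <;> exact (f4 _ rfl).trans (e3 _ rfl rfl rfl)
  have hsm : ∀ τ : State, -1 ≤ τ 3 0 ∧ τ 3 0 < 5 * q ∧ (τ 3 0 = -1 ↔ TF) →
      (var 3 + lit 1).Small Y τ := fun τ h => by
    rw [Expr.small_add, Expr.small_var, Expr.small_lit, abs_le]
    norm_num
    omega
  have hq2 : 0 < q ^ 2 := by positivity
  by_cases htf : TF
  · refine ⟨0, pre fun τ hf _ _ h32 h3 => Run.imp (Run.ite (T := 1) (by omega) (by simp) (hsm τ h3)
      (fun h0 => ?_) (fun _ => ⟨τ, 1, .skip τ, le_rfl, ?_, ?_⟩)) ?_ (fun _ h => h)⟩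
    · simp [h3.2.2.2 htf] at h0
    · simp
      omega
    · intro i hi j hj
      rw [(hT.congr h32) i hi j hj, lower, if_neg]
      rintro ⟨rfl, rfl, k, hk, hlt⟩
      have := htf (i % q) (Nat.mod_lt _ hq0) k hk (j % q) (Nat.mod_lt _ hq0)
      simp only [Nat.div_add_mod'] at this
      omega
    · rw [pending, pending, h32, zero_add]
  · refine ⟨q ^ 3 * 275, pre fun τ hf h30 h31 h32 h3 => Run.imp (Run.ite (T := q ^ 3 * 275)
      (by omega) (by simp) (hsm τ h3) (fun _ => ?_) (fun h0 => ?_)) ?_ (fun _ h => h)⟩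
    · refine (Run.searchBlock H (hR.congr (hf 5 (by omega) (by omega)) (hf 6 (by omega) (by omega))
        (hf 7 (by omega) (by omega)) (hf 8 (by omega) (by omega)) (hf 9 (by omega) (by omega)))
        (hA.congr h30) (hB.congr h31) (hT.congr h32) bA bB bT hAB
        (by rw [hf 12 (by omega) (by omega), ha]) (by rw [hf 13 (by omega) (by omega), hb])
        (by rw [hf 14 (by omega) (by omega), hc]) ha3 hb3 hc3).imp le_rfl fun τ' hτ' => ⟨hτ', ?_⟩
      simp only [hTF, TriangleFree, not_forall, not_le] at htf
      obtain ⟨i, hi, k, hk, j, hj, hlt⟩ := htf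
      -- The threshold exceeds a sum, hence exceeds `-P`, so this entry was not marked before.
      have := pending_lt hT hτ' (Params.ix_lt ha3 hi) (Params.ix_lt hb3 hj)
        ⟨cell_div hi, cell_div hj, k, hk, hlt⟩ (fun h => by
          have := hAB _ (Params.ix_lt ha3 hi) _ (Params.ix_lt hc3 hk) _ (Params.ix_lt hb3 hj)
          omega)
      calc q ^ 3 * 275 + pending q P τ' * (q ^ 3 * 275)
          = (pending q P τ' + 1) * (q ^ 3 * 275) := by ring
        _ ≤ _ := Nat.mul_le_mul_right _ this
    · exact absurd (h3.2.2.1 (by simp at h0; omega)) htf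
    · simp
      omega

/-- One round of the binary search: marking the thresholds in array `32` that are larger than the
entry of the min-plus product of the matrices in the arrays `30` and `31`. -/
def compareAll (wt : Expr) : Program :=
  let q3 := var 5 * var 5 * var 5
  .for 16 (q3 * q3 * q3) <| .seq (.set 12 (lit 0) (var 16 / (q3 * q3))) <|
  .seq (.set 13 (lit 0) (modE (var 16 / q3) q3)) <| .seq (.set 14 (lit 0) (modE (var 16) q3))
  (compareBlock wt)

/-- The number of the triple of blocks that contains the given row, column and intermediate
index. -/
def tripleIx (q i j k : ℕ) : ℕ := (i / q * q ^ 3 + j / q) * q ^ 3 + k / q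

open Classical in
/-- The thresholds after the triples of blocks with numbers below `m` are treated. -/
noncomputable def lowered (q P : ℕ) (A B T : ℕ → ℕ → ℤ) (m i j : ℕ) : ℤ :=
  if ∃ k < q ^ 4, tripleIx q i j k < m ∧ A i k + B k j < T i j then -(P : ℤ) else T i j

/-- A threshold is either already marked, and stays so, or still has its original value; in the
latter case the triple `m` contributes exactly the indices `k` with `tripleIx q i j k = m`. -/
theorem lower_lowered {m : ℕ} (hm : m < q ^ 3 * q ^ 3 * q ^ 3)
    (hAB : ∀ i < q ^ 4, ∀ k < q ^ 4, ∀ j < q ^ 4, -(P : ℤ) ≤ A i k + B k j)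
    {i j : ℕ} (hi : i < q ^ 4) (hj : j < q ^ 4) :
    lower q P A B (lowered q P A B T m) (m / (q ^ 3 * q ^ 3)) (m / q ^ 3 % q ^ 3) (m % q ^ 3) i j
      = lowered q P A B T (m + 1) i j := by
  have hq : 0 < q := by
    rcases Nat.eq_zero_or_pos q with rfl | h
    · simp at hm
    · exact h
  have hq3 : 0 < q ^ 3 := by positivity
  -- The numbers of the three blocks are the digits of `m` in base `q ^ 3`.
  have hix : ∀ k < q ^ 4, (tripleIx q i j k = m ↔ i / q = m / (q ^ 3 * q ^ 3) ∧
      j / q = m / q ^ 3 % q ^ 3 ∧ k / q = m % q ^ 3) := by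
    intro k hk
    rw [← Nat.div_div_eq_div_mul]
    conv_lhs => rw [← Nat.div_add_mod' m (q ^ 3), ← Nat.div_add_mod' (m / q ^ 3) (q ^ 3)]
    rw [tripleIx, cell_inj (Params.div_lt hk) (Nat.mod_lt _ hq3),
      cell_inj (Params.div_lt hj) (Nat.mod_lt _ hq3), and_assoc]
  by_cases h : ∃ k < q ^ 4, tripleIx q i j k < m ∧ A i k + B k j < T i j
  · have h' : ∃ k < q ^ 4, tripleIx q i j k < m + 1 ∧ A i k + B k j < T i j := by
      obtain ⟨k, hk, h1, h2⟩ := h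
      exact ⟨k, hk, by omega, h2⟩
    have e1 : lowered q P A B T m i j = -(P : ℤ) := if_pos h
    have e2 : lowered q P A B T (m + 1) i j = -(P : ℤ) := if_pos h'
    rw [lower, e1, e2, ite_self]
  · have hT : lowered q P A B T m i j = T i j := if_neg h
    have hiff : Found q A B (lowered q P A B T m) (m / (q ^ 3 * q ^ 3)) (m / q ^ 3 % q ^ 3)
        (m % q ^ 3) i j ↔ ∃ k < q ^ 4, tripleIx q i j k < m + 1 ∧ A i k + B k j < T i j := by
      rw [Found, hT]
      constructor
      · rintro ⟨h1, h2, k, hk, hlt⟩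
        have hk4 := Params.ix_lt (Nat.mod_lt m hq3) hk
        refine ⟨_, hk4, ?_, hlt⟩
        rw [((hix _ hk4).2 ⟨h1, h2, cell_div hk⟩)]
        omega
      · rintro ⟨k, hk, h1, hlt⟩
        rcases Nat.lt_succ_iff_lt_or_eq.1 h1 with h2 | h2
        · exact absurd ⟨k, hk, h2, hlt⟩ h
        · obtain ⟨h3, h4, h5⟩ := (hix k hk).1 h2
          exact ⟨h3, h4, k % q, Nat.mod_lt _ hq, by rwa [← h5, Nat.div_add_mod']⟩
    rw [lower, hT]
    by_cases hF : ∃ k < q ^ 4, tripleIx q i j k < m + 1 ∧ A i k + B k j < T i j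
    · rw [if_pos (hiff.2 hF), lowered, if_pos hF]
    · rw [if_neg (fun h => hF (hiff.1 h)), lowered, if_neg hF]

-- The amortization. Each of the `q ^ 9` triples costs `q ^ 2` for copying and for writing the
-- graph, and `t` for the call. The searches cost `q ^ 3` each and are charged to the at most `q ^
-- 8` pending entries, hence `q ^ 11` in total.
open Classical in
theorem Run.compareAll (D : Detector Q wt w) (H : Params Q β Y q X P t) (hR : Regs σ q X P)
    (hA : Mat σ 30 (q ^ 4) A) (hB : Mat σ 31 (q ^ 4) B) (hT : Mat σ 32 (q ^ 4) T)
    (bA : Bdd (q ^ 4) (8 * X) A) (bB : Bdd (q ^ 4) (8 * X) B) (bT : Bdd (q ^ 4) (8 * X) T)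
    (hAB : ∀ i < q ^ 4, ∀ k < q ^ 4, ∀ j < q ^ 4, -(P : ℤ) ≤ A i k + B k j) :
    Run Q β Y (compareAll wt) σ ((50 * wt.cost + 7000) * (q ^ 11 + q ^ 9 * t)) (fun τ =>
      Mat τ 32 (q ^ 4) (fun i j =>
        if ∃ k < q ^ 4, A i k + B k j < T i j then -(P : ℤ) else T i j)) := by
  have hq0 := H.q_pos
  have hY := H.word
  have hX := H.X_le
  have hX0 := H.X_pos
  have hP := H.P_le
  have h1 := H.pow_le (k := 1) (by omega)
  have h3 := H.pow_le (k := 3) (by omega)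
  have h6 := H.pow_le (k := 6) (by omega)
  have h9 := H.pow_le (k := 9) (by omega)
  have hq3 : 0 < q ^ 3 := by positivity
  rw [pow_one] at h1
  have e9 : q ^ 3 * q ^ 3 * q ^ 3 = q ^ 9 := by ring
  refine (Run.for_potential (n := q ^ 3 * q ^ 3 * q ^ 3)
    (T := q ^ 2 * (50 * wt.cost + 6000) + t + 100) (by omega) (by simp) (by omega)
    (fun m τ => Mat τ 32 (q ^ 4) (lowered q P A B T m)) (fun τ => pending q P τ * (q ^ 3 * 275)) rfl
    (fun m τ z hI => hI.congr (upd_of_ne (by omega)))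
    (fun τ z => by rw [pending, pending, upd_of_ne (by omega)]) ?_ ?_ ?_).imp ?_ ?_
  · intro i hi j hj
    rw [hT i hi j hj, lowered, if_neg]
    rintro ⟨k, -, h, -⟩
    omega
  · intro τ hf
    simp only [Expr.small_mul, Expr.small_var, Expr.eval_mul, Expr.eval_var, hf 5 rfl (by omega),
      hR.r5, Nat.abs_cast]
    refine ⟨by omega, by push_cast; ring⟩
  · intro m hm τ hf h16 hI
    have hR' := hR.congr (hf 5 rfl (by omega)) (hf 6 rfl (by omega)) (hf 7 rfl (by omega))
      (hf 8 rfl (by omega)) (hf 9 rfl (by omega))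
    have hmY : m ≤ Y := by omega
    have hqY : q ≤ Y := by omega
    have ha3 : m / (q ^ 3 * q ^ 3) < q ^ 3 := Nat.div_lt_of_lt_mul hm
    have hb3 : m / q ^ 3 % q ^ 3 < q ^ 3 := Nat.mod_lt _ hq3
    have hc3 : m % q ^ 3 < q ^ 3 := Nat.mod_lt _ hq3
    have hlb : Bdd (q ^ 4) (8 * X) (lowered q P A B T m) := by
      intro i hi j hj
      rw [lowered]
      split_ifs
      · rw [abs_neg, Nat.abs_cast]
        omega
      · exact bT i hi j hj
    set τ' := ((τ.upd 12 0 (m / (q ^ 3 * q ^ 3) : ℕ)).upd 13 0 (m / q ^ 3 % q ^ 3 : ℕ)).upd 14 0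
      (m % q ^ 3 : ℕ) with hτ'
    have hne : ∀ b, b ≠ 12 → b ≠ 13 → b ≠ 14 → τ' b = τ b := fun b h1 h2 h3 => by
      rw [hτ', upd_of_ne h3, upd_of_ne h2, upd_of_ne h1]
    obtain ⟨E, hE⟩ := Run.compareBlock (a := m / (q ^ 3 * q ^ 3)) (b := m / q ^ 3 % q ^ 3)
      (c := m % q ^ 3) (T := lowered q P A B T m) (σ := τ') D H
      (hR'.congr (hne 5 (by omega) (by omega) (by omega)) (hne 6 (by omega) (by omega) (by omega))
        (hne 7 (by omega) (by omega) (by omega)) (hne 8 (by omega) (by omega) (by omega))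
        (hne 9 (by omega) (by omega) (by omega)))
      (hA.congr ((hne 30 (by omega) (by omega) (by omega)).trans (hf 30 rfl (by omega))))
      (hB.congr ((hne 31 (by omega) (by omega) (by omega)).trans (hf 31 rfl (by omega))))
      (hI.congr (hne 32 (by omega) (by omega) (by omega))) bA bB hlb hAB
      (by rw [hτ', upd_of_ne (by omega), upd_of_ne (by omega), upd_cell])
      (by rw [hτ', upd_of_ne (by omega), upd_cell]) (by rw [hτ', upd_cell]) ha3 hb3 hc3
    have hpend : pending q P τ' = pending q P τ := by
      rw [pending, pending, hne 32 (by omega) (by omega) (by omega)]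
    rw [hpend] at hE
    have hE' := hE.imp (Ψ := fun τ => Mat τ 32 (q ^ 4) (lowered q P A B T (m + 1)) ∧
      E + pending q P τ * (q ^ 3 * 275) ≤ pending q P _ * (q ^ 3 * 275)) le_rfl (fun ρ h =>
        ⟨fun i hi j hj => by rw [h.1 i hi j hj, lower_lowered hm hAB hi hj], h.2⟩)
    refine ⟨E, ?_⟩
    have h5 := hR'.r5
    refine (Run.seq (T := 22) (T' := q ^ 2 * (50 * wt.cost + 6000) + t + E + 78) (Run.imp
      (Run.set (by omega) (by simp) (by simp) (by simp) ?_ (Run.seq (T := 43)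
      (T' := q ^ 2 * (50 * wt.cost + 6000) + t + E + 35) (Run.imp
      (Run.set (by omega) (by simp) (by simp) (by simp) ?_ (Run.seq (T := 25)
      (T' := q ^ 2 * (50 * wt.cost + 6000) + t + E) (Run.imp
      (Run.set (by omega) (by simp) (by simp) (by simp) ?_ ?_) (by simp) (fun _ h => h))
      |>.imp (by omega) (fun _ h => h))) (by simp) (fun _ h => h)) |>.imp (by omega) (fun _ h => h)))
      (by simp) (fun _ h => h))).imp (by omega) (fun _ h => h)
    · simp only [Expr.small_mul, Expr.small_var, Expr.small_div, h5, h16, Nat.abs_cast]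
      omega
    · simp only [Expr.small_mul, Expr.small_var, Expr.small_div, Expr.small_modE,
        upd_of_ne (show 16 ≠ 12 by omega), upd_of_ne (show 5 ≠ 12 by omega), h5, h16, Nat.abs_cast]
      omega
    · simp only [Expr.small_mul, Expr.small_var, Expr.small_modE,
        upd_of_ne (show 16 ≠ 12 by omega), upd_of_ne (show 5 ≠ 12 by omega),
        upd_of_ne (show 16 ≠ 13 by omega), upd_of_ne (show 5 ≠ 13 by omega), h5, h16, Nat.abs_cast]
      omega
    · convert hE' using 1
      simp only [Expr.eval_modE, Expr.eval_div, Expr.eval_mul, Expr.eval_var, Expr.eval_lit,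
        upd_of_ne (show 16 ≠ 12 by omega), upd_of_ne (show 5 ≠ 12 by omega),
        upd_of_ne (show 16 ≠ 13 by omega), upd_of_ne (show 5 ≠ 13 by omega), h5, h16, hτ']
      push_cast
      ring_nf
  · have hp := Nat.mul_le_mul_right (q ^ 3 * 275) (pending_le q P σ)
    have e11 : q ^ 8 * (q ^ 3 * 275) = 275 * q ^ 11 := by ring
    simp only [Expr.cost_mul, Expr.cost_var, e9]
    have e2 : q ^ 9 * (q ^ 2 * (50 * wt.cost + 6000)) = q ^ 11 * (50 * wt.cost + 6000) := by ring
    have e3 : q ^ 9 ≤ q ^ 11 := Nat.pow_le_pow_right hq0 (by omega)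
    have e4 : 1 ≤ q ^ 11 := Nat.one_le_pow _ _ hq0
    have e5 : q ^ 9 * t ≤ q ^ 9 * t * (50 * wt.cost + 7000) := Nat.le_mul_of_pos_right _ (by omega)
    nlinarith
  · intro τ hI i hi j hj
    rw [hI i hi j hj, lowered]
    refine if_congr (exists_congr fun k => and_congr_right fun hk => and_iff_right ?_) rfl rfl
    rw [tripleIx]
    have h1 := Params.div_lt hi
    have h2 := Params.div_lt hj
    have h3 := Params.div_lt hk
    have h4 := cell_lt h1 h2
    have h5 : (i / q * q ^ 3 + j / q + 1) * q ^ 3 ≤ q ^ 3 * q ^ 3 * q ^ 3 :=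
      Nat.mul_le_mul_right _ h4
    rw [Nat.succ_mul] at h5
    omega

end

/-! ## Min-plus products -/

/-- The thresholds of the next round of the binary search. -/
def nextThreshold : Expr := get 33 (var 17) + var 10

/-- The lower bound after a round of the binary search. -/
def nextBound : Expr :=
  get 33 (var 17) + (lit 1 - eqE (get 32 (var 17)) (lit 0 - var 9)) *
    (get 32 (var 17) - get 33 (var 17))

/-- A round of the binary search. -/
def productRound (wt : Expr) : Program :=
  .seq (.cells 6 (.set 32 (var 17) nextThreshold)) <| .seq (compareAll wt) <|
  .seq (.cells 6 (.set 33 (var 17) nextBound)) (.set 10 (lit 0) (var 10 / lit 2))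

/-- The min-plus product of the matrices in the arrays `30` and `31`, cut off above, is computed
to array `33` by binary search. -/
def product (wt : Expr) : Program :=
  .seq (.cells 6 (.set 33 (var 17) (lit 0 - var 9))) <| .seq (.set 10 (lit 0) (var 9)) <|
  .while (var 10) (productRound wt)

/-- The entries of `S` are lower bounds for the sums, which are sharp up to `m` or as large as
possible. -/
def SearchInv (n P m : ℕ) (A B S : ℕ → ℕ → ℤ) : Prop :=
  ∀ i < n, ∀ j < n, -(P : ℤ) ≤ S i j ∧ S i j + m ≤ P ∧ (∀ k < n, S i j ≤ A i k + B k j) ∧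
    ((∃ k < n, A i k + B k j < S i j + m) ∨ S i j + m = P)

section
variable {Q : GraphProblem} {β : BlackBox} {Y q X P t : ℕ} {σ : State} {A B : ℕ → ℕ → ℤ}
variable {wt : Expr} {w : ℤ → (ℕ → ℕ → ℤ) → (ℕ → ℕ → ℤ) → (ℕ → ℕ → ℤ) → ℕ → ℕ → ℕ → ℕ → ℤ}

theorem Params.cells_le (H : Params Q β Y q X P t) : q ^ 4 * q ^ 4 ≤ Y := by
  have := H.pow_le (k := 8) (by omega)
  have h : q ^ 4 * q ^ 4 = q ^ 8 := by ring
  omega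

theorem Params.small_ix (H : Params Q β Y q X P t) {τ : State} {i j : ℕ} (hi : i < q ^ 4)
    (hj : j < q ^ 4) (h17 : τ 17 0 = (i : ℤ) * (q ^ 4 : ℕ) + j) : |τ 17 0| ≤ (Y : ℤ) := by
  have h1 := cell_lt hi hj
  have h2 := H.cells_le
  rw [h17, abs_of_nonneg (by positivity)]
  exact_mod_cast (by omega : i * q ^ 4 + j ≤ Y)

/-- The thresholds are the midpoints `S i j + m` of the current intervals. A marked entry keeps its
lower bound, any other one moves it up to the midpoint. The mark is unambiguous because `0 < m` and
`-P ≤ S i j` give `-P < S i j + m`. -/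
theorem Run.productRound (D : Detector Q wt w) (H : Params Q β Y q X P t) (hR : Regs σ q X P)
    (hA : Mat σ 30 (q ^ 4) A) (hB : Mat σ 31 (q ^ 4) B)
    (bA : Bdd (q ^ 4) (8 * X) A) (bB : Bdd (q ^ 4) (8 * X) B)
    (hAB : ∀ i < q ^ 4, ∀ k < q ^ 4, ∀ j < q ^ 4, -(P : ℤ) ≤ A i k + B k j) {S : ℕ → ℕ → ℤ}
    (hS : Mat σ 33 (q ^ 4) S) {m : ℕ} (hm : 0 < m) (h10 : σ 10 0 = m)
    (hI : SearchInv (q ^ 4) P (2 * m) A B S) :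
    Run Q β Y (productRound wt) σ ((50 * wt.cost + 7500) * (q ^ 11 + q ^ 9 * t)) (fun τ =>
      τ 10 0 = (m / 2 : ℕ) ∧ ∃ S', Mat τ 33 (q ^ 4) S' ∧ SearchInv (q ^ 4) P m A B S') := by
  classical
  have hq0 := H.q_pos
  have hY := H.word
  have hX := H.X_le
  have hX0 := H.X_pos
  have hP := H.P_le
  have hq4 : 0 < q ^ 4 := by positivity
  have hcY := H.cells_le
  have hSb : ∀ i < q ^ 4, ∀ j < q ^ 4, |S i j| ≤ 8 * X ∧ |S i j + m| ≤ 8 * X := fun i hi j hj => by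
    obtain ⟨h1, h2, -⟩ := hI i hi j hj
    rw [abs_le, abs_le]
    push_cast at h2
    omega
  have hmY : m ≤ 8 * X := by
    have := hI 0 hq4 0 hq4
    omega
  refine (Run.seq_frame (T := q ^ 11 * 100) (T' := (50 * wt.cost + 7000) * (q ^ 11 + q ^ 9 * t)
    + (q ^ 11 * 150 + q ^ 11 * 20)) ((Run.fill_expr (a := 32) (r := 6) (e := nextThreshold)
    (fun i j => S i j + m) (by omega) (by simp [nextThreshold]) hq4 hcY (by omega) (by omega)
    (by omega) hR.r6 ?_).imp ?_ (fun _ h => h.1)) ?_).imp ?_ (fun _ h => h)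
  · intro i hi j hj τ hf h17 _ _ _
    have e33 : τ 33 (τ 17 0) = S i j := by rw [hf 33 (by omega) (by omega), h17, hS i hi j hj]
    have e10 : τ 10 0 = m := by rw [hf 10 (by omega) (by omega), h10]
    have := H.small_ix hi hj h17
    have hb := (hSb i hi j hj).1
    simp only [nextThreshold, Expr.small_add, Expr.small_get, Expr.small_var, Expr.eval_add,
      Expr.eval_get, Expr.eval_var, e33, e10, Nat.abs_cast, and_true]
    omega
  · have e3 : q ^ 4 * q ^ 4 ≤ q ^ 11 := by
      rw [← pow_add]
      exact Nat.pow_le_pow_right hq0 (by omega)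
    refine Nat.mul_le_mul e3 (by simp [nextThreshold])
  · intro τ₁ m1 f1
    refine Run.seq_frame (Run.compareAll D H (hR.congr (f1 5 rfl) (f1 6 rfl) (f1 7 rfl) (f1 8 rfl)
      (f1 9 rfl)) (hA.congr (f1 30 rfl)) (hB.congr (f1 31 rfl)) m1 bA bB
      (fun i hi j hj => (hSb i hi j hj).2) hAB) fun τ₂ m2 f2 => ?_
    set T' : ℕ → ℕ → ℤ := fun i j =>
      if ∃ k < q ^ 4, A i k + B k j < S i j + m then -(P : ℤ) else S i j + m with hT'
    set S' : ℕ → ℕ → ℤ := fun i j =>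
      if ∃ k < q ^ 4, A i k + B k j < S i j + m then S i j else S i j + m with hS'
    have hS2 : Mat τ₂ 33 (q ^ 4) S := hS.congr ((f2 33 rfl).trans (f1 33 rfl))
    refine Run.seq_frame (T := q ^ 11 * 150) (T' := q ^ 11 * 20) ((Run.fill_expr (a := 33)
      (r := 6) (e := nextBound) S' (by omega) (by simp [nextBound]) hq4 hcY (by omega)
      (by omega) (by omega) (by rw [f2 6 rfl, f1 6 rfl, hR.r6]) ?_).imp ?_ (fun _ h => h.1))
      fun τ₃ m3 f3 => ?_
    · intro i hi j hj τ hf h17 _ _ h33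
      have e33 : τ 33 (τ 17 0) = S i j := by rw [h17, h33, hS2 i hi j hj]
      have e32 : τ 32 (τ 17 0) = T' i j := by rw [hf 32 (by omega) (by omega), h17, m2 i hi j hj]
      have e9 : τ 9 0 = P := by rw [hf 9 (by omega) (by omega), f2 9 rfl, f1 9 rfl, hR.r9]
      have := H.small_ix hi hj h17
      have hb := hSb i hi j hj
      have hlow := (hI i hi j hj).1
      have hTb : |T' i j| ≤ 8 * X := by
        rw [hT']
        beta_reduce
        split_ifs
        · rw [abs_neg, Nat.abs_cast]
          omega
        · exact hb.2
      simp only [nextBound, Expr.small_add, Expr.small_sub, Expr.small_mul, Expr.small_get,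
        Expr.small_eqE, Expr.small_lit, Expr.small_var, Expr.eval_add, Expr.eval_sub, Expr.eval_mul,
        Expr.eval_eqE, Expr.eval_lit, Expr.eval_get, Expr.eval_var, e33, e32, e9, Nat.abs_cast]
      constructor
      · norm_num
        omega
      · rw [hT', hS']
        beta_reduce
        split_ifs with h1 h2 h2 <;> omega
    · have e3 : q ^ 4 * q ^ 4 ≤ q ^ 11 := by
        rw [← pow_add]
        exact Nat.pow_le_pow_right hq0 (by omega)
      refine Nat.mul_le_mul e3 (by simp [nextBound])
    · have e10 : τ₃ 10 0 = m := by rw [f3 10 rfl, f2 10 rfl, f1 10 rfl, h10]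
      refine (Run.set (by omega) (by simp) (by simp) (by simp) ?_ ⟨?_, S', ?_, ?_⟩).imp ?_
        (fun _ h => h)
      · simp only [Expr.small_div, Expr.small_var, Expr.small_lit, e10, Nat.abs_cast]
        norm_num
        omega
      · have := Nat.one_le_pow 11 q hq0
        simp
        omega
      · simp [e10]
      · exact m3.congr (upd_of_ne (by omega))
      · intro i hi j hj
        obtain ⟨h1, h2, h3, h4⟩ := hI i hi j hj
        push_cast at h2 h4
        rw [hS']
        beta_reduce
        split_ifs with h
        · exact ⟨h1, by omega, h3, Or.inl h⟩
        · refine ⟨by omega, by omega, fun k hk => ?_, ?_⟩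
          · by_contra hlt
            exact h ⟨k, hk, by omega⟩
          · rcases h4 with ⟨k, hk, hlt⟩ | h4
            · exact Or.inl ⟨k, hk, by omega⟩
            · exact Or.inr (by omega)
  · have : q ^ 11 ≤ q ^ 11 + q ^ 9 * t := by omega
    nlinarith

/-- The interval of length `2 * P` above `-P` is halved `l + 1` times. The alternative `S i j + 1 =
P` at the end says that all sums are at least `P - 1`, which exceeds `2 * X`; the exact value of
such entries is never needed. -/
theorem Run.product (D : Detector Q wt w) (H : Params Q β Y q X P t) (hR : Regs σ q X P)
    (hA : Mat σ 30 (q ^ 4) A) (hB : Mat σ 31 (q ^ 4) B)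
    (bA : Bdd (q ^ 4) (8 * X) A) (bB : Bdd (q ^ 4) (8 * X) B)
    (hAB : ∀ i < q ^ 4, ∀ k < q ^ 4, ∀ j < q ^ 4, -(P : ℤ) ≤ A i k + B k j) {l : ℕ}
    (hl : P = 2 ^ l) :
    Run Q β Y (product wt) σ ((l + 2) * ((50 * wt.cost + 7600) * (q ^ 11 + q ^ 9 * t))) (fun τ =>
      ∃ S, Mat τ 33 (q ^ 4) S ∧ ∀ i < q ^ 4, ∀ j < q ^ 4, |S i j| ≤ 8 * X ∧
        (∀ k < q ^ 4, S i j ≤ A i k + B k j) ∧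
          ((∃ k < q ^ 4, A i k + B k j = S i j) ∨ S i j + 1 = P)) := by
  have hq0 := H.q_pos
  have hY := H.word
  have hX := H.X_le
  have hX0 := H.X_pos
  have hP := H.P_le
  have hPg := H.P_ge
  have hq4 : 0 < q ^ 4 := by positivity
  have hcY := H.cells_le
  have e11 := Nat.one_le_pow 11 q hq0
  refine (Run.seq_frame (T := q ^ 11 * 100) (T' := 5 + ((l + 1) * ((50 * wt.cost + 7500) *
    (q ^ 11 + q ^ 9 * t) + 2 + 1) + (2 + 1))) ((Run.fill_expr (a := 33) (r := 6)
    (e := lit 0 - var 9) (fun i j => -(P : ℤ)) (by omega) (by simp) hq4 hcY (by omega) (by omega)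
    (by omega) hR.r6 ?_).imp ?_ (fun _ h => h.1)) ?_).imp ?_ (fun _ h => h)
  · intro i hi j hj τ hf h17 _ _ _
    have e9 : τ 9 0 = P := by rw [hf 9 (by omega) (by omega), hR.r9]
    simp only [Expr.small_sub, Expr.small_lit, Expr.small_var, Expr.eval_sub, Expr.eval_lit,
      Expr.eval_var, e9, Nat.abs_cast]
    norm_num
    omega
  · have e3 : q ^ 4 * q ^ 4 ≤ q ^ 11 := by
      rw [← pow_add]
      exact Nat.pow_le_pow_right hq0 (by omega)
    refine Nat.mul_le_mul e3 (by simp)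
  · intro τ₁ m1 f1
    have e9 : τ₁ 9 0 = P := by rw [f1 9 rfl, hR.r9]
    refine Run.seq_frame (T := 5) ((Run.set (Φ := fun τ => τ 10 0 = P) (by omega) (by simp)
      (by simp) (by simp) (by simp [e9]; omega) (by simp [e9])).imp (by simp) (fun _ h => h)) fun τ₂ h10 f2 => ?_
    have hf : ∀ τ : State, (∀ a, (Subcubic.productRound wt).mod a = false → τ a = τ₂ a) →
        Regs τ q X P ∧ Mat τ 30 (q ^ 4) A ∧ Mat τ 31 (q ^ 4) B := fun τ hf =>
      ⟨hR.congr ((hf 5 rfl).trans ((f2 5 rfl).trans (f1 5 rfl)))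
        ((hf 6 rfl).trans ((f2 6 rfl).trans (f1 6 rfl)))
        ((hf 7 rfl).trans ((f2 7 rfl).trans (f1 7 rfl)))
        ((hf 8 rfl).trans ((f2 8 rfl).trans (f1 8 rfl)))
        ((hf 9 rfl).trans ((f2 9 rfl).trans (f1 9 rfl))),
      hA.congr ((hf 30 rfl).trans ((f2 30 rfl).trans (f1 30 rfl))),
      hB.congr ((hf 31 rfl).trans ((f2 31 rfl).trans (f1 31 rfl)))⟩
    -- After `k` rounds the intervals have length `2 ^ (l + 1 - k)` and register `10` holds half of
    -- it, which becomes `0` when the length is `1` and so ends the loop.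
    refine (Run.while (n := l + 1) (T := (50 * wt.cost + 7500) * (q ^ 11 + q ^ 9 * t)) (by omega)
      (by simp) (fun k τ => τ 10 0 = (2 ^ (l + 1 - k) / 2 : ℕ) ∧ ∃ S, Mat τ 33 (q ^ 4) S ∧
        SearchInv (q ^ 4) P (2 ^ (l + 1 - k)) A B S) ?_ ?_ ?_).imp
      ?_ ?_
    · refine ⟨?_, _, m1.congr (f2 33 rfl), ?_⟩
      · rw [h10, hl, Nat.sub_zero, pow_succ, Nat.mul_div_cancel _ (by omega)]
      intro i hi j hj
      rw [Nat.sub_zero, pow_succ, ← hl]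
      push_cast
      exact ⟨by omega, by omega, fun k hk => hAB i hi k hk j hj, Or.inr (by ring)⟩
    · rintro k hk τ hfr ⟨h10, S, hS, hI⟩
      obtain ⟨r, hr⟩ : ∃ r, l + 1 - k = r + 1 := ⟨l - k, by omega⟩
      have hr' : l + 1 - (k + 1) = r := by omega
      rw [hr, pow_succ, Nat.mul_div_cancel _ (by omega)] at h10
      rw [hr, pow_succ 2 r, mul_comm (2 ^ r) 2] at hI
      have hpos : 0 < 2 ^ r := by positivity
      have hrP : 2 ^ r ≤ P := hl ▸ Nat.pow_le_pow_right (by omega) (by omega)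
      obtain ⟨hR', hA', hB'⟩ := hf τ hfr
      refine ⟨?_, ?_, ?_⟩
      · rw [Expr.small_var, h10, Nat.abs_cast]
        omega
      · rw [Expr.eval_var, h10]
        exact_mod_cast hpos
      · rw [hr']
        exact Run.productRound D H hR' hA' hB' bA bB hAB hS hpos h10 hI
    · rintro τ - ⟨h10, -⟩
      simp [h10]
    · simp
    · rintro τ ⟨-, S, hS, hI⟩
      refine ⟨S, hS, fun i hi j hj => ?_⟩
      obtain ⟨h1, h2, h3, h4⟩ := hI i hi j hj
      rw [Nat.sub_self, pow_zero, Nat.cast_one] at h2 h4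
      refine ⟨by rw [abs_le]; omega, h3, h4.imp ?_ id⟩
      rintro ⟨k, hk, hlt⟩
      exact ⟨k, hk, by have := h3 k hk; omega⟩
  · have h1 : q ^ 11 ≤ q ^ 11 + q ^ 9 * t := by omega
    have h2 : (l + 1) * 3 + q ^ 11 * 100 + 8 ≤ (l + 2) * 100 * (q ^ 11 + q ^ 9 * t) +
      7500 * (q ^ 11 + q ^ 9 * t) := by nlinarith
    nlinarith

end

/-! ## Walks with a bounded number of edges -/

namespace WGraph
variable {G : WGraph}

/-- There is an edge of weight `x` between the vertices with the given numbers. -/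
def Edge (G : WGraph) (i j : ℕ) (x : ℤ) : Prop :=
  ∃ (hi : i < G.n) (hj : j < G.n), G.w ⟨i, hi⟩ ⟨j, hj⟩ = (x : WithTop ℤ)

/-- There is a walk with `s` edges and weight `z` between the vertices with the given numbers. -/
inductive EdgeWalk (G : WGraph) : ℕ → ℕ → ℕ → ℤ → Prop
  | nil (i : ℕ) : EdgeWalk G 0 i i 0
  | cons {s i j k : ℕ} {x y : ℤ} (h : G.Edge i j x) (p : EdgeWalk G s j k y) :
      EdgeWalk G (s + 1) i k (x + y)

namespace EdgeWalk

theorem append {s t i j k : ℕ} {x y : ℤ} (p : G.EdgeWalk s i j x) (q : G.EdgeWalk t j k y) :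
    G.EdgeWalk (s + t) i k (x + y) := by
  induction p with
  | nil => simpa using q
  | cons h _ ih =>
    rw [Nat.add_right_comm, Int.add_assoc]
    exact .cons h (ih q)

theorem single {i j : ℕ} {x : ℤ} (h : G.Edge i j x) : G.EdgeWalk 1 i j x := by
  simpa using EdgeWalk.cons h (.nil j)

/-- The vertices and the weights of the edges of a walk. -/
theorem exists_path {s i j : ℕ} {z : ℤ} (p : G.EdgeWalk s i j z) :
    ∃ (f : ℕ → ℕ) (g : ℕ → ℤ), f 0 = i ∧ f s = j ∧ (∀ a < s, G.Edge (f a) (f (a + 1)) (g a)) ∧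
      z = ∑ a ∈ Finset.Ico 0 s, g a := by
  induction p with
  | nil i => exact ⟨fun _ => i, fun _ => 0, rfl, rfl, by simp, by simp⟩
  | @cons s i j k x y h p ih =>
    obtain ⟨f, g, h0, hs, he, hz⟩ := ih
    refine ⟨fun a => Nat.casesOn a i f, fun a => Nat.casesOn a x g, rfl, hs, fun a ha => ?_, ?_⟩
    · cases a with
      | zero => simpa [h0] using h
      | succ a => exact he a (by omega)
    · rw [← Finset.range_eq_Ico, Finset.sum_range_succ', hz, Finset.range_eq_Ico]
      exact add_comm _ _

theorem of_path {f : ℕ → ℕ} {g : ℕ → ℤ} {s : ℕ} (h : ∀ a < s, G.Edge (f a) (f (a + 1)) (g a))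
    {a b : ℕ} (hab : a ≤ b) (hb : b ≤ s) :
    G.EdgeWalk (b - a) (f a) (f b) (∑ c ∈ Finset.Ico a b, g c) := by
  induction b, hab using Nat.le_induction with
  | base => simpa using EdgeWalk.nil (f a)
  | succ b hab ih =>
    rw [Finset.sum_Ico_succ_top hab, Nat.succ_sub hab]
    exact (ih (by omega)).append (single (h b (by omega)))

theorem split {s i k : ℕ} {z : ℤ} (p : G.EdgeWalk s i k z) {a : ℕ} (ha : a ≤ s) :
    ∃ j x y, G.EdgeWalk a i j x ∧ G.EdgeWalk (s - a) j k y ∧ z = x + y := by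
  obtain ⟨f, g, rfl, rfl, he, rfl⟩ := p.exists_path
  refine ⟨f a, _, _, of_path he (Nat.zero_le a) ha, of_path he ha le_rfl, ?_⟩
  exact (Finset.sum_Ico_consecutive _ (Nat.zero_le a) ha).symm

theorem abs_le {W : ℤ} (hW : ∀ i j x, G.Edge i j x → |x| ≤ W) {s i j : ℕ} {z : ℤ}
    (p : G.EdgeWalk s i j z) : |z| ≤ s * W := by
  induction p with
  | nil => simp
  | cons h p ih =>
    push_cast
    rw [add_mul, one_mul, add_comm]
    exact (abs_add_le _ _).trans (by linarith [hW _ _ _ h])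

theorem target_lt {s i j : ℕ} {z : ℤ} (p : G.EdgeWalk s i j z) {N : ℕ} (hi : i < N)
    (hN : G.n ≤ N) : j < N := by
  induction p with
  | nil => exact hi
  | cons h _ ih => exact ih (h.2.1.trans_le hN)

theorem hasWalk {s i j : ℕ} {z : ℤ} (p : G.EdgeWalk s i j z) (hi : i < G.n) :
    ∃ hj : j < G.n, G.HasWalk ⟨i, hi⟩ ⟨j, hj⟩ z := by
  induction p with
  | nil => exact ⟨hi, .nil _⟩
  | cons h _ ih =>
    obtain ⟨_, hj, hw⟩ := h
    obtain ⟨hk, hp⟩ := ih hj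
    exact ⟨hk, .cons hw hp⟩

/-- A long walk contains a short cycle. -/
theorem exists_cycle {s i j : ℕ} {z : ℤ} (p : G.EdgeWalk s i j z) (hs : G.n < s) :
    ∃ v a b c x y w, G.EdgeWalk a i v x ∧ G.EdgeWalk b v v y ∧ G.EdgeWalk c v j w ∧ 0 < b ∧
      a ≤ G.n ∧ b ≤ G.n ∧ a + b + c = s ∧ z = x + y + w := by
  obtain ⟨f, g, rfl, rfl, he, rfl⟩ := p.exists_path
  -- The pigeonhole principle for the first `G.n + 1` vertices only. Each of them has an outgoing
  -- edge because `G.n < s`, so its number is that of a vertex, and both `a` and the length of the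
  -- cycle are at most `G.n`.
  obtain ⟨a, b, hab, hf⟩ := Fintype.exists_ne_map_eq_of_card_lt
    (fun a : Fin (G.n + 1) => (⟨f a, (he a (by omega)).1⟩ : Fin G.n)) (by simp)
  simp only [Fin.mk.injEq] at hf
  wlog hlt : a.val < b.val generalizing a b
  · exact this b a hab.symm hf.symm (by have := Fin.val_ne_iff.2 hab; omega)
  have h2 := of_path he hlt.le (by omega)
  rw [← hf] at h2
  have h3 := of_path he (show b.val ≤ s by omega) le_rfl
  rw [← hf] at h3
  refine ⟨f a, a, b - a, s - b, _, _, _, of_path he (Nat.zero_le a) (by omega), h2, h3, by omega,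
    by omega, by omega, by omega, ?_⟩
  rw [Finset.sum_Ico_consecutive _ (Nat.zero_le _) hlt.le,
    Finset.sum_Ico_consecutive _ (Nat.zero_le _) (by omega)]

/-- Cycles are cut out one by one. The weight may change in either direction, so this speaks of
reachability only. -/
theorem exists_short {s i j : ℕ} {z : ℤ} (p : G.EdgeWalk s i j z) :
    ∃ s' ≤ G.n, ∃ z', G.EdgeWalk s' i j z' := by
  induction s using Nat.strong_induction_on generalizing z with
  | _ s ih =>
    by_cases hs : s ≤ G.n
    · exact ⟨s, hs, z, p⟩
    · obtain ⟨v, a, b, c, x, y, w, h1, -, h3, hb, -, -, hsum, -⟩ := p.exists_cycle (by omega)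
      exact ih (a + c) (by omega) (h1.append h3)

end EdgeWalk

theorem HasWalk.edgeWalk {i j : Fin G.n} {z : ℤ} (p : G.HasWalk i j z) :
    ∃ s, G.EdgeWalk s i j z := by
  induction p with
  | nil i => exact ⟨0, .nil i⟩
  | @cons i j k x y h _ ih =>
    obtain ⟨s, hs⟩ := ih
    exact ⟨s + 1, .cons ⟨i.2, j.2, h⟩ hs⟩

/-- Running around the cycle `|x + w - m|` times brings the weight down to at most `m`, for every
integer `m`. -/
theorem dist_eq_bot {i j v : Fin G.n} {x y w : ℤ} (h1 : G.HasWalk i v x) (h2 : G.HasWalk v v y)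
    (h3 : G.HasWalk v j w) (hy : y < 0) : G.dist i j = ⊥ := by
  have hk : ∀ k : ℕ, G.HasWalk v v (k * y) := fun k => by
    induction k with
    | zero => simpa using HasWalk.nil v
    | succ k ih =>
      push_cast
      rw [add_mul, one_mul]
      exact ih.append h2
  have hle : ∀ m : ℤ, G.dist i j ≤ ((m : WithTop ℤ) : ExtInt) := fun m => by
    refine (dist_le (h1.append ((hk (x + w - m).natAbs).append h3))).trans (coe_le_coe_int.2 ?_)
    have h4 : x + w - m ≤ ((x + w - m).natAbs : ℤ) := Int.le_natAbs
    nlinarith [Int.natCast_nonneg (x + w - m).natAbs]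
  generalize G.dist i j = d at hle
  induction d using WithBot.recBotCoe with
  | bot => rfl
  | coe d =>
    induction d using WithTop.recTopCoe with
    | top => exact absurd (top_le_iff.1 (WithBot.coe_le_coe.1 (hle 0))) WithTop.coe_ne_top
    | coe d => have := coe_le_coe_int.1 (hle (d - 1)); omega

/-- The entries of `A` are the minimal weights of walks with at most `s` edges, where `4 * X` stands
for infinity. -/
def WalkMat (G : WGraph) (N X s : ℕ) (A : ℕ → ℕ → ℤ) : Prop :=
  ∀ i < N, ∀ j < N, (∀ s' ≤ s, ∀ z, G.EdgeWalk s' i j z → A i j ≤ z) ∧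
    (A i j = 4 * X ∨ |A i j| ≤ X ∧ ∃ s' ≤ s, G.EdgeWalk s' i j (A i j))

/-- The cut at `X` separates finite from infinite entries: a sum of two finite entries is the weight
of a walk with at most `2 * s` edges, hence at most `X`, a sum with an infinite term is at least `3
* X`, and an unresolved entry `P - 1` is at least `2 * X + 1`. -/
theorem WalkMat.square {N X s P : ℕ} {A S : ℕ → ℕ → ℤ} (hA : G.WalkMat N X s A) (hN : G.n ≤ N)
    (hX0 : 0 < X) (hX : ∀ s' ≤ 2 * s, ∀ i j z, G.EdgeWalk s' i j z → |z| ≤ X)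
    (hP : 2 * X + 2 ≤ P) (hS : ∀ i < N, ∀ j < N, (∀ k < N, S i j ≤ A i k + A k j) ∧
      ((∃ k < N, A i k + A k j = S i j) ∨ S i j + 1 = P)) :
    G.WalkMat N X (2 * s) (fun i j => if S i j ≤ X then S i j else 4 * X) := by
  intro i hi j hj
  obtain ⟨h1, h2⟩ := hS i hi j hj
  constructor
  · intro s' hs' z p
    -- Splitting after `min s' s` edges leaves at most `s` edges on both sides.
    obtain ⟨k, x, y, p1, p2, rfl⟩ := p.split (min_le_left s' s)
    have hk := p1.target_lt hi hN
    have h3 := (hA i hi k hk).1 _ (by omega) _ p1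
    have h4 := (hA k hk j hj).1 _ (by omega) _ p2
    have h5 := h1 k hk
    have h6 := abs_le.1 (hX _ hs' _ _ _ p)
    beta_reduce
    rw [if_pos (by omega)]
    omega
  · by_cases hle : S i j ≤ X
    · right
      simp only [hle, if_true]
      rcases h2 with ⟨k, hk, hsum⟩ | h2
      · rcases (hA i hi k hk).2 with h3 | ⟨h3, s1, hs1, p1⟩ <;>
          rcases (hA k hk j hj).2 with h4 | ⟨h4, s2, hs2, p2⟩
        · omega
        · rw [abs_le] at h4
          omega
        · rw [abs_le] at h3
          omega
        · have p := p1.append p2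
          rw [hsum] at p
          exact ⟨hX _ (by omega) _ _ _ p, _, by omega, p⟩
      · omega
    · left
      simp [hle]

/-- A reachable vertex is reached by a walk with at most `G.n ≤ s` edges, and the weight of such a
walk is at most `X < 4 * X`. -/
theorem WalkMat.ne_iff {N X s : ℕ} {A : ℕ → ℕ → ℤ} (hA : G.WalkMat N X s A) (hX0 : 0 < X)
    (hX : ∀ s' ≤ s, ∀ i j z, G.EdgeWalk s' i j z → |z| ≤ X) (hs : G.n ≤ s) {i j : ℕ} (hi : i < N)
    (hj : j < N) : A i j ≠ 4 * X ↔ ∃ s' z, G.EdgeWalk s' i j z := by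
  refine ⟨fun h => ?_, ?_⟩
  · obtain ⟨-, s', -, p⟩ := (hA i hi j hj).2.resolve_left h
    exact ⟨s', _, p⟩
  · rintro ⟨s', z, p⟩ h
    obtain ⟨s'', hs'', z', p'⟩ := p.exists_short
    have h1 := (hA i hi j hj).1 _ (hs''.trans hs) _ p'
    have h2 := abs_le.1 (hX _ (hs''.trans hs) _ _ _ p')
    omega

/-- The distances can be read off from the minimal weights of walks with at most `s ≥ n` edges. -/
theorem WalkMat.dist_eq {N X s : ℕ} {A : ℕ → ℕ → ℤ} (hA : G.WalkMat N X s A) (hN : G.n ≤ N)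
    (hX0 : 0 < X) (hX : ∀ s' ≤ s, ∀ i j z, G.EdgeWalk s' i j z → |z| ≤ X) (hs : G.n ≤ s)
    (i j : Fin G.n) :
    ((∃ v < N, A i v ≠ 4 * X ∧ A v v < 0 ∧ A v j ≠ 4 * X) → G.dist i j = ⊥) ∧
    (¬ (∃ v < N, A i v ≠ 4 * X ∧ A v v < 0 ∧ A v j ≠ 4 * X) → (A i j = 4 * X → G.dist i j = ⊤) ∧
      (A i j ≠ 4 * X → G.dist i j = ((A i j : WithTop ℤ) : ExtInt))) := by
  have hi := i.2.trans_le hN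
  have hj := j.2.trans_le hN
  constructor
  · rintro ⟨v, hv, h1, h2, h3⟩
    obtain ⟨-, _, -, p1⟩ := (hA i hi v hv).2.resolve_left h1
    obtain ⟨-, _, -, p2⟩ := (hA v hv v hv).2.resolve_left (by omega)
    obtain ⟨-, _, -, p3⟩ := (hA v hv j hj).2.resolve_left h3
    obtain ⟨hvn, q1⟩ := p1.hasWalk i.2
    obtain ⟨_, q2⟩ := p2.hasWalk hvn
    obtain ⟨_, q3⟩ := p3.hasWalk hvn
    exact dist_eq_bot q1 q2 q3 h2
  · intro hneg
    -- Here cutting out a cycle does not increase the weight: a cycle with at most `G.n ≤ s` edges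
    -- and negative weight would make a diagonal entry negative, which `hneg` excludes.
    have short : ∀ L z, G.EdgeWalk L i j z → ∃ s' ≤ G.n, ∃ z' ≤ z, G.EdgeWalk s' i j z' := by
      intro L
      induction L using Nat.strong_induction_on with
      | _ L ih =>
        intro z p
        by_cases hL : L ≤ G.n
        · exact ⟨L, hL, z, le_rfl, p⟩
        · obtain ⟨v, a, b, c, x, y, w, h1, h2, h3, hb, ha, hbn, hsum, hz⟩ :=
            p.exists_cycle (by omega)
          have hv := h1.target_lt hi hN
          have hy : 0 ≤ y := by
            by_contra hy
            refine hneg ⟨v, hv, (hA.ne_iff hX0 hX hs hi hv).2 ⟨_, _, h1⟩, ?_,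
              (hA.ne_iff hX0 hX hs hv hj).2 ⟨_, _, h3⟩⟩
            have := (hA v hv v hv).1 _ (hbn.trans hs) _ h2
            omega
          obtain ⟨s', hs', z', hz', p'⟩ := ih (a + c) (by omega) _ (h1.append h3)
          exact ⟨s', hs', z', by omega, p'⟩
    constructor
    · intro h
      refine top_le_iff.1 (le_dist fun z p => ?_)
      obtain ⟨L, p⟩ := p.edgeWalk
      exact absurd h ((hA.ne_iff hX0 hX hs hi hj).2 ⟨_, _, p⟩)
    · intro h
      obtain ⟨-, _, -, p⟩ := (hA i hi j hj).2.resolve_left h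
      obtain ⟨_, p⟩ := p.hasWalk i.2
      refine le_antisymm (dist_le p) (le_dist fun z p => coe_le_coe_int.2 ?_)
      obtain ⟨L, p⟩ := p.edgeWalk
      obtain ⟨s', hs', z', hz', p'⟩ := short L z p
      exact ((hA i hi j hj).1 _ (hs'.trans hs) _ p').trans hz'

end WGraph

/-! ## Preparing the parameters -/

namespace WGraph
variable (G : WGraph)

open Classical in
/-- The adjacency matrix. -/
noncomputable def adj (i j : ℕ) : ℤ := if ∃ x, G.Edge i j x then 1 else 0

open Classical in
/-- The weights of the edges, and `0` for the pairs without an edge. -/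
noncomputable def wt (i j : ℕ) : ℤ := if h : ∃ x, G.Edge i j x then h.choose else 0

variable {G}

theorem Edge.unique {i j : ℕ} {x y : ℤ} (h : G.Edge i j x) (h' : G.Edge i j y) : x = y := by
  obtain ⟨_, _, h⟩ := h
  obtain ⟨_, _, h'⟩ := h'
  exact WithTop.coe_injective (h.symm.trans h')

theorem Edge.ne {i j : ℕ} {x : ℤ} (h : G.Edge i j x) : i ≠ j := by
  rintro rfl
  obtain ⟨hi, _, h⟩ := h
  rw [G.loopless] at h
  exact WithTop.top_ne_coe h

theorem Edge.wt_eq {i j : ℕ} {x : ℤ} (h : G.Edge i j x) : G.wt i j = x := by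
  have h' : ∃ x, G.Edge i j x := ⟨x, h⟩
  rw [wt, dif_pos h']
  exact h'.choose_spec.unique h

theorem Edge.adj_eq {i j : ℕ} {x : ℤ} (h : G.Edge i j x) : G.adj i j = 1 := if_pos ⟨x, h⟩

theorem edge_or (i j : ℕ) : G.Edge i j (G.wt i j) ∧ G.adj i j = 1 ∨
    (∀ x, ¬ G.Edge i j x) ∧ G.adj i j = 0 ∧ G.wt i j = 0 := by
  by_cases h : ∃ x, G.Edge i j x
  · obtain ⟨x, hx⟩ := h
    exact Or.inl ⟨by rwa [hx.wt_eq], hx.adj_eq⟩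
  · exact Or.inr ⟨fun x hx => h ⟨x, hx⟩, if_neg h, dif_neg h⟩

theorem abs_wt_le {M : ℕ} (hM : G.BoundedBy M) (i j : ℕ) : |G.wt i j| ≤ M := by
  rcases G.edge_or i j with ⟨⟨hi, hj, h⟩, -⟩ | ⟨-, -, h⟩
  · exact hM _ _ _ h
  · simp [h]

theorem abs_adj_le (i j : ℕ) : |G.adj i j| ≤ 1 := by
  rcases G.edge_or i j with ⟨-, h⟩ | ⟨-, h, -⟩ <;> simp [h]

end WGraph

/-- The input convention restricts array `2` only at edges, hence the condition in the second part.
-/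
theorem Holds.edge {σ : State} {G : WGraph} (h : Holds σ G) : Mat σ 1 G.n G.adj ∧
    ∀ i < G.n, ∀ j < G.n, G.adj i j = 1 → σ 2 ((i : ℤ) * G.n + j) = G.wt i j := by
  have key : ∀ i < G.n, ∀ j < G.n, σ 1 ((i : ℤ) * G.n + j) = G.adj i j ∧
      (G.adj i j = 1 → σ 2 ((i : ℤ) * G.n + j) = G.wt i j) := by
    intro i hi j hj
    obtain ⟨h1, h2⟩ := h.2 ⟨i, hi⟩ ⟨j, hj⟩
    rcases G.edge_or i j with ⟨⟨_, _, hw⟩, ha⟩ | ⟨hno, ha, -⟩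
    · exact ⟨(h2 _ hw).1.trans ha.symm, fun _ => (h2 _ hw).2⟩
    · refine ⟨(h1 ?_).trans ha.symm, fun h => by omega⟩
      by_contra hne
      obtain ⟨x, hx⟩ := WithTop.ne_top_iff_exists.1 hne
      exact hno x ⟨hi, hj, hx.symm⟩
  exact ⟨fun i hi j hj => (key i hi j hj).1, fun i hi j hj => (key i hi j hj).2⟩

/-- The fourth power of variable `5`. -/
def fourth : Expr := var 5 * var 5 * (var 5 * var 5)

/-- Computing the size of the blocks and the dimension of the matrices. -/
def sizes : Program :=
  .seq (.set 4 (lit 0) (var 0)) <| .seq (.set 5 (lit 0) (lit 1)) <|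
  .seq (.while (var 4 - fourth) (.set 5 (lit 0) (var 5 + lit 1))) (.set 6 (lit 0) fourth)

/-- Replacing the unspecified weights of the pairs without an edge by zeros. -/
def cleanWeights : Program :=
  .cells 4 (.ite (get 1 (var 17)) (.set 38 (var 17) (get 2 (var 17))) (.set 38 (var 17) (lit 0)))

/-- Computing a bound on the weights of the edges. -/
def weightBound : Program :=
  .seq (.set 24 (lit 0) (lit 1)) <|
  .cells 4 (.set 24 (lit 0) (var 24 + get 38 (var 17) * get 38 (var 17)))

/-- Computing the bounds for the entries of the matrices. -/
def entryBounds : Program :=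
  .seq (.set 7 (lit 0) (lit 2 * var 6 * var 24)) <| .seq (.set 8 (lit 0) (lit 100 * var 7)) <|
  .seq (.set 9 (lit 0) (lit 1)) <|
  .while (lit 2 * var 7 + lit 2 - var 9) (.set 9 (lit 0) (var 9 + var 9))

section
variable {Q : GraphProblem} {β : BlackBox} {Y : ℕ} {σ : State}

theorem Run.sizes {n q : ℕ} (hY : 2 ≤ Y) (h0 : σ 0 0 = n) (hq0 : 0 < q) (hq : n ≤ q ^ 4)
    (hmin : ∀ k < q, k ^ 4 < n) (hqY : q ^ 4 ≤ Y) :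
    Run Q β Y sizes σ (q * 50) (fun τ => τ 4 0 = n ∧ τ 5 0 = q ∧ τ 6 0 = (q ^ 4 : ℕ)) := by
  have hqq : q ≤ q ^ 4 := Nat.le_self_pow (by omega) q
  have e4 : ∀ k : ℕ, (k : ℤ) * k * (k * k) = (k ^ 4 : ℕ) := fun k => by push_cast; ring
  refine (Run.seq_frame (T := 4) (T' := 3 + ((q - 1) * 40 + 18) + 17)
    (Run.set (Φ := fun τ => τ 4 0 = n) hY (by simp) (by simp) (by simp)
    (by simp [h0]; omega) (by simp [h0])) fun τ₁ h4 f1 => ?_).imp (by omega) (fun _ h => h)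
  rw [add_assoc]
  refine Run.seq_frame (T := 3) (Run.set (Φ := fun τ => τ 5 0 = 1) hY (by simp) (by simp) (by simp)
    (by simp; omega) (by simp)) fun τ₂ h5 f2 => ?_
  refine Run.seq_frame (T := (q - 1) * 40 + 18) ((Run.while (n := q - 1) (T := 6)
    (e := var 4 - fourth) hY (by simp [fourth]) (fun k τ => τ 5 0 = ((k + 1 : ℕ) : ℤ))
      (by simpa using h5) ?_ ?_).imp (by simp [fourth]; omega) (fun _ h => h)) ?_
  · intro k hk τ hf h
    have h4' : τ 4 0 = n := by rw [hf 4 rfl, f2 4 rfl, h4]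
    have := hmin (k + 1) (by omega)
    simp only [fourth, Expr.small_sub, Expr.small_mul, Expr.small_var, Expr.eval_sub, Expr.eval_mul,
      Expr.eval_var, h, h4', e4, Nat.abs_cast]
    refine ⟨by omega, by omega, Run.set hY (by simp) (by simp) (by simp) ?_ ?_⟩
    · simp only [Expr.small_add, Expr.small_var, Expr.small_lit, h, Nat.abs_cast, abs_one]
      omega
    · simp [h]
  · intro τ hf h
    have h4' : τ 4 0 = n := by rw [hf 4 rfl, f2 4 rfl, h4]
    rw [Nat.sub_add_cancel hq0] at h
    simp only [fourth, Expr.small_sub, Expr.small_mul, Expr.small_var, Expr.eval_sub, Expr.eval_mul,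
      Expr.eval_var, h, h4', e4, Nat.abs_cast]
    omega
  · intro τ₃ h f3
    rw [Nat.sub_add_cancel hq0] at h
    refine (Run.set hY (by simp) (by simp [fourth]) (by simp) ?_ ⟨?_, ?_, ?_⟩).imp
      (by simp [fourth]) (fun _ h => h)
    · simp only [fourth, Expr.small_mul, Expr.small_var, h, Nat.abs_cast]
      omega
    · rw [upd_of_ne (by omega), f3 4 rfl, f2 4 rfl, h4]
    · rw [upd_of_ne (by omega), h]
    · simp only [fourth, Expr.eval_lit, upd_cell, Expr.eval_mul, Expr.eval_var, h, e4]

/-- Adjacency is tested before a weight is read, since an unspecified cell may hold a number that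
does not fit a word. -/
theorem Run.cleanWeights {G : WGraph} {M : ℕ} (hY : 2 ≤ Y) (hH : Holds σ G) (hM : G.BoundedBy M)
    (hMY : M ≤ Y) (hnY : G.n * G.n ≤ Y) (h4 : σ 4 0 = G.n) :
    Run Q β Y cleanWeights σ (G.n * G.n * 100) (fun τ => Mat τ 38 G.n G.wt) := by
  refine (Run.fill (r := 4) (a := 38) (p := .ite (get 1 (var 17)) (.set 38 (var 17)
      (get 2 (var 17))) (.set 38 (var 17) (lit 0))) G.wt hY
    ⟨by simp, ⟨by simp, by simp⟩, by simp, by simp⟩ G.n_pos hnY (by omega) (fun b hb => by simp [Program.mod, hb]) (by omega) (by omega) h4 ?_).imp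
    (Nat.mul_le_mul_left _ (by simp [Program.cost])) (fun _ h => h.1)
  intro i hi j hj τ hf h17 _ _ _
  have e1 : τ 1 (τ 17 0) = G.adj i j := by
    rw [hf 1 (by omega) (by omega), h17, hH.edge.1 i hi j hj]
  have e2 : G.adj i j = 1 → τ 2 (τ 17 0) = G.wt i j := fun h => by
    rw [hf 2 (by omega) (by omega), h17, hH.edge.2 i hi j hj h]
  have e17 : |τ 17 0| ≤ (Y : ℤ) := by
    have := cell_lt hi hj
    rw [h17, abs_of_nonneg (by positivity)]
    exact_mod_cast (by omega : i * G.n + j ≤ Y)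
  have hw := abs_wt_le hM i j
  have ha := G.abs_adj_le i j
  simp only [WP, Expr.small_get, Expr.small_var, Expr.eval_get, Expr.eval_var, Expr.small_lit, e1,
    Expr.eval_lit, e17]
  refine ⟨⟨trivial, by omega⟩, fun h => ?_, fun h => ?_⟩
  · rcases G.edge_or i j with ⟨-, h'⟩ | ⟨-, h', -⟩
    · rw [e2 h', h17]
      exact ⟨trivial, ⟨trivial, by omega⟩, rfl⟩
    · omega
  · rcases G.edge_or i j with ⟨-, h'⟩ | ⟨-, -, h'⟩
    · omega
    · rw [h', h17]
      simp

/-- One plus the sum of the squares bounds every `|f i j|`, since `|x| ≤ x * x` for integers, and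
takes no comparisons. A polynomial overestimate does no harm, as bounds on entries enter running
times only through logarithms. -/
theorem Run.weightBound {n M : ℕ} {f : ℕ → ℕ → ℤ} (hY : 2 ≤ Y) (hn : 0 < n) (hnY : n * n ≤ Y)
    (hMY : 1 + n * n * (M * M) ≤ Y) (hf : Mat σ 38 n f)
    (hM : ∀ i < n, ∀ j < n, |f i j| ≤ M) (h4 : σ 4 0 = n) :
    Run Q β Y weightBound σ (n * n * 100) (fun τ => ∃ W : ℕ, τ 24 0 = W ∧ 1 ≤ W ∧
      W ≤ 1 + n * n * (M * M) ∧ ∀ i < n, ∀ j < n, |f i j| ≤ W) := by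
  have hnn : 1 ≤ n * n := Nat.mul_pos hn hn
  have hM' : M ≤ n * n * (M * M) := (Nat.le_mul_self M).trans (Nat.le_mul_of_pos_left _ hnn)
  refine (Run.seq_frame (T := 3) (T' := n * n * (13 + 75)) (Run.set (Φ := fun τ => τ 24 0 = 1) hY
    (by simp) (by simp) (by simp) (by simp; omega) (by simp)) fun τ₁ h24 f1 => ?_).imp
    (by omega) (fun _ h => h)
  refine (Run.cells (r := 4) (T := 13) hY hn hnY (fun c τ => ∃ W : ℕ, τ 24 0 = W ∧ 1 ≤ W ∧
    W ≤ 1 + c * (M * M) ∧ ∀ i < n, ∀ j < n, i * n + j < c → |f i j| ≤ W) rfl (by omega) rfl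
    (by rw [f1 4 rfl, h4]) ?_ ?_ ?_).imp le_rfl ?_
  · intro c τ τ' h hI
    rwa [h 24 (by omega)]
  · exact ⟨1, by simpa using h24, le_rfl, by simp, by simp⟩
  · rintro i hi j hj τ hfr h17 h18 h19 ⟨W, hW, h1, h2, h3⟩
    have hlt := cell_lt hi hj
    have e38 : τ 38 (τ 17 0) = f i j := by
      rw [hfr 38 rfl (by omega), h17, f1 38 rfl, hf i hi j hj]
    have e17 : |τ 17 0| ≤ (Y : ℤ) := by
      rw [h17, abs_of_nonneg (by positivity)]
      exact_mod_cast (by omega : i * n + j ≤ Y)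
    have hle := hM i hi j hj
    have hna : (f i j).natAbs ≤ M := by
      rw [← Int.natCast_natAbs] at hle
      exact_mod_cast hle
    have hsq := Nat.mul_self_le_mul_self hna
    have hc : (i * n + j) * (M * M) ≤ n * n * (M * M) := Nat.mul_le_mul_right _ hlt.le
    refine (Run.set hY (by simp) (by simp) (by simp) ?_ ?_).imp (by simp) (fun _ h => h)
    · simp only [Expr.small_add, Expr.small_mul, Expr.small_get, Expr.small_var, Expr.eval_var, e17,
        hW, e38, Nat.abs_cast]
      exact ⟨by omega, ⟨trivial, by omega⟩, trivial, by omega⟩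
    · have hle2 : (f i j).natAbs ≤ (f i j).natAbs * (f i j).natAbs := Nat.le_mul_self _
      refine ⟨W + (f i j).natAbs * (f i j).natAbs, ?_, by omega, ?_, ?_⟩
      · rw [Expr.eval_lit, upd_cell, Expr.eval_add, Expr.eval_mul, Expr.eval_get, Expr.eval_var, Expr.eval_var, hW,
          e38, Nat.cast_add, Nat.cast_mul, Int.natAbs_mul_self']
      · rw [Nat.add_mul (i * n + j) 1, Nat.one_mul]
        omega
      · intro i' hi' j' hj' hlt'
        push_cast
        rcases Nat.lt_succ_iff_lt_or_eq.1 hlt' with h | h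
        · have := h3 i' hi' j' hj' h
          have := mul_self_nonneg |f i j|
          omega
        · obtain ⟨rfl, rfl⟩ := (cell_inj hj' hj).1 h
          rw [← Int.natCast_natAbs] at *
          exact_mod_cast (by omega)
  · rintro τ ⟨W, hW, h1, h2, h3⟩
    exact ⟨W, hW, h1, h2, fun i hi j hj => h3 i hi j hj (cell_lt hi hj)⟩

theorem Run.entryBounds {N W X l : ℕ} (hY : 2 ≤ Y) (hX : X = 2 * N * W) (hX0 : 0 < X)
    (hXY : 800 * X ≤ Y) (hl : 2 * X + 2 ≤ 2 ^ l) (hl' : ∀ k < l, 2 ^ k < 2 * X + 2)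
    (h6 : σ 6 0 = N) (h24 : σ 24 0 = W) :
    Run Q β Y entryBounds σ (l * 30 + 50) (fun τ => τ 7 0 = X ∧ τ 8 0 = (100 * X : ℕ) ∧
      τ 9 0 = (2 ^ l : ℕ)) := by
  have hNW : N * 2 ≤ X * 2 ∧ W ≤ X := by
    have h1 : 0 < N := by by_contra h; simp_all
    have h2 : 0 < W := by by_contra h; simp_all
    constructor <;> nlinarith
  have hlX : 2 ^ l ≤ 4 * X + 2 := by
    rcases l with _ | l
    · simp
    · have := hl' l (by omega)
      rw [pow_succ]
      omega
  refine (Run.seq_frame (T := 9) (T' := 6 + (3 + (l * (7 + 9 + 1) + (9 + 1))))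
    (Run.set (Φ := fun τ => τ 7 0 = X) hY (by simp) (by simp) (by simp)
    ?_ ?_) fun τ₁ h7 f1 => ?_).imp (by omega) (fun _ h => h)
  · simp only [Expr.small_mul, Expr.small_var, Expr.small_lit, h6, h24, Nat.abs_cast]
    norm_num
    omega
  · simp [h6, h24, hX]
  refine Run.seq_frame (T := 6) (Run.set (Φ := fun τ => τ 8 0 = (100 * X : ℕ)) hY (by simp)
    (by simp) (by simp) ?_ ?_) fun τ₂ h8 f2 => ?_
  · simp only [Expr.small_mul, Expr.small_var, Expr.small_lit, h7, Nat.abs_cast]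
    norm_num
    omega
  · simp [h7]
  refine Run.seq_frame (T := 3) (Run.set (Φ := fun τ => τ 9 0 = 1) hY (by simp) (by simp) (by simp)
    (by simp; omega) (by simp)) fun τ₃ h9 f3 => ?_
  have e7 : τ₃ 7 0 = X := by rw [f3 7 rfl, f2 7 rfl, h7]
  have e8 : τ₃ 8 0 = (100 * X : ℕ) := by rw [f3 8 rfl, h8]
  refine ((Run.while (n := l) (T := 7) (e := lit 2 * var 7 + lit 2 - var 9) hY (by simp)
    (fun k τ => τ 9 0 = (2 ^ k : ℕ)) (by simpa using h9) ?_ ?_).frame).imp (by simp) ?_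
  · intro k hk τ hf h
    have := hl' k hk
    simp only [Expr.small_add, Expr.small_sub, Expr.small_mul, Expr.small_var, Expr.small_lit,
      Expr.eval_add, Expr.eval_sub, Expr.eval_mul, Expr.eval_var, Expr.eval_lit, h, hf 7 rfl, e7,
      Nat.abs_cast]
    norm_num only
    refine ⟨by omega, by omega, (Run.set hY (by simp) (by simp) (by simp) ?_ ?_).imp (by simp)
      (fun _ h => h)⟩
    · simp only [Expr.small_add, Expr.small_var, h, Nat.abs_cast]
      omega
    · simp only [Expr.eval_add, Expr.eval_var, Expr.eval_lit, upd_cell, h]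
      push_cast
      ring
  · intro τ hf h
    simp only [Expr.small_add, Expr.small_sub, Expr.small_mul, Expr.small_var, Expr.small_lit,
      Expr.eval_add, Expr.eval_sub, Expr.eval_mul, Expr.eval_var, Expr.eval_lit, h, hf 7 rfl, e7,
      Nat.abs_cast]
    norm_num only
    omega
  · rintro τ ⟨h, hf⟩
    exact ⟨by rw [hf 7 rfl, e7], by rw [hf 8 rfl, e8], h⟩

end

/-! ## Repeated squaring -/

/-- Whether the row and the column of the current cell are numbers of vertices. -/
def inRange : Expr :=
  posE (var 4 - var 18) (lit 1 + var 6) * posE (var 4 - var 19) (lit 1 + var 6)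

/-- The position of the current pair of vertices in the adjacency matrix. -/
def pairIx : Expr := (var 18 * var 4 + var 19) * inRange

/-- The minimal weight of a walk with at most one edge. -/
def initEntry : Expr :=
  (lit 1 - eqE (var 18) (var 19)) * (get 1 pairIx * inRange * get 38 pairIx +
    (lit 1 - get 1 pairIx * inRange) * (lit 4 * var 7))

/-- The computed entry of a product, where large entries are replaced by infinity. -/
def cutEntry : Expr :=
  posE (lit 1 + var 7 - get 33 (var 17)) (var 8) * get 33 (var 17) +
    (lit 1 - posE (lit 1 + var 7 - get 33 (var 17)) (var 8)) * (lit 4 * var 7)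

/-- Squaring the matrix in array `30`. -/
def squareMatrix (wt : Expr) : Program :=
  .seq (.cells 6 (.set 31 (var 17) (get 30 (var 17)))) <| .seq (product wt) <|
  .cells 6 (.set 30 (var 17) cutEntry)

/-- Computing the minimal weights of walks. -/
def walkWeights (wt : Expr) : Program :=
  .seq (.cells 6 (.set 30 (var 17) initEntry)) <| .seq (.set 11 (lit 0) (lit 1)) <|
  .while (var 6 - var 11) (.seq (squareMatrix wt) (.set 11 (lit 0) (var 11 + var 11)))

section
variable {Q : GraphProblem} {β : BlackBox} {Y q X P t : ℕ} {σ : State} {G : WGraph}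
variable {wt : Expr} {w : ℤ → (ℕ → ℕ → ℤ) → (ℕ → ℕ → ℤ) → (ℕ → ℕ → ℤ) → ℕ → ℕ → ℕ → ℕ → ℤ}

theorem WGraph.WalkMat.bdd {N X s : ℕ} {A : ℕ → ℕ → ℤ} (hA : G.WalkMat N X s A) :
    Bdd N (4 * X) A ∧ ∀ i < N, ∀ j < N, -(X : ℤ) ≤ A i j := by
  constructor <;> intro i hi j hj <;> rcases (hA i hi j hj).2 with h | ⟨h, -⟩
  · rw [h, abs_of_nonneg (by positivity)]
  · omega
  · omega
  · exact (abs_le.1 h).1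

/-- The dimension `q ^ 4` may exceed `G.n`; the additional indices act as isolated vertices. -/
theorem Run.initMatrix (H : Params Q β Y q X P t) (hR : Regs σ q X P) (h4 : σ 4 0 = G.n)
    (hadj : Mat σ 1 G.n G.adj) (hwt : Mat σ 38 G.n G.wt) (hn : G.n ≤ q ^ 4)
    (hX : ∀ i j, |G.wt i j| ≤ X) :
    Run Q β Y (.cells 6 (.set 30 (var 17) initEntry)) σ (q ^ 11 * 400) (fun τ =>
      ∃ D, Mat τ 30 (q ^ 4) D ∧ G.WalkMat (q ^ 4) X 1 D) := by
  classical
  have hq0 := H.q_pos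
  have hY := H.word
  have hX800 := H.X_le
  have hX0 := H.X_pos
  have h4Y := H.pow_le (k := 4) (by omega)
  have hq4 : 0 < q ^ 4 := by positivity
  refine (Run.fill_expr (r := 6) (a := 30) (e := initEntry)
    (fun i j => if i = j then 0 else if G.adj i j = 1 then G.wt i j else 4 * X)
    (by omega) (by simp [initEntry, pairIx, inRange]) hq4 H.cells_le (by omega) (by omega)
    (by omega) hR.r6 ?_).imp ?_ ?_
  · intro i hi j hj τ hf h17 h18 h19 _
    have e6 : τ 6 0 = (q ^ 4 : ℕ) := by rw [hf 6 (by omega) (by omega), hR.r6]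
    have e7 : τ 7 0 = X := by rw [hf 7 (by omega) (by omega), hR.r7]
    have e4 : τ 4 0 = G.n := by rw [hf 4 (by omega) (by omega), h4]
    have hpos : ∀ a k, τ a 0 = ((k : ℕ) : ℤ) → k < q ^ 4 →
        (posE (var 4 - var a) (lit 1 + var 6)).eval τ = if k < G.n then 1 else 0 := by
      intro a k ha hk
      rw [Expr.eval_posE]
      · simp only [Expr.eval_sub, Expr.eval_var, e4, ha]
        by_cases h : k < G.n
        · rw [if_pos h, if_pos (by omega)]
        · rw [if_neg h, if_neg (by omega)]
      · simp only [Expr.eval_sub, Expr.eval_add, Expr.eval_lit, Expr.eval_var, e4, e6, ha]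
        rw [abs_lt]
        omega
    have hin : inRange.eval τ = if i < G.n ∧ j < G.n then 1 else 0 := by
      rw [inRange, Expr.eval_mul, hpos 18 i h18 hi, hpos 19 j h19 hj]
      by_cases h1 : i < G.n <;> by_cases h2 : j < G.n <;> simp [h1, h2]
    have sin : inRange.Small Y τ := by
      simp only [inRange, Expr.small_mul, Expr.small_posE, Expr.small_sub, Expr.small_add,
        Expr.small_var, Expr.small_lit, e4, e6, h18, h19, Nat.abs_cast, abs_one]
      omega
    -- Outside the range of the vertices the address collapses to cell `0`, whose content is known
    -- to be small; the value read there is then multiplied by `0`.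
    obtain ⟨i', hi', j', hj', hix⟩ : ∃ i' < G.n, ∃ j' < G.n, pairIx.eval τ = (i' : ℤ) * G.n + j' ∧
        (i < G.n ∧ j < G.n → i' = i ∧ j' = j) := by
      by_cases h : i < G.n ∧ j < G.n
      · refine ⟨i, h.1, j, h.2, ?_, fun _ => ⟨rfl, rfl⟩⟩
        simp only [pairIx, Expr.eval_mul, Expr.eval_add, Expr.eval_var, h18, h19, e4, hin, h, and_self,
          if_true, mul_one]
      · refine ⟨0, G.n_pos, 0, G.n_pos, ?_, fun h' => absurd h' h⟩
        simp [pairIx, hin, h]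
    have six : pairIx.Small Y τ := by
      simp only [pairIx, Expr.small_mul, Expr.small_add, Expr.small_var, sin, h18, h19, e4,
        Nat.abs_cast, and_true]
      omega
    have e1 : τ 1 (pairIx.eval τ) = G.adj i' j' := by
      rw [hf 1 (by omega) (by omega), hix.1, hadj i' hi' j' hj']
    have e38 : τ 38 (pairIx.eval τ) = G.wt i' j' := by
      rw [hf 38 (by omega) (by omega), hix.1, hwt i' hi' j' hj']
    have ha := G.abs_adj_le i' j'
    have hw := hX i' j'
    constructor
    · simp only [initEntry, Expr.small_mul, Expr.small_add, Expr.small_sub, Expr.small_lit,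
        Expr.small_eqE, Expr.small_get, Expr.small_var, h18, h19, sin, six, e1, e38, e7,
        Nat.abs_cast, abs_one, true_and]
      norm_num
      omega
    · simp only [initEntry, Expr.eval_mul, Expr.eval_add, Expr.eval_sub, Expr.eval_lit,
        Expr.eval_eqE, Expr.eval_get, Expr.eval_var, h18, h19, hin, e1, e38, e7, Nat.cast_inj]
      by_cases hij : i = j
      · simp [hij]
      by_cases h : i < G.n ∧ j < G.n
      · obtain ⟨rfl, rfl⟩ := hix.2 h
        rcases G.edge_or i' j' with ⟨-, h'⟩ | ⟨-, h', -⟩ <;> simp [hij, h, h']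
      · have hno : G.adj i j = 0 := by
          rcases G.edge_or i j with ⟨⟨hi, hj, -⟩, -⟩ | ⟨-, h', -⟩
          · exact absurd ⟨hi, hj⟩ h
          · exact h'
        simp [hij, h, hno]
  · have e3 : q ^ 4 * q ^ 4 ≤ q ^ 11 := by
      rw [← pow_add]
      exact Nat.pow_le_pow_right hq0 (by omega)
    exact Nat.mul_le_mul e3 (by simp [initEntry, pairIx, inRange])
  · rintro τ ⟨hD, -⟩
    refine ⟨_, hD, fun i hi j hj => ⟨fun s' hs' z p => ?_, ?_⟩⟩
    · cases p with
      | nil => simp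
      | cons h p =>
        cases p with
        | nil => rw [if_neg h.ne, if_pos h.adj_eq, h.wt_eq, add_zero]
        | cons => omega
    · by_cases hij : i = j
      · subst hij
        simp only [if_true]
        exact Or.inr ⟨by simp, 0, by omega, .nil i⟩
      · rw [if_neg hij]
        rcases G.edge_or i j with ⟨h, h'⟩ | ⟨-, h', -⟩
        · rw [if_pos h']
          exact Or.inr ⟨hX i j, 1, le_rfl, .single h⟩
        · rw [if_neg (by omega)]
          exact Or.inl rfl

theorem Run.squareMatrix (D : Detector Q wt w) (H : Params Q β Y q X P t) (hR : Regs σ q X P)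
    {l s : ℕ} (hl : P = 2 ^ l) {A : ℕ → ℕ → ℤ} (hA : Mat σ 30 (q ^ 4) A)
    (hW : G.WalkMat (q ^ 4) X s A) (hn : G.n ≤ q ^ 4)
    (hX : ∀ s' ≤ 2 * s, ∀ i j z, G.EdgeWalk s' i j z → |z| ≤ X) :
    Run Q β Y (squareMatrix wt) σ ((l + 3) * ((50 * wt.cost + 7600) * (q ^ 11 + q ^ 9 * t)))
      (fun τ => ∃ A', Mat τ 30 (q ^ 4) A' ∧ G.WalkMat (q ^ 4) X (2 * s) A') := by
  have hq0 := H.q_pos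
  have hY := H.word
  have hX800 := H.X_le
  have hX0 := H.X_pos
  have hP := H.P_ge
  have hq4 : 0 < q ^ 4 := by positivity
  obtain ⟨bA, lA⟩ := hW.bdd
  have bA' : Bdd (q ^ 4) (8 * X) A := fun i hi j hj => (bA i hi j hj).trans (by omega)
  have e3 : q ^ 4 * q ^ 4 ≤ q ^ 11 := by
    rw [← pow_add]
    exact Nat.pow_le_pow_right hq0 (by omega)
  refine (Run.seq_frame (T := q ^ 11 * 100) (T' := (l + 2) * ((50 * wt.cost + 7600) *
    (q ^ 11 + q ^ 9 * t)) + q ^ 11 * 200) ((Run.fill_expr (r := 6) (a := 31)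
    (e := get 30 (var 17)) A (by omega) (by simp) hq4 H.cells_le (by omega) (by omega)
    (by omega) hR.r6 ?_).imp (Nat.mul_le_mul e3 (by simp)) (fun _ h => h.1)) ?_).imp ?_ (fun _ h => h)
  · intro i hi j hj τ hf h17 _ _ _
    have e30 : τ 30 (τ 17 0) = A i j := by rw [hf 30 (by omega) (by omega), h17, hA i hi j hj]
    simp only [Expr.small_get, Expr.small_var, Expr.eval_get, Expr.eval_var, e30]
    exact ⟨⟨H.small_ix hi hj h17, (bA i hi j hj).trans (by omega)⟩, trivial⟩
  · intro τ₁ m1 f1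
    refine Run.seq_frame (Run.product D H (hR.congr (f1 5 rfl) (f1 6 rfl) (f1 7 rfl) (f1 8 rfl)
      (f1 9 rfl)) (hA.congr (f1 30 rfl)) m1 bA' bA' (fun i hi k hk j hj => ?_) hl) ?_
    · have h1 := lA i hi k hk
      have h2 := lA k hk j hj
      omega
    · rintro τ₂ ⟨S, mS, hS⟩ f2
      refine (Run.fill_expr (r := 6) (a := 30) (e := cutEntry)
        (fun i j => if S i j ≤ X then S i j else 4 * X) (by omega) (by simp [cutEntry]) hq4
        H.cells_le (by omega) (by omega) (by omega) (by rw [f2 6 rfl, f1 6 rfl, hR.r6]) ?_).imp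
        (Nat.mul_le_mul e3 (by simp [cutEntry])) ?_
      · intro i hi j hj τ hf h17 _ _ _
        have e33 : τ 33 (τ 17 0) = S i j := by rw [hf 33 (by omega) (by omega), h17, mS i hi j hj]
        have e7 : τ 7 0 = X := by
          rw [hf 7 (by omega) (by omega), f2 7 rfl, f1 7 rfl, hR.r7]
        have e8 : τ 8 0 = (100 * X : ℕ) := by
          rw [hf 8 (by omega) (by omega), f2 8 rfl, f1 8 rfl, hR.r8]
        have h17' := H.small_ix hi hj h17
        have hb := (hS i hi j hj).1
        have hb' := abs_le.1 hb
        have hp : (posE (lit 1 + var 7 - get 33 (var 17)) (var 8)).eval τ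
            = if S i j ≤ X then 1 else 0 := by
          rw [Expr.eval_posE]
          · simp only [Expr.eval_sub, Expr.eval_add, Expr.eval_lit, Expr.eval_var, Expr.eval_get, e33,
              e7]
            by_cases h : S i j ≤ X
            · rw [if_pos h, if_pos (by omega)]
            · rw [if_neg h, if_neg (by omega)]
          · simp only [Expr.eval_sub, Expr.eval_add, Expr.eval_lit, Expr.eval_var, Expr.eval_get, e33,
              e7, e8]
            rw [abs_lt]
            omega
        constructor
        · simp only [cutEntry, Expr.small_mul, Expr.small_add, Expr.small_sub, Expr.small_lit,
            Expr.small_posE, Expr.small_get, Expr.small_var, Expr.eval_var, e33, e7, e8, h17',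
            Nat.abs_cast, abs_one]
          norm_num
          omega
        · simp only [cutEntry, Expr.eval_mul, Expr.eval_add, Expr.eval_sub, Expr.eval_lit, hp,
            Expr.eval_get, Expr.eval_var, e33, e7]
          split_ifs <;> ring
      · rintro τ ⟨hM, -⟩
        exact ⟨_, hM, hW.square hn hX0 hX hP fun i hi j hj => (hS i hi j hj).2⟩
  · have h1 : q ^ 11 ≤ q ^ 11 + q ^ 9 * t := by omega
    nlinarith

/-- The first power `2 ^ m ≥ q ^ 4` is at most `2 * q ^ 4`, so only walks with at most `2 * q ^ 4`
edges have to be bounded by `X`. -/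
theorem Run.walkWeights (D : Detector Q wt w) (H : Params Q β Y q X P t) (hR : Regs σ q X P)
    {l m : ℕ} (hl : P = 2 ^ l) (h4 : σ 4 0 = G.n)
    (hadj : Mat σ 1 G.n G.adj) (hwt : Mat σ 38 G.n G.wt) (hn : G.n ≤ q ^ 4)
    (hX : ∀ s ≤ 2 * q ^ 4, ∀ i j z, G.EdgeWalk s i j z → |z| ≤ X)
    (hm : q ^ 4 ≤ 2 ^ m) (hm' : ∀ k < m, 2 ^ k < q ^ 4) :
    Run Q β Y (walkWeights wt) σ ((m + 1) * ((l + 4) * ((50 * wt.cost + 7600) *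
      (q ^ 11 + q ^ 9 * t)))) (fun τ => ∃ A, Mat τ 30 (q ^ 4) A ∧ G.WalkMat (q ^ 4) X (2 ^ m) A) := by
  have hq0 := H.q_pos
  have hY := H.word
  have h4Y := H.pow_le (k := 4) (by omega)
  have hX1 : ∀ i j, |G.wt i j| ≤ X := fun i j => by
    rcases G.edge_or i j with ⟨h, -⟩ | ⟨-, -, h⟩
    · exact hX 1 (by have := Nat.one_le_pow 4 q hq0; omega) i j _ (.single h)
    · simp [h]
  have hmY : 2 ^ m ≤ 2 * q ^ 4 := by
    rcases m with _ | m
    · have := Nat.one_le_pow 4 q hq0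
      omega
    · have := hm' m (by omega)
      rw [pow_succ]
      omega
  refine (Run.seq_frame (T' := 3 + (m * ((l + 3) * ((50 * wt.cost + 7600) * (q ^ 11 + q ^ 9 * t)) +
    7 + 5 + 1) + (5 + 1))) (Run.initMatrix H hR h4 hadj hwt hn hX1) ?_).imp ?_ (fun _ h => h)
  · rintro τ₁ ⟨A₀, hA₀, hW₀⟩ f1
    refine Run.seq_frame (T := 3) (Run.set (Φ := fun τ => τ 11 0 = 1) (by omega) (by simp) (by simp)
      (by simp) (by simp; omega) (by simp)) fun τ₂ h11 f2 => ?_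
    refine (Run.while (n := m) (T := (l + 3) * ((50 * wt.cost + 7600) * (q ^ 11 + q ^ 9 * t)) + 7)
      (e := var 6 - var 11) (by omega) (by simp) (fun k τ => τ 11 0 = (2 ^ k : ℕ) ∧
        ∃ A, Mat τ 30 (q ^ 4) A ∧ G.WalkMat (q ^ 4) X (2 ^ k) A)
      ⟨by simpa using h11, A₀, hA₀.congr (f2 30 rfl), hW₀⟩ ?_ ?_).imp (by simp)
      (fun τ h => h.2)
    · rintro k hk τ hf ⟨h11, A, hA, hW⟩
      have hR' : Regs τ q X P := hR.congr ((hf 5 rfl).trans ((f2 5 rfl).trans (f1 5 rfl)))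
        ((hf 6 rfl).trans ((f2 6 rfl).trans (f1 6 rfl)))
        ((hf 7 rfl).trans ((f2 7 rfl).trans (f1 7 rfl)))
        ((hf 8 rfl).trans ((f2 8 rfl).trans (f1 8 rfl)))
        ((hf 9 rfl).trans ((f2 9 rfl).trans (f1 9 rfl)))
      have hk' := hm' k hk
      simp only [Expr.small_sub, Expr.small_var, Expr.eval_sub, Expr.eval_var, h11, hR'.r6,
        Nat.abs_cast]
      refine ⟨by omega, by omega, ?_⟩
      refine Run.seq_frame (Run.squareMatrix D H hR' hl hA hW hn
        (fun s' hs' => hX s' (by omega))) ?_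
      rintro τ' ⟨A', hA', hW'⟩ f3
      have e11 : τ' 11 0 = (2 ^ k : ℕ) := by rw [f3 11 rfl, h11]
      refine (Run.set (by omega) (by simp) (by simp) (by simp) ?_ ⟨?_, A', ?_, ?_⟩).imp (by simp)
        (fun _ h => h)
      · simp only [Expr.small_add, Expr.small_var, e11, Nat.abs_cast]
        omega
      · simp only [Expr.eval_add, Expr.eval_var, Expr.eval_lit, upd_cell, e11]
        push_cast
        ring
      · exact hA'.congr (upd_of_ne (by omega))
      · rwa [pow_succ 2 k, mul_comm (2 ^ k) 2]
    · rintro τ hf ⟨h11, -⟩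
      simp only [Expr.small_sub, Expr.small_var, Expr.eval_sub, Expr.eval_var, h11, hf 6 rfl, f2 6 rfl,
        f1 6 rfl, hR.r6, Nat.abs_cast]
      omega
  · have h1 : q ^ 11 ≤ q ^ 11 + q ^ 9 * t := by omega
    have h2 := Nat.one_le_pow 11 q hq0
    have h3 : 7600 * (q ^ 11 + q ^ 9 * t) ≤ (50 * wt.cost + 7600) * (q ^ 11 + q ^ 9 * t) :=
      Nat.mul_le_mul_right _ (by omega)
    generalize (50 * wt.cost + 7600) * (q ^ 11 + q ^ 9 * t) = K at *
    nlinarith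

end

/-! ## All pairs shortest paths -/

/-- Infinity if the entry of array `34` in the current cell is infinite, and `0` otherwise. -/
def reachEntry : Expr := lit 4 * var 7 * eqE (get 34 (var 17)) (lit 4 * var 7)

/-- `0` if the entry of array `34` in the current cell is finite and the vertex of its column is on a
negative cycle, and infinity otherwise. -/
def negativeEntry : Expr :=
  lit 4 * var 7 - lit 4 * var 7 * ((lit 1 - eqE (get 34 (var 17)) (lit 4 * var 7)) *
    posE (lit 0 - entry 34 (var 19) (var 19)) (var 8))

/-- The product that detects the walks which meet a negative cycle. -/
def negativeProduct (wt : Expr) : Program :=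
  .seq (.cells 6 (.set 34 (var 17) (get 30 (var 17)))) <|
  .seq (.cells 6 (.set 31 (var 17) reachEntry)) <|
  .seq (.cells 6 (.set 30 (var 17) negativeEntry)) (product wt)

/-- Whether the entry of array `33` for the current pair of vertices is small. -/
def smallEntry : Expr := posE (lit 1 + var 7 - entry 33 (var 18) (var 19)) (var 8)

/-- The tag of the distance of the current pair of vertices. -/
def distTag : Expr :=
  (lit 1 - smallEntry) * eqE (entry 34 (var 18) (var 19)) (lit 4 * var 7) - smallEntry

/-- Writing the distances to the output array. -/
def writeDistances : Program :=
  .cells 4 (.seq (.set 3 (lit 2 * var 17) distTag)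
    (.set 3 (lit 2 * var 17 + lit 1) (entry 34 (var 18) (var 19))))

/-- Solving `APSP` with a black box that detects violations of triangle inequalities. -/
def apsp (wt : Expr) : Program :=
  .seq sizes <| .seq cleanWeights <| .seq weightBound <| .seq entryBounds <|
  .seq (walkWeights wt) <| .seq (negativeProduct wt) <| .seq writeDistances (.set 0 (lit 0) (var 4))

section
variable {Q : GraphProblem} {β : BlackBox} {Y q X P t : ℕ} {σ : State} {G : WGraph}
variable {wt : Expr} {w : ℤ → (ℕ → ℕ → ℤ) → (ℕ → ℕ → ℤ) → (ℕ → ℕ → ℤ) → ℕ → ℕ → ℕ → ℕ → ℤ}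

/-- A Boolean product in min-plus disguise, with `0` for true and `4 * X` for false: the first
factor tells whether `v` is reachable from `i` and has a negative diagonal entry, the second whether
`j` is reachable from `v`. False entries of the product are at least `2 * X + 1`. -/
theorem Run.negativeProduct (D : Detector Q wt w) (H : Params Q β Y q X P t) (hR : Regs σ q X P)
    {l : ℕ} (hl : P = 2 ^ l) {A : ℕ → ℕ → ℤ} (hA : Mat σ 30 (q ^ 4) A)
    (bA : Bdd (q ^ 4) (4 * X) A) :
    Run Q β Y (negativeProduct wt) σ ((l + 3) * ((50 * wt.cost + 7600) * (q ^ 11 + q ^ 9 * t)))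
      (fun τ => Mat τ 34 (q ^ 4) A ∧ ∃ S, Mat τ 33 (q ^ 4) S ∧ Bdd (q ^ 4) (8 * X) S ∧
        ∀ i < q ^ 4, ∀ j < q ^ 4, S i j ≤ X ↔
          ∃ v < q ^ 4, A i v ≠ 4 * X ∧ A v v < 0 ∧ A v j ≠ 4 * X) := by
  classical
  have hq0 := H.q_pos
  have hY := H.word
  have hX800 := H.X_le
  have hX0 := H.X_pos
  have hP := H.P_ge
  have hq4 : 0 < q ^ 4 := by positivity
  have h4Y := H.pow_le (k := 4) (by omega)
  have e3 : q ^ 4 * q ^ 4 ≤ q ^ 11 := by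
    rw [← pow_add]
    exact Nat.pow_le_pow_right hq0 (by omega)
  refine (Run.seq_frame (T := q ^ 11 * 100) (T' := q ^ 11 * 200 + (q ^ 11 * 200 +
    (l + 2) * ((50 * wt.cost + 7600) * (q ^ 11 + q ^ 9 * t)))) ((Run.fill_expr (r := 6) (a := 34)
    (e := get 30 (var 17)) A (by omega) (by simp) hq4 H.cells_le (by omega) (by omega)
    (by omega) hR.r6 ?_).imp (Nat.mul_le_mul e3 (by simp)) (fun _ h => h.1)) ?_).imp ?_ (fun _ h => h)
  · intro i hi j hj τ hf h17 _ _ _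
    have e30 : τ 30 (τ 17 0) = A i j := by rw [hf 30 (by omega) (by omega), h17, hA i hi j hj]
    simp only [Expr.small_get, Expr.small_var, Expr.eval_get, Expr.eval_var, e30]
    exact ⟨⟨H.small_ix hi hj h17, (bA i hi j hj).trans (by omega)⟩, trivial⟩
  · intro τ₁ m1 f1
    refine Run.seq_frame ((Run.fill_expr (r := 6) (a := 31) (e := reachEntry)
      (fun i j => if A i j = 4 * X then 4 * X else 0) (by omega) (by simp [reachEntry]) hq4
      H.cells_le (by omega) (by omega) (by omega) (by rw [f1 6 rfl, hR.r6]) ?_).imp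
      (Nat.mul_le_mul e3 (by simp [reachEntry])) (fun _ h => h.1)) ?_
    · intro i hi j hj τ hf h17 _ _ _
      have e34 : τ 34 (τ 17 0) = A i j := by rw [hf 34 (by omega) (by omega), h17, m1 i hi j hj]
      have e7 : τ 7 0 = X := by rw [hf 7 (by omega) (by omega), f1 7 rfl, hR.r7]
      have := bA i hi j hj
      have h17' := H.small_ix hi hj h17
      constructor
      · simp only [reachEntry, Expr.small_mul, Expr.small_lit, Expr.small_eqE, Expr.small_get,
          Expr.small_var, Expr.eval_var, e34, e7, h17', Nat.abs_cast]
        norm_num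
        omega
      · simp only [reachEntry, Expr.eval_mul, Expr.eval_lit, Expr.eval_eqE, Expr.eval_get,
          Expr.eval_var, e34, e7]
        split_ifs <;> ring
    · intro τ₂ m2 f2
      refine Run.seq_frame ((Run.fill_expr (r := 6) (a := 30) (e := negativeEntry)
        (fun i j => if A i j ≠ 4 * X ∧ A j j < 0 then 0 else 4 * X) (by omega)
        (by simp [negativeEntry, entry]) hq4
        H.cells_le (by omega) (by omega) (by omega) (by rw [f2 6 rfl, f1 6 rfl, hR.r6]) ?_).imp
        (Nat.mul_le_mul e3 (by simp [negativeEntry, entry])) (fun _ h => h.1)) ?_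
      · intro i hi j hj τ hf h17 _ h19 _
        have m1' := m1.congr ((hf 34 (by omega) (by omega)).trans (f2 34 rfl))
        have e34 : τ 34 (τ 17 0) = A i j := by rw [h17, m1' i hi j hj]
        have e6 : τ 6 0 = (q ^ 4 : ℕ) := by
          rw [hf 6 (by omega) (by omega), f2 6 rfl, f1 6 rfl, hR.r6]
        have e7 : τ 7 0 = X := by rw [hf 7 (by omega) (by omega), f2 7 rfl, f1 7 rfl, hR.r7]
        have e8 : τ 8 0 = (100 * X : ℕ) := by
          rw [hf 8 (by omega) (by omega), f2 8 rfl, f1 8 rfl, hR.r8]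
        have eD : (entry 34 (var 19) (var 19)).eval τ = A j j :=
          Params.eval_entry e6 h19 h19 hj hj m1'
        have s19 : (var 19).Small Y τ := by
          rw [Expr.small_var, h19, Nat.abs_cast]
          omega
        have sD : (entry 34 (var 19) (var 19)).Small Y τ :=
          H.small_entry e6 h19 h19 hj hj m1' s19 s19 (N := 4 * X) (by omega) bA
        have b1 := bA i hi j hj
        have b2 := abs_le.1 (bA j hj j hj)
        have h17' := H.small_ix hi hj h17
        have hp : (posE (lit 0 - entry 34 (var 19) (var 19)) (var 8)).eval τ
            = if A j j < 0 then 1 else 0 := by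
          rw [Expr.eval_posE]
          · simp only [Expr.eval_sub, Expr.eval_lit, eD]
            by_cases h : A j j < 0
            · rw [if_pos h, if_pos (by omega)]
            · rw [if_neg h, if_neg (by omega)]
          · simp only [Expr.eval_sub, Expr.eval_lit, eD, Expr.eval_var, e8]
            rw [abs_lt]
            omega
        constructor
        · simp only [negativeEntry, Expr.small_mul, Expr.small_sub, Expr.small_lit, Expr.small_eqE,
            Expr.small_get, Expr.small_posE, Expr.small_var, Expr.eval_var, e34, e7, e8, h17', sD,
            Nat.abs_cast]
          norm_num
          omega
        · simp only [negativeEntry, Expr.eval_mul, Expr.eval_sub, Expr.eval_lit, Expr.eval_eqE,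
            Expr.eval_get, Expr.eval_var, e34, e7, hp]
          by_cases h1 : A i j = 4 * X <;> by_cases h2 : A j j < 0 <;> simp [h1, h2]
      · intro τ₃ m3 f3
        refine ((Run.product D H (hR.congr ((f3 5 rfl).trans ((f2 5 rfl).trans (f1 5 rfl)))
          ((f3 6 rfl).trans ((f2 6 rfl).trans (f1 6 rfl)))
          ((f3 7 rfl).trans ((f2 7 rfl).trans (f1 7 rfl)))
          ((f3 8 rfl).trans ((f2 8 rfl).trans (f1 8 rfl)))
          ((f3 9 rfl).trans ((f2 9 rfl).trans (f1 9 rfl)))) m3 (m2.congr (f3 31 rfl))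
          ?_ ?_ ?_ hl).frame).imp le_rfl ?_
        · intro i _ j _
          beta_reduce
          split_ifs
          · simp
          · rw [abs_of_nonneg (by positivity)]
            omega
        · intro i _ j _
          beta_reduce
          split_ifs
          · rw [abs_of_nonneg (by positivity)]
            omega
          · simp
        · intro i _ k _ j _
          split_ifs <;> omega
        · rintro τ ⟨⟨S, mS, hS⟩, f4⟩
          refine ⟨m1.congr ((f4 34 rfl).trans ((f3 34 rfl).trans (f2 34 rfl))), S, mS,
            fun i hi j hj => (hS i hi j hj).1, fun i hi j hj => ?_⟩
          obtain ⟨-, h1, h2⟩ := hS i hi j hj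
          constructor
          · intro hle
            obtain ⟨v, hv, hsum⟩ := h2.resolve_right (by omega)
            refine ⟨v, hv, ?_⟩
            split_ifs at hsum with h3 h4
            · omega
            · exact ⟨h3.1, h3.2, h4⟩
            · omega
            · omega
          · rintro ⟨v, hv, h3, h4, h5⟩
            have := h1 v hv
            rw [if_pos ⟨h3, h4⟩, if_neg h5] at this
            omega
  · have h1 : q ^ 11 ≤ q ^ 11 + q ^ 9 * t := by omega
    nlinarith

theorem Run.writeDistances (H : Params Q β Y q X P t) (hR : Regs σ q X P) (h4 : σ 4 0 = G.n)
    {A S : ℕ → ℕ → ℤ} (hA : Mat σ 34 (q ^ 4) A) (hS : Mat σ 33 (q ^ 4) S)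
    (bA : Bdd (q ^ 4) (4 * X) A) (bS : Bdd (q ^ 4) (8 * X) S) (hn : G.n ≤ q ^ 4)
    (hdist : ∀ i j : Fin G.n, (S i j ≤ X → G.dist i j = ⊥) ∧ (¬ S i j ≤ X →
      (A i j = 4 * X → G.dist i j = ⊤) ∧
      (A i j ≠ 4 * X → G.dist i j = ((A i j : WithTop ℤ) : ExtInt)))) :
    Run Q β Y writeDistances σ (q ^ 11 * 300) (fun τ => APSP.IsAnswer G (output τ)) := by
  classical
  have hq0 := H.q_pos
  have hY := H.word
  have hX800 := H.X_le
  have hX0 := H.X_pos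
  have h4Y := H.pow_le (k := 4) (by omega)
  have h8Y := H.pow_le (k := 8) (by omega)
  have hnn : G.n * G.n ≤ q ^ 8 := by
    rw [show q ^ 8 = q ^ 4 * q ^ 4 by ring]
    exact Nat.mul_le_mul hn hn
  have e3 : G.n * G.n ≤ q ^ 11 := hnn.trans (Nat.pow_le_pow_right hq0 (by omega))
  refine (Run.cells (r := 4) (T := 225) (by omega) G.n_pos (by omega) (fun c τ => ∀ i j : Fin G.n,
    i.val * G.n + j < c →
      Represents (τ 3 (2 * G.cell i j)) (τ 3 (2 * G.cell i j + 1)) (G.dist i j)) rfl (by omega) rfl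
    h4 ?_ ?_ ?_).imp (Nat.mul_le_mul_right _ e3) ?_
  · intro c τ τ' h hI
    rwa [h 3 (by omega)]
  · intro i j h
    omega
  · intro i hi j hj τ hf h17 h18 h19 hI
    have e6 : τ 6 0 = (q ^ 4 : ℕ) := by rw [hf 6 rfl (by omega), hR.r6]
    have e7 : τ 7 0 = X := by rw [hf 7 rfl (by omega), hR.r7]
    have e8 : τ 8 0 = (100 * X : ℕ) := by rw [hf 8 rfl (by omega), hR.r8]
    have hA' := hA.congr (hf 34 rfl (by omega))
    have hS' := hS.congr (hf 33 rfl (by omega))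
    have hi' := hi.trans_le hn
    have hj' := hj.trans_le hn
    have s18 : (var 18).Small Y τ := by
      rw [Expr.small_var, h18, Nat.abs_cast]
      omega
    have s19 : (var 19).Small Y τ := by
      rw [Expr.small_var, h19, Nat.abs_cast]
      omega
    have eA : (entry 34 (var 18) (var 19)).eval τ = A i j :=
      Params.eval_entry e6 h18 h19 hi' hj' hA'
    have eS : (entry 33 (var 18) (var 19)).eval τ = S i j :=
      Params.eval_entry e6 h18 h19 hi' hj' hS'
    have sA : (entry 34 (var 18) (var 19)).Small Y τ :=
      H.small_entry e6 h18 h19 hi' hj' hA' s18 s19 (N := 4 * X) (by omega) bA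
    have sS : (entry 33 (var 18) (var 19)).Small Y τ :=
      H.small_entry e6 h18 h19 hi' hj' hS' s18 s19 (N := 8 * X) (by omega) bS
    have bS' := abs_le.1 (bS i hi' j hj')
    have hp : smallEntry.eval τ = if S i j ≤ X then 1 else 0 := by
      rw [smallEntry, Expr.eval_posE]
      · simp only [Expr.eval_sub, Expr.eval_add, Expr.eval_lit, Expr.eval_var, eS, e7]
        by_cases h : S i j ≤ X
        · rw [if_pos h, if_pos (by omega)]
        · rw [if_neg h, if_neg (by omega)]
      · simp only [Expr.eval_sub, Expr.eval_add, Expr.eval_lit, Expr.eval_var, eS, e7, e8]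
        rw [abs_lt]
        omega
    have sp : smallEntry.Small Y τ := by
      simp only [smallEntry, Expr.small_posE, Expr.small_add, Expr.small_sub, Expr.small_lit,
        Expr.small_var, sS, e7, e8, Nat.abs_cast, abs_one, and_true]
      omega
    have h17' : |τ 17 0| ≤ (Y : ℤ) := by
      have := cell_lt hi hj
      rw [h17, abs_of_nonneg (by positivity)]
      exact_mod_cast (by omega : i * G.n + j ≤ Y)
    set d : ℤ := (i : ℤ) * G.n + j with hd
    have hrun : WP Y (.seq (.set 3 (lit 2 * var 17) distTag) (.set 3 (lit 2 * var 17 + lit 1)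
        (entry 34 (var 18) (var 19)))) (fun τ' => ∀ i' j' : Fin G.n, i'.val * G.n + j' < i * G.n + j + 1 →
        Represents (τ' 3 (2 * G.cell i' j')) (τ' 3 (2 * G.cell i' j' + 1)) (G.dist i' j')) τ := by
      have htag : ∀ z : ℤ, (entry 34 (var 18) (var 19)).eval (τ.upd 3 z (distTag.eval τ)) = A i j ∧
          ((entry 34 (var 18) (var 19)).Small Y (τ.upd 3 z (distTag.eval τ)) ↔
            (entry 34 (var 18) (var 19)).Small Y τ) := fun z => by
        constructor
        · rw [← eA]
          simp [entry, upd_of_ne]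
        · simp [entry, upd_of_ne]
      simp only [WP, Expr.small_mul, Expr.small_add, Expr.small_lit, Expr.small_var,
        Expr.eval_mul, Expr.eval_add, Expr.eval_lit, Expr.eval_var, htag, sA,
        upd_of_ne (show 17 ≠ 3 by omega), h17']
      rw [h17]
      refine ⟨by norm_num; omega, ?_, by norm_num; omega, trivial, ?_⟩
      · simp only [distTag, Expr.small_mul, Expr.small_sub, Expr.small_lit, Expr.small_eqE,
          Expr.small_var, sp, sA, e7, Nat.abs_cast]
        norm_num
        omega
      · intro i' j' hlt
        have hc : ∀ i' j' : Fin G.n, G.cell i' j' = ((i'.val * G.n + j'.val : ℕ) : ℤ) := fun i' j' => by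
          rw [WGraph.cell]
          push_cast
          rfl
        have hd' : d = ((i * G.n + j : ℕ) : ℤ) := by push_cast; rfl
        rcases Nat.lt_succ_iff_lt_or_eq.1 hlt with h | h
        · have := hI i' j' h
          -- The output positions of an earlier cell lie below `2 * d`, so the two writes do not
          -- disturb them.
          have hne : G.cell i' j' < d := by rw [hc, hd']; exact_mod_cast h
          rw [upd_same, if_neg (by omega), upd_same, if_neg (by omega), upd_same, if_neg (by omega),
            upd_same, if_neg (by omega)]
          exact this
        · obtain ⟨hi1, hj1⟩ := (cell_inj j'.2 hj).1 h
          have he : G.cell i' j' = d := by rw [hc, hd', h]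
          rw [he, upd_same, if_neg (by omega), upd_cell, upd_cell]
          obtain ⟨h1, h2⟩ := hdist i' j'
          rw [hi1, hj1] at h1 h2
          have htv : distTag.eval τ = if S i j ≤ X then -1 else if A i j = 4 * X then 1 else 0 := by
            simp only [distTag, Expr.eval_sub, Expr.eval_mul, Expr.eval_lit, Expr.eval_eqE, hp, eA,
              Expr.eval_var, e7]
            split_ifs <;> norm_num
          rw [htv]
          by_cases hs : S i j ≤ X
          · exact Or.inr (Or.inr ⟨if_pos hs, h1 hs⟩)
          · rw [if_neg hs]
            by_cases ha : A i j = 4 * X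
            · exact Or.inr (Or.inl ⟨if_pos ha, (h2 hs).1 ha⟩)
            · exact Or.inl ⟨if_neg ha, (h2 hs).2 ha⟩
    exact (Run.of_wp (by omega) (by simp [Program.Short, distTag, smallEntry, entry]) hrun).imp
      (by simp [Program.cost, distTag, smallEntry, entry]) (fun _ h => h)
  · intro τ h i j
    exact h i j (cell_lt i.2 j.2)

/-- One logarithm counts the squarings, the other the rounds of the binary search. The last
instruction restores the number of vertices, which the calls have overwritten by `5 * q`. -/
theorem Run.apsp {M : ℕ} (D : Detector Q wt w) (hH : Holds σ G) (hM : G.BoundedBy M)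
    (hq0 : 0 < q) (hq : G.n ≤ q ^ 4) (hmin : ∀ k < q, k ^ 4 < G.n) (hqY : 25 * q ^ 9 ≤ Y)
    (hX : X = 2 * q ^ 4 * (1 + G.n * G.n * (M * M))) (hXY : 800 * X ≤ Y)
    (hβ : ∀ G, Q.Valid G → Q.IsAnswer G (β.answer G))
    (ht : ∀ G : WGraph, G.n = 5 * q → G.BoundedBy (800 * X) → Q.Valid G → β.time G ≤ t) :
    Run Q β Y (apsp wt) σ ((Nat.log 2 Y + 4) ^ 2 * ((50 * wt.cost + 10000) *
      (q ^ 11 + q ^ 9 * t))) (fun τ => APSP.IsAnswer G (output τ) ∧ τ 0 0 = G.n) := by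
  have hpow : ∀ {k}, k ≤ 9 → 25 * q ^ k ≤ Y := fun hk =>
    (Nat.mul_le_mul_left _ (Nat.pow_le_pow_right hq0 hk)).trans hqY
  have h0Y := hpow (k := 0) (by omega)
  have h4Y := hpow (k := 4) (by omega)
  have h8Y := hpow (k := 8) (by omega)
  have hnn : G.n * G.n ≤ q ^ 8 := by
    rw [show q ^ 8 = q ^ 4 * q ^ 4 by ring]
    exact Nat.mul_le_mul hq hq
  have e3 : G.n * G.n ≤ q ^ 11 := hnn.trans (Nat.pow_le_pow_right hq0 (by omega))
  have hq4 : 0 < q ^ 4 := by positivity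
  have hMX : 2 * (1 + G.n * G.n * (M * M)) ≤ X := by rw [hX]; nlinarith
  have hn1 := Nat.mul_pos G.n_pos G.n_pos
  have hMM : M ≤ G.n * G.n * (M * M) :=
    (Nat.le_mul_self M).trans (Nat.le_mul_of_pos_left _ hn1)
  set K := (50 * wt.cost + 7600) * (q ^ 11 + q ^ 9 * t) with hK
  set L := Nat.log 2 Y with hL
  refine (Run.seq_frame (T' := G.n * G.n * 100 + (G.n * G.n * 100 + (L * 30 + 50 +
    ((L + 1) * ((L + 4) * K) + ((L + 3) * K + (q ^ 11 * 300 + 4)))))) (Run.sizes (by omega) hH.1 hq0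
    hq hmin (by omega)) ?_).imp ?_ (fun _ h => h)
  · rintro τ₁ ⟨h4, h5, h6⟩ f1
    have hH' : Holds τ₁ G := by
      rwa [Holds, f1 0 rfl, f1 1 rfl, f1 2 rfl]
    refine Run.seq_frame (Run.cleanWeights (by omega) hH' hM (by omega) (by omega) h4) ?_
    intro τ₂ m2 f2
    refine Run.seq_frame (Run.weightBound (by omega) G.n_pos (by omega) (by omega) m2
      (fun i _ j _ => abs_wt_le hM i j) (by rw [f2 4 rfl, h4])) ?_
    rintro τ₃ ⟨W, h24, hW1, hW2, hW3⟩ f3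
    -- The program does not know `M`. It works with `X'`, obtained from the computed bound `W`,
    -- while `X` only serves to bound `X'` in terms of `M`.
    obtain ⟨X', hX'⟩ : ∃ X', X' = 2 * q ^ 4 * W := ⟨_, rfl⟩
    have hXX : X' ≤ X := by
      rw [hX, hX']
      exact Nat.mul_le_mul_left _ hW2
    have hX0' : 0 < X' := by
      rw [hX']
      positivity
    have hl := Nat.le_pow_clog (b := 2) (by omega) (2 * X' + 2)
    have hl' : ∀ k < Nat.clog 2 (2 * X' + 2), 2 ^ k < 2 * X' + 2 := fun k hk =>
      (Nat.lt_clog_iff_pow_lt (by omega)).1 hk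
    generalize Nat.clog 2 (2 * X' + 2) = l at hl hl'
    have hlX : 2 ^ l ≤ 8 * X' := by
      rcases l with _ | l
      · omega
      · have := hl' l (by omega)
        rw [pow_succ]
        omega
    have hlL : l ≤ L := Nat.le_log_of_pow_le (by omega) (by omega)
    refine Run.seq_frame ((Run.entryBounds (l := l) (by omega) hX' hX0' (by omega) hl hl'
      (by rw [f3 6 rfl, f2 6 rfl, h6]) h24).imp (by omega) (fun _ h => h)) ?_
    rintro τ₄ ⟨h7, h8, h9⟩ f4
    have H : Params Q β Y q X' (2 ^ l) t := ⟨by omega, hq0, hX0', hqY, by omega, hl, hlX, hβ,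
      fun G' h1 h2 h3 => ht G' h1 (fun i j z hz => (h2 i j z hz).trans (by exact_mod_cast
        (by omega : 800 * X' ≤ 800 * X))) h3⟩
    have hR4 : Regs τ₄ q X' (2 ^ l) := ⟨by rw [f4 5 rfl, f3 5 rfl, f2 5 rfl, h5],
      by rw [f4 6 rfl, f3 6 rfl, f2 6 rfl, h6], h7, h8, h9⟩
    have hwX : ∀ s ≤ 2 * q ^ 4, ∀ i j z, G.EdgeWalk s i j z → |z| ≤ X' := by
      intro s hs i j z p
      refine (p.abs_le (W := W) fun i j x h => ?_).trans ?_
      · rw [← h.wt_eq]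
        exact hW3 i h.1 j h.2.1
      · rw [hX']
        exact_mod_cast Nat.mul_le_mul_right W hs
    have hm := Nat.le_pow_clog (b := 2) (by omega) (q ^ 4)
    have hm' : ∀ k < Nat.clog 2 (q ^ 4), 2 ^ k < q ^ 4 := fun k hk =>
      (Nat.lt_clog_iff_pow_lt (by omega)).1 hk
    generalize Nat.clog 2 (q ^ 4) = m at hm hm'
    have hmq : 2 ^ m ≤ 2 * q ^ 4 := by
      rcases m with _ | m
      · omega
      · have := hm' m (by omega)
        rw [pow_succ]
        omega
    have hmL : m ≤ L := Nat.le_log_of_pow_le (by omega) (by omega)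
    refine Run.seq_frame ((Run.walkWeights D H hR4 rfl (by rw [f4 4 rfl, f3 4 rfl, f2 4 rfl, h4])
      (hH'.edge.1.congr ((f4 1 rfl).trans ((f3 1 rfl).trans (f2 1 rfl))))
      (m2.congr ((f4 38 rfl).trans (f3 38 rfl))) hq hwX hm hm').imp (Nat.mul_le_mul (by omega)
      (Nat.mul_le_mul_right _ (by omega))) (fun _ h => h)) ?_
    rintro τ₅ ⟨A, hA, hWA⟩ f5
    have hR5 : Regs τ₅ q X' (2 ^ l) := hR4.congr (f5 5 rfl) (f5 6 rfl) (f5 7 rfl) (f5 8 rfl)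
      (f5 9 rfl)
    refine Run.seq_frame ((Run.negativeProduct D H hR5 rfl hA hWA.bdd.1).imp
      (Nat.mul_le_mul_right _ (by omega)) (fun _ h => h)) ?_
    rintro τ₆ ⟨mA, S, mS, bS, hS⟩ f6
    have h4' : τ₆ 4 0 = G.n := by
      rw [f6 4 rfl, f5 4 rfl, f4 4 rfl, f3 4 rfl, f2 4 rfl, h4]
    refine Run.seq_frame (Run.writeDistances H (hR5.congr (f6 5 rfl) (f6 6 rfl) (f6 7 rfl) (f6 8 rfl)
      (f6 9 rfl)) h4' mA mS hWA.bdd.1 bS hq fun i j => ?_) ?_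
    · rw [hS i (i.2.trans_le hq) j (j.2.trans_le hq)]
      exact hWA.dist_eq hq hX0' (fun s hs => hwX s (by omega)) (by omega) i j
    · intro τ₇ hans f7
      have e4 : τ₇ 4 0 = G.n := by rw [f7 4 rfl, h4']
      refine (Run.set (by omega) (by simp) (by simp) (by simp) ?_ ⟨?_, ?_⟩).imp (by simp)
        (fun _ h => h)
      · rw [Expr.small_var, e4, Nat.abs_cast]
        have : G.n ≤ Y := by omega
        exact_mod_cast this
      · rwa [output, upd_of_ne (by omega)]
      · simp [e4]
  · have h1 : q ^ 11 ≤ q ^ 11 + q ^ 9 * t := by omega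
    have h2 := Nat.one_le_pow 11 q hq0
    have h3 : q ≤ q ^ 11 := Nat.le_self_pow (by omega) q
    have h4 : (50 * wt.cost + 10000) * (q ^ 11 + q ^ 9 * t) = K + 2400 * (q ^ 11 + q ^ 9 * t) := by
      rw [hK]
      ring
    have h5 : 7600 * (q ^ 11 + q ^ 9 * t) ≤ K := Nat.mul_le_mul_right _ (by omega)
    rw [h4]
    nlinarith

end

/-! ## Running times -/

theorem one_le_log (n M : ℕ) : 1 ≤ Nat.log 2 (n + M + 2) :=
  Nat.le_log_of_pow_le (by omega) (by omega)

theorem subcubicBound_mono {ε ε' : ℝ} {c c' k k' n : ℕ} (M : ℕ) (hn : 1 ≤ n) (hε : ε' ≤ ε)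
    (hc : c ≤ c') (hk : k ≤ k') : subcubicBound ε c k n M ≤ subcubicBound ε' c' k' n M := by
  have h1 : (1 : ℝ) ≤ n := by exact_mod_cast hn
  have h2 : (1 : ℝ) ≤ (Nat.log 2 (n + M + 2) : ℕ) := by exact_mod_cast one_le_log n M
  rw [subcubicBound, subcubicBound]
  have h3 : (c : ℝ) ≤ c' := by exact_mod_cast hc
  have h4 := Real.rpow_le_rpow_of_exponent_le h1 (show 3 - ε ≤ 3 - ε' by linarith)
  have h5 := pow_le_pow_right₀ h2 hk
  gcongr

theorem log_pow_le (b z : ℕ) : Nat.log 2 (z ^ b) ≤ b * (Nat.log 2 z + 1) := by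
  refine Nat.lt_succ_iff.1 (Nat.log_lt_of_lt_pow' (by omega) ?_)
  have h1 : z < 2 ^ (Nat.log 2 z + 1) := Nat.lt_pow_succ_log_self (by omega) z
  calc z ^ b ≤ (2 ^ (Nat.log 2 z + 1)) ^ b := Nat.pow_le_pow_left h1.le b
    _ = 2 ^ (b * (Nat.log 2 z + 1)) := by rw [← pow_mul, mul_comm]
    _ < 2 ^ (b * (Nat.log 2 z + 1)).succ := Nat.pow_lt_pow_right (by omega) (by omega)

/-- For the least `q` the padding is bounded: `(q - 1) ^ 4 < n`, and `q ≤ 2 * (q - 1)` if `q ≥ 2`.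
-/
theorem exists_fourth_root {n : ℕ} (hn : 0 < n) : ∃ q, 0 < q ∧ n ≤ q ^ 4 ∧ (∀ k < q, k ^ 4 < n) ∧
    q ≤ n ∧ q ^ 4 ≤ 16 * n := by
  have hex : ∃ q, n ≤ q ^ 4 := ⟨n, Nat.le_self_pow (by omega) n⟩
  refine ⟨Nat.find hex, ?_, Nat.find_spec hex, fun k hk => not_le.1 (Nat.find_min hex hk),
    Nat.find_min' hex (Nat.le_self_pow (by omega) n), ?_⟩
  · by_contra h
    have := Nat.find_spec hex
    rw [show Nat.find hex = 0 by omega] at this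
    omega
  · have hmin : ∀ k < Nat.find hex, k ^ 4 < n := fun k hk => not_le.1 (Nat.find_min hex hk)
    generalize Nat.find hex = q at hmin
    rcases q with _ | _ | q
    · simp
    · omega
    · have := hmin (q + 1) (by omega)
      have h2 : (q + 2) ^ 4 ≤ (2 * (q + 1)) ^ 4 := Nat.pow_le_pow_left (by omega) 4
      rw [mul_pow] at h2
      exact h2.trans (Nat.mul_le_mul_left 16 this.le)

/-- The exponent that is saved by the reduction from matrices of dimension `q ^ 4` to graphs with
`5 * q` vertices. -/
theorem blocks_time_le {q n c k L t : ℕ} {ε : ℝ} (hε0 : 0 < ε) (hε : ε ≤ 1) (hq0 : 0 < q)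
    (hqn : q ^ 4 ≤ 16 * n) (hL : 1 ≤ L) (ht : (t : ℝ) ≤ c * (5 * q : ℝ) ^ (3 - ε) * (L : ℝ) ^ k) :
    ((q ^ 11 + q ^ 9 * t : ℕ) : ℝ) ≤ 4096 * (1 + 125 * c) * (n : ℝ) ^ (3 - ε / 4) * (L : ℝ) ^ k := by
  have hx : (1 : ℝ) ≤ q := by exact_mod_cast hq0
  have hx0 : (0 : ℝ) < q := by linarith
  have hL' : (1 : ℝ) ≤ (L : ℝ) ^ k := one_le_pow₀ (by exact_mod_cast hL)
  have h1 : (5 * q : ℝ) ^ (3 - ε) ≤ 125 * (q : ℝ) ^ (3 - ε) := by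
    rw [Real.mul_rpow (by norm_num) hx0.le]
    have : (5 : ℝ) ^ (3 - ε) ≤ 5 ^ (3 : ℝ) :=
      Real.rpow_le_rpow_of_exponent_le (by norm_num) (by linarith)
    have h5 : (5 : ℝ) ^ (3 : ℝ) = 125 := by norm_num
    rw [h5] at this
    gcongr
  have h2 : (q : ℝ) ^ 9 * (q : ℝ) ^ (3 - ε) = (q : ℝ) ^ (12 - ε) := by
    rw [← Real.rpow_natCast, ← Real.rpow_add hx0]
    norm_num
    congr 1
    ring
  -- This is where `ε ≤ 1` is needed: the overhead `q ^ 11` limits the saving.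
  have h3 : (q : ℝ) ^ 11 ≤ (q : ℝ) ^ (12 - ε) := by
    rw [← Real.rpow_natCast]
    exact Real.rpow_le_rpow_of_exponent_le hx (by norm_num; linarith)
  -- The constant is `16 ^ 3`, from `q ^ 4 ≤ 16 * n`.
  have h4 : (q : ℝ) ^ (12 - ε) ≤ 4096 * (n : ℝ) ^ (3 - ε / 4) := by
    have e : (q : ℝ) ^ (12 - ε) = ((q : ℝ) ^ 4) ^ (3 - ε / 4) := by
      rw [← Real.rpow_natCast, ← Real.rpow_mul hx0.le]
      norm_num
      congr 1
      ring
    have hqn' : (q : ℝ) ^ 4 ≤ 16 * n := by exact_mod_cast hqn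
    have h16 : (16 : ℝ) ^ (3 - ε / 4) ≤ 16 ^ (3 : ℝ) :=
      Real.rpow_le_rpow_of_exponent_le (by norm_num) (by linarith)
    have e16 : (16 : ℝ) ^ (3 : ℝ) = 4096 := by norm_num
    rw [e16] at h16
    rw [e]
    calc ((q : ℝ) ^ 4) ^ (3 - ε / 4) ≤ (16 * (n : ℝ)) ^ (3 - ε / 4) :=
          Real.rpow_le_rpow (by positivity) hqn' (by linarith)
      _ = 16 ^ (3 - ε / 4) * (n : ℝ) ^ (3 - ε / 4) := Real.mul_rpow (by norm_num) (by positivity)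
      _ ≤ _ := by gcongr
  push_cast
  calc (q : ℝ) ^ 11 + (q : ℝ) ^ 9 * t
      ≤ (q : ℝ) ^ (12 - ε) * (L : ℝ) ^ k +
        (q : ℝ) ^ 9 * (c * (125 * (q : ℝ) ^ (3 - ε)) * (L : ℝ) ^ k) := by
        refine add_le_add (h3.trans (le_mul_of_one_le_right (by positivity) hL')) ?_
        refine mul_le_mul_of_nonneg_left (ht.trans ?_) (by positivity)
        gcongr
    _ = (1 + 125 * c) * (q : ℝ) ^ (12 - ε) * (L : ℝ) ^ k := by
        rw [← h2]
        ring
    _ ≤ (1 + 125 * c) * (4096 * (n : ℝ) ^ (3 - ε / 4)) * (L : ℝ) ^ k := by gcongr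
    _ = _ := by ring

/-- The program `p` solves `APSP` in subcubic time and does not forget the number of vertices. -/
def SolvesDistances (p : Program) (Q : GraphProblem) (β : BlackBox) : Prop :=
  ∃ δ : ℝ, 0 < δ ∧ ∃ c k r : ℕ, ∀ (G : WGraph) (M : ℕ), G.BoundedBy M →
    ∀ σ : State, Holds σ G →
      ∃ (σ' : State) (t : ℕ), Exec Q β ((G.n + M + 2) ^ r) p σ σ' t ∧
        (APSP.IsAnswer G (output σ') ∧ σ' 0 0 = G.n) ∧ (t : ℝ) ≤ subcubicBound δ c k G.n M

theorem SolvesDistances.solvesSubcubic {p : Program} {Q : GraphProblem} {β : BlackBox}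
    (h : SolvesDistances p Q β) : p.SolvesSubcubic APSP Q β := by
  obtain ⟨δ, hδ, c, k, r, h⟩ := h
  refine ⟨δ, hδ, c, k, r, fun G M _ hM σ hσ => ?_⟩
  obtain ⟨σ', t, h1, h2, h3⟩ := h G M hM σ hσ
  exact ⟨σ', t, h1, h2.1, h3⟩

/-- With the saving cut to at most `3`, the bound without its constant is at least `1`, so `c + 1`
absorbs the step for the call itself. The word bound is irrelevant, as no expression is evaluated.
-/
theorem call_solvesDistances {β : BlackBox} (h : β.SolvesSubcubic APSP) :
    SolvesDistances .call APSP β := by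
  obtain ⟨hβ, ε, hε, c, k, h⟩ := h
  refine ⟨min ε 3, lt_min hε (by norm_num), c + 1, k, 0, fun G M hM σ hσ =>
    ⟨_, _, .call hσ trivial, ⟨?_, ?_⟩, ?_⟩⟩
  · simpa [output] using hβ G trivial
  · simpa using hσ.1
  · have h1 := (h G M trivial hM).trans
      (subcubicBound_mono M G.n_pos (min_le_left ε 3) le_rfl le_rfl)
    have hn : (1 : ℝ) ≤ G.n := by exact_mod_cast G.n_pos
    have h2 : (1 : ℝ) ≤ (G.n : ℝ) ^ (3 - min ε 3) :=
      Real.one_le_rpow hn (by linarith [min_le_right ε 3])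
    have h3 : (1 : ℝ) ≤ ((Nat.log 2 (G.n + M + 2) : ℕ) : ℝ) ^ k :=
      one_le_pow₀ (by exact_mod_cast one_le_log G.n M)
    rw [subcubicBound] at h1 ⊢
    push_cast
    nlinarith

/-- The black box sees graphs with `5 * q` vertices, where `q` is about the fourth root of `n`, so
its saving `ε` becomes `ε / 4`. With `z = n + M + 2`, all parameters and gadget weights are at most
`z ^ 20`. -/
theorem apsp_solvesDistances {Q : GraphProblem} {β : BlackBox} {wt : Expr}
    {w : ℤ → (ℕ → ℕ → ℤ) → (ℕ → ℕ → ℤ) → (ℕ → ℕ → ℤ) → ℕ → ℕ → ℕ → ℕ → ℤ}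
    (D : Detector Q wt w) (h : β.SolvesSubcubic Q) : SolvesDistances (apsp wt) Q β := by
  obtain ⟨hβ, ε', hε', c, k, hε⟩ := h
  obtain ⟨ε, hε0, hε1, hle⟩ : ∃ ε : ℝ, 0 < ε ∧ ε ≤ 1 ∧ ε ≤ ε' :=
    ⟨min ε' 1, lt_min hε' one_pos, min_le_right _ _, min_le_left _ _⟩
  -- The logarithm `L` of `z ^ 20` is at most `40 * l` with `l` that of `z`, and `L + 4 ≤ 44 * l`;
  -- these give `40 ^ k`, `44 ^ 2` and the exponent `k + 2`.
  refine ⟨ε / 4, by positivity, 44 ^ 2 * ((50 * wt.cost + 10000) * (4096 * (1 + 125 * c) * 40 ^ k)),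
    k + 2, 20 * 256, fun G M hM σ hσ => ?_⟩
  obtain ⟨q, hq0, hq, hmin, hqn, hq16⟩ := exists_fourth_root G.n_pos
  obtain ⟨z, hz⟩ : ∃ z, z = G.n + M + 2 := ⟨_, rfl⟩
  have hn0 := G.n_pos
  obtain ⟨X, hX⟩ : ∃ X, X = 2 * q ^ 4 * (1 + G.n * G.n * (M * M)) := ⟨_, rfl⟩
  have hz3 : 3 ≤ z := by omega
  have hXz : X ≤ 32 * z ^ 5 := by
    have h1 : 1 + G.n * G.n * (M * M) ≤ z ^ 4 := by
      have h2 : G.n * M + 1 ≤ z * z := by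
        rw [hz]
        nlinarith
      calc 1 + G.n * G.n * (M * M) ≤ (G.n * M + 1) * (G.n * M + 1) := by nlinarith
        _ ≤ (z * z) * (z * z) := Nat.mul_le_mul h2 h2
        _ = z ^ 4 := by ring
    calc X ≤ (2 * (16 * z)) * z ^ 4 := by
          rw [hX]
          exact Nat.mul_le_mul (by omega) h1
      _ = 32 * z ^ 5 := by ring
  have hY1 : 25 * q ^ 9 ≤ z ^ 20 := by
    have h1 : q ^ 9 ≤ z ^ 9 := Nat.pow_le_pow_left (by omega) 9
    have h2 : 3 ^ 11 ≤ z ^ 11 := Nat.pow_le_pow_left hz3 11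
    calc 25 * q ^ 9 ≤ z ^ 11 * z ^ 9 := Nat.mul_le_mul (by omega) h1
      _ = z ^ 20 := by ring
  have hY2 : 5 * q + 800 * X + 2 ≤ z ^ 20 := by
    have h2 : 3 ^ 15 ≤ z ^ 15 := Nat.pow_le_pow_left hz3 15
    have h3 : z ≤ z ^ 5 := Nat.le_self_pow (by omega) z
    calc 5 * q + 800 * X + 2 ≤ 3 ^ 15 * z ^ 5 := by omega
      _ ≤ z ^ 15 * z ^ 5 := Nat.mul_le_mul_right _ h2
      _ = z ^ 20 := by ring
  obtain ⟨L, hL⟩ : ∃ L, L = Nat.log 2 (z ^ 20) := ⟨_, rfl⟩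
  obtain ⟨l, hl⟩ : ∃ l, l = Nat.log 2 z := ⟨_, rfl⟩
  have hl1 : 1 ≤ l := by
    rw [hl, hz]
    exact one_le_log G.n M
  have hLl : L ≤ 40 * l := by
    have := log_pow_le 20 z
    omega
  have hL1 : 1 ≤ L := by
    rw [hL]
    exact hl1.trans (hl ▸ Nat.log_mono_right (Nat.le_self_pow (by omega) z))
  have ht : ∀ G' : WGraph, G'.n = 5 * q → G'.BoundedBy (800 * X) → Q.Valid G' →
      β.time G' ≤ ⌊(c : ℝ) * (5 * q : ℝ) ^ (3 - ε) * (L : ℝ) ^ k⌋₊ := by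
    intro G' h1 h2 h3
    refine Nat.le_floor (((hε G' _ h3 h2).trans (subcubicBound_mono _ G'.n_pos hle le_rfl
      le_rfl)).trans ?_)
    rw [subcubicBound, h1]
    have : (Nat.log 2 (5 * q + 800 * X + 2) : ℝ) ≤ L := by
      rw [hL]
      exact_mod_cast Nat.log_mono_right hY2
    push_cast
    gcongr
  obtain ⟨σ', s, h1, h2, h3⟩ := Run.apsp D hσ hM hq0 hq hmin hY1 hX (by omega) hβ ht
  refine ⟨σ', s, ?_, h3, ?_⟩
  · rwa [← hz, pow_mul]
  · have hb := blocks_time_le hε0 hε1 hq0 hq16 hL1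
      (Nat.floor_le (show 0 ≤ (c : ℝ) * (5 * q : ℝ) ^ (3 - ε) * (L : ℝ) ^ k by positivity))
    rw [← hL] at h2
    have h2' : (s : ℝ) ≤ (L + 4 : ℝ) ^ 2 * ((50 * wt.cost + 10000) * ((q ^ 11 + q ^ 9 *
        ⌊(c : ℝ) * (5 * q : ℝ) ^ (3 - ε) * (L : ℝ) ^ k⌋₊ : ℕ) : ℝ)) := by exact_mod_cast h2
    have hLl' : (L : ℝ) ≤ 40 * l := by exact_mod_cast hLl
    have hl1' : (1 : ℝ) ≤ l := by exact_mod_cast hl1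
    rw [subcubicBound, ← hz, ← hl]
    push_cast
    calc (s : ℝ) ≤ _ := h2'
      _ ≤ (44 * l : ℝ) ^ 2 * ((50 * wt.cost + 10000) *
          (4096 * (1 + 125 * c) * (G.n : ℝ) ^ (3 - ε / 4) * (40 * l : ℝ) ^ k)) := by
        gcongr
        · linarith
        · refine hb.trans ?_
          gcongr
      _ = _ := by
        rw [mul_pow, mul_pow]
        ring

/-! ## Comparing vertices by their distances -/

/-- Combining the numbers `a 0, …, a (m - 1)` with the operation `op`. -/
def accumulate (op : ℤ → ℤ → ℤ) (a : ℕ → ℤ) : ℕ → ℤ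
  | 0 => 0
  | m + 1 => op (accumulate op a m) (a m)

/-- The extended integer stored as `z`, where `F` stands for infinity. -/
def decode (F z : ℤ) : ExtInt := if z = F then ⊤ else ((z : WithTop ℤ) : ExtInt)

theorem decode_le_decode {F x y : ℤ} (hx : x ≤ F) (hy : y ≤ F) :
    decode F x ≤ decode F y ↔ x ≤ y := by
  rw [decode, decode]
  split_ifs with h1 h2 h2
  · simp [h1, h2]
  · rw [top_le_iff]
    refine ⟨fun h => ?_, fun h => absurd (le_antisymm hy (h1 ▸ h)) h2⟩
    exact absurd (WithBot.coe_injective h) WithTop.coe_ne_top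
  · simp [h2, hx]
  · exact coe_le_coe_int

/-- A problem that asks for a vertex at which a quantity is not minimal, where the quantity is
computed from the distances by the operation `op`. -/
structure Aggregate (P : GraphProblem) (E : (G : WGraph) → Fin G.n → ExtInt) (op : ℤ → ℤ → ℤ)
    (e : Expr) : Prop where
  valid : ∀ G, P.Valid G → G.NonNeg
  answer : ∀ G out, P.IsAnswer G out ↔ (out 0 = -1 ∧ ∀ v u, E G v ≤ E G u) ∨
    ∃ v : Fin G.n, out 0 = (v.val : ℤ) ∧ ¬ ∀ u, E G v ≤ E G u
  leaves_le : e.leaves ≤ 256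
  small : ∀ {Y : ℕ} {τ : State}, 1 ≤ Y → |τ 4 0| ≤ (Y : ℤ) → |τ 11 0| ≤ (Y : ℤ) →
    |τ 13 0| ≤ (Y : ℤ) → |τ 24 0| ≤ (Y : ℤ) → e.Small Y τ
  eval : ∀ {τ : State}, |τ 13 0 - τ 11 0| ≤ τ 4 0 * τ 24 0 → e.eval τ = op (τ 11 0) (τ 13 0)
  nonneg : ∀ x y, 0 ≤ x → 0 ≤ y → 0 ≤ op x y
  le_add : ∀ x y, 0 ≤ x → 0 ≤ y → op x y ≤ x + y
  value : ∀ (G : WGraph) (v : Fin G.n) (a : ℕ → ℤ) (F : ℤ), 0 < F → (∀ u, 0 ≤ a u ∧ a u ≤ F) →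
    a v = 0 → (∀ u : Fin G.n, G.dist v u = decode F (a u)) →
    ((∀ u < G.n, a u ≠ F) → ∑ u ∈ Finset.range G.n, a u < F) →
    E G v = decode F (min (accumulate op a G.n) F)

theorem accumulate_mem {op : ℤ → ℤ → ℤ} (h0 : ∀ x y, 0 ≤ x → 0 ≤ y → 0 ≤ op x y)
    (h1 : ∀ x y, 0 ≤ x → 0 ≤ y → op x y ≤ x + y) {a : ℕ → ℤ} {F : ℤ}
    (ha : ∀ u, 0 ≤ a u ∧ a u ≤ F) (m : ℕ) :
    0 ≤ accumulate op a m ∧ accumulate op a m ≤ m * F := by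
  induction m with
  | zero => simp [accumulate]
  | succ m ih =>
    rw [accumulate]
    refine ⟨h0 _ _ ih.1 (ha m).1, (h1 _ _ ih.1 (ha m).1).trans ?_⟩
    push_cast
    linarith [(ha m).2]

theorem accumulate_add (a : ℕ → ℤ) (m : ℕ) :
    accumulate (· + ·) a m = ∑ u ∈ Finset.range m, a u := by
  induction m with
  | zero => rfl
  | succ m ih => rw [accumulate, ih, Finset.sum_range_succ]

theorem accumulate_max {a : ℕ → ℤ} (m : ℕ) :
    (∀ u < m, a u ≤ accumulate max a m) ∧
      (accumulate max a m = 0 ∨ ∃ u < m, accumulate max a m = a u) := by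
  induction m with
  | zero => simp [accumulate]
  | succ m ih =>
    rw [accumulate]
    refine ⟨fun u hu => ?_, ?_⟩
    · rcases Nat.lt_succ_iff_lt_or_eq.1 hu with h | rfl
      · exact (ih.1 u h).trans (le_max_left _ _)
      · exact le_max_right _ _
    · rcases max_choice (accumulate max a m) (a m) with h | h
      · rw [h]
        exact ih.2.imp id fun ⟨u, hu, h'⟩ => ⟨u, by omega, h'⟩
      · exact Or.inr ⟨m, by omega, h⟩

/-- An infinite distance pushes the sum up to `F`, where it is cut off; a sum of finite distances
stays below `F` by the last hypothesis of `value`. -/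
theorem aggregate_coMedian :
    Aggregate CoMedian WGraph.distSum (· + ·) (var 11 + var 13) where
  valid _ h := h
  answer _ _ := Iff.rfl
  leaves_le := by simp
  small _ _ h1 h2 _ := by simp [h1, h2]
  eval _ := by simp
  nonneg _ _ h1 h2 := add_nonneg h1 h2
  le_add _ _ _ _ := le_rfl
  value G v a F hF ha hv hd hsum := by
    rw [accumulate_add]
    have hd0 : ∀ u, 0 ≤ G.dist v u := fun u => by
      rw [hd, decode]
      split_ifs
      · exact le_top
      · exact coe_le_coe_int.2 (ha u).1
    by_cases h : ∃ u : Fin G.n, a u = F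
    · obtain ⟨u, hu⟩ := h
      have h1 : F ≤ ∑ u ∈ Finset.range G.n, a u := by
        rw [← hu]
        exact Finset.single_le_sum (fun u _ => (ha u).1) (Finset.mem_range.2 u.2)
      rw [min_eq_right h1, decode, if_pos rfl, distSum, ← top_le_iff]
      have huv : u ≠ v := by
        rintro rfl
        omega
      refine le_trans (le_of_eq ?_) (Finset.single_le_sum (fun u _ => hd0 u)
        (Finset.mem_erase.2 ⟨huv, Finset.mem_univ u⟩))
      rw [hd, decode, if_pos hu]
    · push Not at h
      have h1 := hsum fun u hu => h ⟨u, hu⟩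
      rw [min_eq_left h1.le, decode, if_neg h1.ne, distSum_eq (e := fun u => a u)]
      · congr 2
        rw [← Fin.sum_univ_eq_sum_range, ← Finset.add_sum_erase _ _ (Finset.mem_univ v), hv, zero_add]
      · intro u _
        rw [hd, decode, if_neg (h u)]

/-- The expression computes the maximum as `x + [y > x] * (y - x)`. The initial value `0` is
harmless because it is the distance from `v` to itself. -/
theorem aggregate_coRadius : Aggregate CoRadius WGraph.ecc max
    (var 11 + posE (var 13 - var 11) (lit 1 + var 4 * var 24) * (var 13 - var 11)) where
  valid _ h := h
  answer _ _ := Iff.rfl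
  leaves_le := by simp
  small h0 h1 h2 h3 h4 := by
    have : (1 : ℤ) ≤ _ := Int.ofNat_le.2 h0
    simp_all
  eval {τ} h := by
    rw [Expr.eval_add, Expr.eval_mul, Expr.eval_posE]
    · split_ifs with h1 <;> simp only [Expr.eval_sub, Expr.eval_var] at h1 ⊢
      · rw [max_eq_right (by omega)]
        ring
      · rw [max_eq_left (by omega)]
        ring
    · simp only [Expr.eval_sub, Expr.eval_add, Expr.eval_mul, Expr.eval_var, Expr.eval_lit]
      omega
  nonneg _ _ h1 _ := h1.trans (le_max_left _ _)
  le_add _ _ h1 h2 := max_le (by omega) (by omega)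
  value G v a F hF ha hv hd hsum := by
    obtain ⟨h1, h2⟩ := accumulate_max (a := a) G.n
    obtain ⟨u, hu⟩ : ∃ u : Fin G.n, accumulate max a G.n = a u := by
      rcases h2 with h2 | ⟨u, hu, h2⟩
      · exact ⟨v, by rw [h2, hv]⟩
      · exact ⟨⟨u, hu⟩, h2⟩
    rw [hu, min_eq_left (ha u).2, ← hd u]
    refine le_antisymm (iSup_le fun u' => ?_) (le_iSup (fun u => G.dist v u) u)
    rw [hd, hd, decode_le_decode (ha u').2 (ha u).2, ← hu]
    exact h1 u' u'.2

/-- The value for the distances `a v`, cut off at `F`. -/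
def score (op : ℤ → ℤ → ℤ) (a : ℕ → ℕ → ℤ) (n : ℕ) (F : ℤ) (v : ℕ) : ℤ :=
  min (accumulate op (a v) n) F

/-- The result of the comparison of the first `k` vertices with vertex `0`. -/
def Compared (s : ℕ → ℤ) (k : ℕ) (r : ℤ) : Prop :=
  (r = -1 ∧ ∀ v < k, s v = s 0) ∨ (∃ v < k, r = (v : ℤ) ∧ s 0 < s v) ∨ (r = 0 ∧ ∃ v < k, s v < s 0)

/-- Comparisons with vertex `0` suffice: either all values equal its value, or one of the two
vertices of an unequal pair is not optimal. -/
theorem Aggregate.isAnswer {P : GraphProblem} {E : (G : WGraph) → Fin G.n → ExtInt}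
    {op : ℤ → ℤ → ℤ} {e : Expr} (D : Aggregate P E op e) {G : WGraph} {s : ℕ → ℤ} {F : ℤ}
    (hs : ∀ v, s v ≤ F) (hE : ∀ v : Fin G.n, E G v = decode F (s v)) {out : ℤ → ℤ}
    (h : Compared s G.n (out 0)) : P.IsAnswer G out := by
  rw [D.answer]
  have hlt : ∀ v u : Fin G.n, E G v ≤ E G u ↔ s v ≤ s u := fun v u => by
    rw [hE, hE, decode_le_decode (hs v) (hs u)]
  simp only [hlt]
  rcases h with ⟨h1, h2⟩ | ⟨v, hv, h1, h2⟩ | ⟨h1, v, hv, h2⟩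
  · exact Or.inl ⟨h1, fun v u => by rw [h2 v v.2, h2 u u.2]⟩
  · exact Or.inr ⟨⟨v, hv⟩, h1, fun h => absurd (h ⟨0, G.n_pos⟩) (not_le.2 h2)⟩
  · exact Or.inr ⟨⟨0, G.n_pos⟩, by simpa using h1, fun h => absurd (h ⟨v, hv⟩) (not_le.2 h2)⟩

/-- Distances, or `0` for pairs with infinite distance. -/
def finiteEntries : Program :=
  .cells 4 (.ite (get 3 (lit 2 * var 17)) (.set 38 (var 17) (lit 0))
    (.set 38 (var 17) (get 3 (lit 2 * var 17 + lit 1))))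

/-- Combining the distances from the vertex in variable `16`. -/
def combine (e : Expr) : Program :=
  .seq (.set 11 (lit 0) (lit 0)) <| .for 18 (var 4) <|
    .seq (.set 13 (lit 0) (get 34 (var 16 * var 4 + var 18))) (.set 11 (lit 0) e)

/-- Comparing the vertex in variable `16` with vertex `0`. -/
def compareVertex : Program :=
  .seq (.ite (var 11 - var 24) (.set 11 (lit 0) (var 24)) .skip) <|
  .seq (.ite (var 16) .skip (.set 12 (lit 0) (var 11))) <|
  .seq (.ite (var 11 - var 12) (.set 10 (lit 0) (var 16)) .skip) <|
  .ite (var 12 - var 11) (.set 10 (lit 0) (lit 0)) .skip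

/-- Finding a vertex with a larger value than some other vertex, from the matrix of distances. -/
def findLarger (e : Expr) : Program :=
  .seq (.set 4 (lit 0) (var 0)) <| .seq finiteEntries <| .seq weightBound <|
  .seq (.set 24 (lit 0) (lit 1 + var 4 * var 24)) <|
  .seq (.cells 4 (.set 34 (var 17) (get 38 (var 17) + var 24 * get 3 (lit 2 * var 17)))) <|
  .seq (.set 10 (lit 0) (lit (-1))) <|
  .seq (.for 16 (var 4) (.seq (combine e) compareVertex)) (.set 3 (lit 0) (var 10))

/-! ### Scanning the rows of the distance matrix -/

section
variable {Q : GraphProblem} {β : BlackBox} {Y : ℕ} {σ : State} {P : GraphProblem}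
  {E : (G : WGraph) → Fin G.n → ExtInt} {op : ℤ → ℤ → ℤ} {e : Expr}

theorem Run.combine (D : Aggregate P E op e) {n F v : ℕ} {a : ℕ → ℕ → ℤ} (hY : 2 ≤ Y)
    (hnY : n * n ≤ Y) (hFY : n * F ≤ Y) (h4 : σ 4 0 = n) (h24 : σ 24 0 = F)
    (h16 : σ 16 0 = v) (hv : v < n)
    (ha : Mat σ 34 n a) (haF : ∀ i j, 0 ≤ a i j ∧ a i j ≤ F) :
    Run Q β Y (combine e) σ (n * (e.cost + 50) + 30) (fun τ => τ 11 0 = accumulate op (a v) n) := by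
  have hn : n ≤ n * n := Nat.le_mul_self n
  have hFn : F ≤ n * F := Nat.le_mul_of_pos_left _ (by omega)
  rw [Subcubic.combine]
  refine (Run.seq_frame (T := 3) (Run.set (Φ := fun τ => τ 11 0 = 0) hY (by simp) (by simp) (by simp)
    (by simp) (by simp)) fun τ₁ h11 f1 => ?_).imp (T := 3 + (n * (e.cost + 13 + 2 + 20) + (2 + 20)))
    (by nlinarith) (fun _ h => h)
  refine Run.for (T := e.cost + 13) hY (by simp) (by omega)
    (fun k τ => τ 11 0 = accumulate op (a v) k) rfl
    (fun k τ z h => by rwa [upd_of_ne (by omega)]) h11 ?_ ?_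
  · intro τ hf
    rw [Expr.small_var, Expr.eval_var, hf 4 rfl (by omega), f1 4 rfl, h4, Nat.abs_cast]
    exact ⟨by omega, rfl⟩
  · intro k hk τ hf h18 hI
    have e4 : τ 4 0 = n := by rw [hf 4 rfl (by omega), f1 4 rfl, h4]
    have e24 : τ 24 0 = F := by rw [hf 24 rfl (by omega), f1 24 rfl, h24]
    have e16 : τ 16 0 = v := by rw [hf 16 rfl (by omega), f1 16 rfl, h16]
    have e34 : τ 34 ((v : ℤ) * n + k) = a v k := by
      rw [hf 34 rfl (by omega), f1 34 rfl, ha v hv k hk]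
    obtain ⟨b1, b2⟩ := haF v k
    obtain ⟨b3, b4⟩ := accumulate_mem D.nonneg D.le_add (haF v) k
    have b5 : (k : ℤ) * F ≤ n * F := by exact_mod_cast Nat.mul_le_mul_right F hk.le
    have b6 : (n : ℤ) * F ≤ Y := by exact_mod_cast hFY
    have b7 : (F : ℤ) ≤ n * F := by exact_mod_cast hFn
    refine (Run.seq_frame (T := 11) (T' := e.cost + 2) (Run.set (a := 13) (i := lit 0)
      (e := get 34 (var 16 * var 4 + var 18)) (Φ := fun τ => τ 13 0 = a v k) hY (by simp)
      (by simp) (by simp) ?_ ?_) fun τ' h13 f' => ?_).imp (by omega) (fun _ h => h)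
    · simp only [Expr.small_get, Expr.small_add, Expr.small_mul, Expr.small_var, Expr.eval_add,
        Expr.eval_mul, Expr.eval_var, e4, e16, h18, e34, Nat.abs_cast, abs_of_nonneg b1]
      omega
    · simp [e4, e16, h18, e34]
    · have g4 : τ' 4 0 = n := by rw [f' 4 rfl, e4]
      have g24 : τ' 24 0 = F := by rw [f' 24 rfl, e24]
      have g11 : τ' 11 0 = accumulate op (a v) k := by rw [f' 11 rfl, hI]
      refine (Run.set hY (by simp) D.leaves_le (by simp) (D.small (by omega) ?_ ?_ ?_ ?_) ?_).imp
        (by simp; omega) (fun _ h => h)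
      · rw [g4, Nat.abs_cast]
        omega
      · rw [g11, abs_of_nonneg b3]
        omega
      · rw [h13, abs_of_nonneg b1]
        omega
      · rw [g24, Nat.abs_cast]
        omega
      · rw [Expr.eval_lit, upd_cell, D.eval, g11, h13, accumulate]
        rw [g11, h13, g4, g24, abs_le]
        omega

theorem Run.compareVertex {n F v : ℕ} {a : ℕ → ℕ → ℤ} (hY : 2 ≤ Y) (hnY : n ≤ Y) (hFY : F ≤ Y)
    (hv : v < n) (h16 : σ 16 0 = v) (h24 : σ 24 0 = F) (h11 : σ 11 0 = accumulate op (a v) n)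
    (hb : 0 ≤ σ 11 0 ∧ σ 11 0 ≤ Y) (hs0 : |score op a n F 0| ≤ Y)
    (h12 : 0 < v → σ 12 0 = score op a n F 0) (h10 : Compared (score op a n F) v (σ 10 0)) :
    Run Q β Y compareVertex σ 50 (fun τ => τ 12 0 = score op a n F 0 ∧
      Compared (score op a n F) (v + 1) (τ 10 0)) := by
  set s := score op a n F with hs
  have hsv : s v = min (σ 11 0) F := by rw [hs, score, h11]
  have hsb : 0 ≤ s v ∧ s v ≤ F := by
    rw [hsv]
    omega
  rw [Subcubic.compareVertex]
  refine (Run.seq_frame (T := 11) (T' := 39) (Run.of_wp (Φ := fun τ => τ 11 0 = s v) hY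
    (by simp [Program.Short]) ?_) ?_).imp le_rfl (fun _ h => h)
  · simp only [WP, Expr.small_sub, Expr.small_var, Expr.small_lit, Expr.eval_sub, Expr.eval_var, h24,
      Expr.eval_lit, Nat.abs_cast, abs_zero, upd_cell]
    refine ⟨⟨by rw [abs_of_nonneg hb.1]; omega, by omega⟩, fun h => ⟨by omega, by omega, ?_⟩, fun h => ?_⟩
    · omega
    · omega
  · intro τ₁ g11 f1
    have g16 : τ₁ 16 0 = v := by rw [f1 16 rfl, h16]
    -- The value of vertex `0` is stored in register `12` when the loop visits vertex `0`, and is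
    -- left alone afterwards.
    refine (Run.seq_frame (T := 8) (T' := 31) (Run.of_wp (p := .ite (var 16) .skip
      (.set 12 (lit 0) (var 11))) (Φ := fun τ => τ 12 0 = s 0) hY (by simp [Program.Short]) ?_) ?_).imp le_rfl (fun _ h => h)
    · simp only [WP, Expr.small_var, Expr.small_lit, Expr.eval_var, g16, g11,
        Expr.eval_lit, Nat.abs_cast, abs_zero, upd_cell]
      refine ⟨by omega, fun h => ?_, fun h => ⟨by omega, ?_, ?_⟩⟩
      · rw [f1 12 rfl, h12 (by omega)]
      · rw [abs_of_nonneg hsb.1]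
        omega
      · rw [show v = 0 by omega]
    · intro τ₂ g12 f2
      have k16 : τ₂ 16 0 = v := by rw [f2 16 rfl, g16]
      have k11 : τ₂ 11 0 = s v := by rw [f2 11 rfl, g11]
      have k10 : τ₂ 10 0 = σ 10 0 := by rw [f2 10 rfl, f1 10 rfl]
      refine (Run.of_wp hY (by simp [Program.Short]) ?_).imp (by simp [Program.cost]) (fun _ h => h)
      have hsv' : |s v| ≤ (Y : ℤ) := by
        rw [abs_of_nonneg hsb.1]
        omega
      simp only [WP, Expr.small_sub, Expr.small_var, Expr.small_lit, Expr.eval_sub, Expr.eval_var,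
        Expr.eval_lit, Nat.abs_cast, abs_zero, upd_cell, k16, k11, g12, k10, hs0, hsv',
        upd_of_ne (show 11 ≠ 10 by omega), upd_of_ne (show 12 ≠ 10 by omega)]
      refine ⟨⟨trivial, trivial⟩, fun h => ⟨by omega, by omega, ⟨trivial, trivial⟩, fun h' => by omega,
        fun _ => ⟨trivial, Or.inr (Or.inl ⟨v, by omega, rfl, by omega⟩)⟩⟩, fun h =>
        ⟨⟨trivial, trivial⟩, fun h' => ⟨by omega, by omega, trivial, Or.inr (Or.inr ⟨rfl, v, by omega,
          by omega⟩)⟩, fun h' => ⟨trivial, ?_⟩⟩⟩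
      rcases h10 with ⟨h1, h2⟩ | ⟨u, hu, h1, h2⟩ | ⟨h1, u, hu, h2⟩
      · refine Or.inl ⟨h1, fun u hu => ?_⟩
        rcases Nat.lt_succ_iff_lt_or_eq.1 hu with h3 | rfl
        · exact h2 u h3
        · omega
      · exact Or.inr (Or.inl ⟨u, by omega, h1, h2⟩)
      · exact Or.inr (Or.inr ⟨h1, u, by omega, h2⟩)

end

/-- A reachable vertex is reached by a walk with at most `G.n` edges, and non-negativity bounds the
distance from below. -/
theorem WGraph.NonNeg.dist_eq_top_or {G : WGraph} {M : ℕ} (h : G.NonNeg) (hM : G.BoundedBy M)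
    (i j : Fin G.n) : G.dist i j = ⊤ ∨ ∃ z : ℤ, 0 ≤ z ∧ z ≤ G.n * M ∧
      G.dist i j = ((z : WithTop ℤ) : ExtInt) := by
  by_cases hw : ∃ z, G.HasWalk i j z
  · right
    obtain ⟨z, hz⟩ := hw
    obtain ⟨s, p⟩ := hz.edgeWalk
    obtain ⟨s', hs', z', p'⟩ := p.exists_short
    obtain ⟨_, hw'⟩ := p'.hasWalk i.2
    have h1 := le_of_abs_le (p'.abs_le (W := M) fun i j x ⟨_, _, hx⟩ => hM _ _ x hx)
    have h2 : (s' : ℤ) * M ≤ G.n * M := by exact_mod_cast Nat.mul_le_mul_right M hs'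
    obtain ⟨e, he⟩ := exists_int_of_le (h.dist_nonneg i j) (dist_le hw')
    have h3 := h.dist_nonneg i j
    have h4 := dist_le hw'
    rw [he, coe_le_coe_int] at h3 h4
    exact ⟨e, h3, by omega, he⟩
  · exact Or.inl (top_le_iff.1 (le_dist fun z p => absurd ⟨z, p⟩ hw))

/-! ### Solving the vertex problems from the distances -/

section
variable {Q : GraphProblem} {β : BlackBox} {Y : ℕ} {σ : State} {P : GraphProblem}
  {E : (G : WGraph) → Fin G.n → ExtInt} {op : ℤ → ℤ → ℤ} {e : Expr} {p : Program}

theorem Run.findLarger {G : WGraph} {M : ℕ} (D : Aggregate P E op e) (hG : P.Valid G)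
    (hM : G.BoundedBy M) (h0 : σ 0 0 = G.n) (hd : APSP.IsAnswer G (output σ)) (hY2 : 2 ≤ Y)
    (hY : G.n * (1 + G.n * (1 + G.n * G.n * (G.n * M * (G.n * M)))) ≤ Y) :
    Run Q β Y (findLarger e) σ (G.n * G.n * (e.cost + 1000))
      (fun τ => P.IsAnswer G (output τ)) := by
  classical
  have hN := D.valid G hG
  obtain ⟨n, hn⟩ : ∃ n, n = G.n := ⟨_, rfl⟩
  have hn0 : 0 < n := hn ▸ G.n_pos
  rw [← hn] at hY h0 ⊢
  have hnn : 1 ≤ n * n := Nat.mul_pos hn0 hn0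
  have hb1 : n * M ≤ n * n * (n * M * (n * M)) :=
    (Nat.le_mul_self _).trans (Nat.le_mul_of_pos_left _ hnn)
  have hY1 : 1 + n * (1 + n * n * (n * M * (n * M))) ≤ Y :=
    (Nat.le_mul_of_pos_left _ hn0).trans hY
  have hY0 : 1 + n * n * (n * M * (n * M)) ≤ n * (1 + n * n * (n * M * (n * M))) :=
    Nat.le_mul_of_pos_left _ hn0
  have hnY : n * n ≤ Y := by
    refine le_trans ?_ hY
    refine Nat.mul_le_mul_left _ ?_
    nlinarith [Nat.zero_le (n * (n * n * (n * M * (n * M))))]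
  have hnY' : n ≤ Y := (Nat.le_mul_self n).trans hnY
  set tag : ℕ → ℕ → ℤ := fun i j => σ 3 (2 * ((i : ℤ) * n + j)) with htag
  set val : ℕ → ℕ → ℤ := fun i j => σ 3 (2 * ((i : ℤ) * n + j) + 1) with hval
  -- The tag `-1` cannot occur, because weights are non-negative.
  have hcases : ∀ i j : Fin G.n, tag i j = 0 ∧ 0 ≤ val i j ∧ val i j ≤ (n * M : ℕ) ∧
      G.dist i j = ((val i j : WithTop ℤ) : ExtInt) ∨ tag i j = 1 ∧ G.dist i j = ⊤ := by
    intro i j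
    have h1 : Represents (tag i j) (val i j) (G.dist i j) := by
      simp only [htag, hval, hn]
      exact hd i j
    rcases h1 with ⟨h1, h2⟩ | ⟨h1, h2⟩ | ⟨h1, h2⟩
    · rcases hN.dist_eq_top_or hM i j with h3 | ⟨z, h3, h4, h5⟩
      · rw [h3] at h2
        exact absurd (WithBot.coe_injective h2).symm WithTop.coe_ne_top
      · have h6 : z = val i j := WithTop.coe_injective (WithBot.coe_injective (h5.symm.trans h2))
        rw [← hn] at h4
        refine Or.inl ⟨h1, ?_, ?_, h2⟩
        · omega
        · push_cast
          omega
    · exact Or.inr ⟨h1, h2⟩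
    · have h3 := hN.dist_nonneg i j
      rw [h2] at h3
      exact absurd h3 (not_le.2 (WithBot.bot_lt_coe _))
  set f : ℕ → ℕ → ℤ := fun i j => if tag i j = 0 then val i j else 0 with hf
  have htv : ∀ i < n, ∀ j < n, (tag i j = 0 ∧ f i j = val i j ∨ tag i j = 1 ∧ f i j = 0) ∧
      0 ≤ f i j ∧ f i j ≤ (n * M : ℕ) := by
    intro i hi j hj
    rw [hf]
    beta_reduce
    rcases hcases ⟨i, hn ▸ hi⟩ ⟨j, hn ▸ hj⟩ with ⟨h1, h2, h3, -⟩ | ⟨h1, -⟩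
    · rw [if_pos h1]
      exact ⟨Or.inl ⟨h1, rfl⟩, h2, h3⟩
    · rw [if_neg (by rw [h1]; omega)]
      exact ⟨Or.inr ⟨h1, rfl⟩, le_rfl, by positivity⟩
  have hix : ∀ {τ : State} {i j : ℕ}, i < n → j < n → τ 17 0 = (i : ℤ) * n + j →
      |τ 17 0| ≤ (Y : ℤ) := by
    intro τ i j hi hj h17
    have := cell_lt hi hj
    rw [h17, abs_of_nonneg (by positivity)]
    exact_mod_cast (by omega : i * n + j ≤ Y)
  rw [Subcubic.findLarger]
  refine (Run.seq_frame (T := 4) (T' := n * n * 120 + (n * n * 100 + (9 + (n * n * 100 + (3 +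
    (n * (n * (e.cost + 50) + 80 + 2 + 20) + (2 + 20) + 4)))))) (Run.set (Φ := fun τ => τ 4 0 = n) hY2
    (by simp) (by simp) (by simp) (by simpa [h0] using hnY') (by simp [h0])) fun τ₁ h4 f1 => ?_).imp
    (by nlinarith) (fun _ h => h)
  refine Run.seq_frame ((Run.fill (r := 4) (a := 38) (p := .ite (get 3 (lit 2 * var 17))
    (.set 38 (var 17) (lit 0)) (.set 38 (var 17) (get 3 (lit 2 * var 17 + lit 1)))) f hY2
    ⟨by simp, ⟨by simp, by simp⟩, by simp, by simp⟩ hn0 hnY (by omega)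
    (fun b hb => by simp [Program.mod, hb]) (by omega) (by omega) h4 ?_).imp
    (Nat.mul_le_mul_left _ (by simp [Program.cost])) (fun _ h => h.1)) ?_
  · intro i hi j hj τ hfr h17 _ _ _
    have e3 : τ 3 = σ 3 := by rw [hfr 3 (by omega) (by omega), f1 3 rfl]
    have et : τ 3 (2 * τ 17 0) = tag i j := by rw [e3, h17]
    have ev : τ 3 (2 * τ 17 0 + 1) = val i j := by rw [e3, h17]
    have hs := hix hi hj h17
    obtain ⟨h1, h2, h3⟩ := htv i hi j hj
    simp only [WP, Expr.small_get, Expr.small_mul, Expr.small_add, Expr.small_var, Expr.small_lit,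
      Expr.eval_get, Expr.eval_mul, Expr.eval_add, Expr.eval_var, Expr.eval_lit, et, ev, hs]
    rcases h1 with ⟨h1, h4⟩ | ⟨h1, h4⟩ <;> rw [h1, h4]
    · rw [h4] at h2 h3
      rw [abs_of_nonneg h2, h17]
      norm_num
      omega
    · rw [h17]
      norm_num
      omega
  intro τ₂ m2 f2
  refine Run.seq_frame (Run.weightBound (M := n * M) hY2 hn0 hnY (by omega) m2 (fun i hi j hj => by
    obtain ⟨-, h2, h3⟩ := htv i hi j hj
    rwa [abs_of_nonneg h2]) (by rw [f2 4 rfl, h4])) ?_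
  rintro τ₃ ⟨W, h24, hW1, hW2, hW3⟩ f3
  -- This stand-in for infinity exceeds every sum of at most `n` finite distances.
  obtain ⟨F, hF⟩ : ∃ F, F = 1 + n * W := ⟨_, rfl⟩
  have hnW : n * W ≤ n * (1 + n * n * (n * M * (n * M))) := Nat.mul_le_mul_left n hW2
  have hWn : W ≤ n * W := Nat.le_mul_of_pos_left _ hn0
  have hnF : n * F ≤ Y := (Nat.mul_le_mul_left n (by omega)).trans hY
  have hFY : F ≤ Y := by omega
  have e4 : τ₃ 4 0 = n := by rw [f3 4 rfl, f2 4 rfl, h4]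
  refine Run.seq_frame (T := 9) (Run.set (Φ := fun τ => τ 24 0 = F) hY2 (by simp) (by simp) (by simp)
    ?_ ?_) fun τ₄ h24' f4 => ?_
  · simp only [Expr.small_add, Expr.small_mul, Expr.small_lit, Expr.small_var, e4, h24, Nat.abs_cast]
    norm_num
    omega
  · simp [e4, h24, hF]
  -- Since `f` vanishes where the tag is `1`, this is the distance, or exactly `F` if it is
  -- infinite.
  set a : ℕ → ℕ → ℤ := fun i j => if i < n ∧ j < n then f i j + F * tag i j else 0 with ha
  have haF : ∀ i j, 0 ≤ a i j ∧ a i j ≤ F := by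
    intro i j
    rw [ha]
    beta_reduce
    split_ifs with hij
    · obtain ⟨h1, h2, -⟩ := htv i hij.1 j hij.2
      have h3 := le_of_abs_le (hW3 i hij.1 j hij.2)
      rcases h1 with ⟨h1, -⟩ | ⟨h1, h4⟩ <;> rw [h1]
      · omega
      · omega
    · omega
  refine Run.seq_frame ((Run.fill_expr (r := 4) (a := 34)
    (e := get 38 (var 17) + var 24 * get 3 (lit 2 * var 17)) a hY2 (by simp) hn0 hnY (by omega)
    (by omega) (by omega) (by rw [f4 4 rfl, e4]) ?_).imp (Nat.mul_le_mul_left _ (by simp))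
    (fun _ h => h.1)) ?_
  · intro i hi j hj τ hfr h17 _ _ _
    have e3 : τ 3 (2 * τ 17 0) = tag i j := by
      rw [hfr 3 (by omega) (by omega), f4 3 rfl, f3 3 rfl, f2 3 rfl, f1 3 rfl, h17]
    have e38 : τ 38 (τ 17 0) = f i j := by
      rw [hfr 38 (by omega) (by omega), f4 38 rfl, f3 38 rfl, h17, m2 i hi j hj]
    have e24 : τ 24 0 = F := by rw [hfr 24 (by omega) (by omega), h24']
    have hs := hix hi hj h17
    obtain ⟨h1, h2, h3⟩ := htv i hi j hj
    have h5 := hW3 i hi j hj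
    constructor
    · simp only [Expr.small_get, Expr.small_mul, Expr.small_add, Expr.small_var, Expr.small_lit,
        Expr.eval_mul, Expr.eval_var, Expr.eval_lit, e3, e38, e24, hs,
        Nat.abs_cast]
      rcases h1 with ⟨h1, -⟩ | ⟨h1, -⟩ <;> rw [h1] <;> norm_num <;> omega
    · simp only [Expr.eval_get, Expr.eval_mul, Expr.eval_add, Expr.eval_var, Expr.eval_lit, e3, e38,
        e24, ha]
      rw [if_pos ⟨hi, hj⟩]
  intro τ₅ m5 f5
  refine Run.seq_frame (T := 3) (Run.set (Φ := fun τ => τ 10 0 = -1) hY2 (by simp) (by simp) (by simp)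
    (by simp; omega) (by simp)) fun τ₆ h10 f6 => ?_
  have g4 : τ₆ 4 0 = n := by rw [f6 4 rfl, f5 4 rfl, f4 4 rfl, e4]
  have g24 : τ₆ 24 0 = F := by rw [f6 24 rfl, f5 24 rfl, h24']
  have g34 : Mat τ₆ 34 n a := m5.congr (f6 34 rfl)
  have hacc : ∀ v, 0 ≤ accumulate op (a v) n ∧ accumulate op (a v) n ≤ (n * F : ℕ) := fun v => by
    push_cast
    exact accumulate_mem D.nonneg D.le_add (haF v) n
  refine Run.seq_frame (Run.for (n := n) (T := n * (e.cost + 50) + 80) hY2 (by simp) hnY'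
    (fun k τ => (0 < k → τ 12 0 = score op a n F 0) ∧ Compared (score op a n F) k (τ 10 0)) rfl
    (fun k τ z h => by rwa [upd_of_ne (by omega), upd_of_ne (by omega)])
    ⟨by omega, Or.inl ⟨h10, by omega⟩⟩ ?_ ?_) ?_
  · intro τ hfr
    rw [Expr.small_var, Expr.eval_var, hfr 4 rfl (by omega), g4, Nat.abs_cast]
    exact ⟨by omega, rfl⟩
  · rintro v hv τ hfr h16 ⟨h12, h10⟩
    refine Run.imp (Run.seq_frame (T := n * (e.cost + 50) + 30) (T' := 50) (Run.combine D hY2 hnY hnF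
      (by rw [hfr 4 rfl (by omega), g4]) (by rw [hfr 24 rfl (by omega), g24]) h16 hv
      (g34.congr (hfr 34 rfl (by omega))) haF) fun τ' h11 f' => ?_) le_rfl (fun _ h => h)
    refine (Run.compareVertex (F := F) hY2 hnY' hFY hv (by rw [f' 16 rfl, h16])
      (by rw [f' 24 rfl, hfr 24 rfl (by omega), g24]) h11 ?_ ?_ (by rwa [f' 12 rfl])
      (by rwa [f' 10 rfl])).imp le_rfl (fun _ h => ⟨fun _ => h.1, h.2⟩)
    · rw [h11]
      have := hacc v
      omega
    · have := hacc 0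
      rw [score, abs_of_nonneg (by omega)]
      omega
  · rintro τ₇ ⟨-, hc⟩ f7
    have hr : |τ₇ 10 0| ≤ (Y : ℤ) := by
      rcases hc with ⟨h1, -⟩ | ⟨v, hv, h1, -⟩ | ⟨h1, -⟩ <;> rw [h1]
      · norm_num
        omega
      · rw [Nat.abs_cast]
        omega
      · simp
    refine (Run.set hY2 (by simp) (by simp) (by simp) (by simpa using hr) ?_).imp (by simp)
      (fun _ h => h)
    refine D.isAnswer (s := score op a n F) (F := F) (fun v => min_le_right _ _) (fun v => ?_) ?_
    · have hv : v.val < n := hn ▸ v.2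
      have hdist : ∀ u : Fin G.n, G.dist v u = decode F (a v u) := by
        intro u
        have hu : u.val < n := hn ▸ u.2
        have h3 := le_of_abs_le (hW3 v hv u hu)
        rw [ha]
        beta_reduce
        rw [if_pos ⟨hv, hu⟩, decode]
        rcases hcases v u with ⟨h1, -, -, h5⟩ | ⟨h1, h2⟩
        · rw [hf] at h3 ⊢
          beta_reduce at h3 ⊢
          rw [if_pos h1] at h3 ⊢
          rw [h1, if_neg (by omega), h5, mul_zero, add_zero]
        · rw [hf]
          beta_reduce
          simp [h1, h2]
      rw [score, hn]
      refine D.value G v (a v) F (by omega) (haF v) ?_ hdist fun hne => ?_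
      · have h1 := hdist v
        rw [hN.dist_self, decode] at h1
        split_ifs at h1 with h2
        · exact absurd (WithBot.coe_injective h1) WithTop.coe_ne_top
        · exact (WithTop.coe_injective (WithBot.coe_injective h1)).symm
      · have : ∑ u ∈ Finset.range G.n, a v u ≤ ∑ u ∈ Finset.range G.n, (W : ℤ) := by
          refine Finset.sum_le_sum fun u hu => ?_
          have hu := Finset.mem_range.1 hu
          have h1 := hne u hu
          rw [← hn] at hu
          have h3 := le_of_abs_le (hW3 v hv u hu)
          rw [ha] at h1 ⊢
          beta_reduce at h1 ⊢
          rw [if_pos ⟨hv, hu⟩] at h1 ⊢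
          rcases (htv v hv u hu).1 with ⟨h4, -⟩ | ⟨h4, h5⟩
          · rw [h4]
            omega
          · rw [h4, h5] at h1
            omega
        rw [Finset.sum_const, Finset.card_range, nsmul_eq_mul, show (G.n : ℤ) = n by rw [hn]] at this
        rw [hF]
        push_cast
        omega
    · rw [← hn, output, Expr.eval_lit, upd_cell]
      exact hc

/-- The scan takes quadratic time, which is within the bound once the saving is cut to at most `1`.
-/
theorem SolvesDistances.findLarger (h : SolvesDistances p Q β) (D : Aggregate P E op e) :
    (p.seq (findLarger e)).SolvesSubcubic P Q β := by
  obtain ⟨δ, hδ, c, k, r, h⟩ := h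
  refine ⟨min δ 1, lt_min hδ one_pos, c + (e.cost + 1000), k, r + 10 * 256, fun G M hG hM σ hσ => ?_⟩
  obtain ⟨σ₁, t₁, h1, ⟨h2, h3⟩, h4⟩ := h G M hM σ hσ
  have hn0 := G.n_pos
  obtain ⟨z, hz⟩ : ∃ z, z = G.n + M + 2 := ⟨_, rfl⟩
  have hY : G.n * (1 + G.n * (1 + G.n * G.n * (G.n * M * (G.n * M)))) ≤ z ^ 10 := by
    have hn : G.n ≤ z := by omega
    have hM' : M ≤ z := by omega
    have step : ∀ {x b : ℕ}, x ≤ z ^ b → 1 + x ≤ z ^ (b + 1) := fun {x b} hx => by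
      have := Nat.one_le_pow b z (by omega)
      rw [pow_succ]
      nlinarith
    have e1 : G.n * G.n * (G.n * M * (G.n * M)) ≤ z ^ 6 := by
      calc _ ≤ z * z * (z * z * (z * z)) := by gcongr
        _ = z ^ 6 := by ring
    have e2 := step (b := 7 + 1) (x := G.n * (1 + G.n * G.n * (G.n * M * (G.n * M)))) (by
      rw [pow_succ' z 7]
      exact Nat.mul_le_mul hn (step e1))
    calc _ ≤ z * z ^ (7 + 1 + 1) := Nat.mul_le_mul hn e2
      _ = z ^ 10 := by ring
  obtain ⟨σ₂, t₂, h5, h6, h7⟩ := Run.findLarger (Q := Q) (β := β) D hG hM h3 h2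
    ((by omega : 2 ≤ z).trans (Nat.le_self_pow (by omega) z)) hY
  rw [← pow_mul] at h5
  rw [← hz] at h1 ⊢
  refine ⟨σ₂, _, .seq (h1.mono (Nat.pow_le_pow_right (by omega) (by omega)))
    (h5.mono (Nat.pow_le_pow_right (by omega) (by omega))), h7, ?_⟩
  have h8 := h4.trans (subcubicBound_mono M hn0 (min_le_left δ 1) le_rfl le_rfl)
  have hn : (1 : ℝ) ≤ G.n := by exact_mod_cast hn0
  have h9 : (G.n : ℝ) * G.n ≤ (G.n : ℝ) ^ (3 - min δ 1) := by
    rw [← sq, ← Real.rpow_two]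
    exact Real.rpow_le_rpow_of_exponent_le hn (by linarith [min_le_right δ 1])
  have h10 : (1 : ℝ) ≤ ((Nat.log 2 (G.n + M + 2) : ℕ) : ℝ) ^ k :=
    one_le_pow₀ (by exact_mod_cast one_le_log G.n M)
  have h11 : (t₂ : ℝ) ≤ G.n * G.n * (e.cost + 1000) := by exact_mod_cast h6
  rw [subcubicBound] at h8 ⊢
  push_cast
  calc (t₁ + t₂ : ℝ) ≤ c * (G.n : ℝ) ^ (3 - min δ 1) * (Nat.log 2 (G.n + M + 2) : ℝ) ^ k +
        (G.n : ℝ) ^ (3 - min δ 1) * (e.cost + 1000) * (Nat.log 2 (G.n + M + 2) : ℝ) ^ k := by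
        refine add_le_add h8 (h11.trans ?_)
        refine le_trans ?_ (le_mul_of_one_le_right (by positivity) h10)
        gcongr
    _ = _ := by ring

end

theorem reducible_of_detector {Q : GraphProblem} {wt : Expr}
    {w : ℤ → (ℕ → ℕ → ℤ) → (ℕ → ℕ → ℤ) → (ℕ → ℕ → ℤ) → ℕ → ℕ → ℕ → ℕ → ℤ}
    (D : Detector Q wt w) : SubcubicReducible APSP Q :=
  ⟨apsp wt, fun _ h => (apsp_solvesDistances D h).solvesSubcubic⟩

theorem reducible_to_apsp {P : GraphProblem} {E : (G : WGraph) → Fin G.n → ExtInt}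
    {op : ℤ → ℤ → ℤ} {e : Expr} (D : Aggregate P E op e) : SubcubicReducible P APSP :=
  ⟨.seq .call (findLarger e), fun _ h => (call_solvesDistances h).findLarger D⟩

/-- The two programs are run one after the other: distances are computed with the black box for `Q`
and then scanned. This bypasses a general proof of transitivity, which would have to substitute
programs for calls. -/
theorem reducible_through_apsp {P Q : GraphProblem} {E : (G : WGraph) → Fin G.n → ExtInt}
    {op : ℤ → ℤ → ℤ} {e wt : Expr}
    {w : ℤ → (ℕ → ℕ → ℤ) → (ℕ → ℕ → ℤ) → (ℕ → ℕ → ℤ) → ℕ → ℕ → ℕ → ℕ → ℤ}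
    (D : Aggregate P E op e) (D' : Detector Q wt w) : SubcubicReducible P Q :=
  ⟨.seq (apsp wt) (findLarger e), fun _ h => (apsp_solvesDistances D' h).findLarger D⟩

end Subcubic

theorem theorem1p2 :
    Subcubic.SubcubicEquivalent Subcubic.APSP Subcubic.CoMedian ∧
      Subcubic.SubcubicEquivalent Subcubic.APSP Subcubic.CoRadius ∧
      Subcubic.SubcubicEquivalent Subcubic.CoMedian Subcubic.CoRadius := by
  open Subcubic in
  exact ⟨⟨reducible_of_detector detector_coMedian, reducible_to_apsp aggregate_coMedian⟩,
    ⟨reducible_of_detector detector_coRadius, reducible_to_apsp aggregate_coRadius⟩,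
    reducible_through_apsp aggregate_coMedian detector_coRadius,
    reducible_through_apsp aggregate_coRadius detector_coMedian⟩
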